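/- **Theorem (Cartan model as restricted BRST algebra).** Let $G$ be a (finite-dimensional, real) Lie group with Lie algebra $\mathfrak g$, acting smoothly (on the left) on a Hausdorff smooth manifold $M$. For $\xi\in\mathfrak g$ let $V_\xi$ be the vector field on $M$ with $(V_\xi f)(x)=-\frac{d}{dt}\big|_{t=0}f(\exp(t\xi)x)$, so that $\xi\mapsto V_\xi$ is a homomorphism of Lie algebras. Let $(\xi_a)$ be a basis of $\mathfrak g$, with $[\xi_b,\xi_c]=f^a_{bc}\xi_a$ (repeated indices are summed), and let $\iota_a$ and $\mathcal L_a$ be the interior product and the Lie derivative along $V_{\xi_a}$ on the differential forms $\Omega(M)$. Let $W(\mathfrak g)=S(\mathfrak g^*)\otimes\Lambda(\mathfrak g^*)$ be the Weil algebra, generated by $\phi^a$ (degree $2$) and $\omega^a$ (degree $1$), with the differential $d_W\omega^a=\phi^a-\frac12f^a_{bc}\omega^b\omega^c$, $d_W\phi^a=-f^a_{bc}\omega^b\phi^c$, the interior products $I_a\omega^b=\delta_a^b$, $I_a\phi^b=0$, and the Lie derivatives $L_a=I_ad_W+d_WI_a$. All tensor products are graded, operators on them obey the sign rule, and degrees are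 total degrees. On one and the same algebra $A=B=W(\mathfrak g)\otimes\Omega(M)$ put $$d=d_W\otimes1+1\otimes d,\qquad \delta=d+\omega^a\otimes\mathcal L_a-\phi^b\otimes\iota_b,\qquad \psi=\exp(-\omega^a\otimes\iota_a),$$ where $d$ in $1\otimes d$ is the exterior derivative. Let $$A_{\rm basic}=(W(\mathfrak g)\otimes\Omega(M))_{\rm basic}=\bigcap_a\ker(I_a\otimes1+1\otimes\iota_a)\cap\bigcap_b\ker(L_b\otimes1+1\otimes\mathcal L_b),$$ let $(S(\mathfrak g^*)\otimes\Omega(M))^G$ be the subalgebra of the infinitesimally invariant elements of $S(\mathfrak g^*)\otimes\Omega(M)$, i.e. those annihilated by the action of $\mathfrak g$ (the coadjoint action on $S(\mathfrak g^*)$ and the Lie derivative on $\Omega(M)$), and let $D=1\otimes d-\phi^b\otimes\iota_b$ be the Cartan differential on it. Let $j:S(\mathfrak g^*)\otimes\Omega(M)\to W(\mathfrak g)\otimes\Omega(M)$ be the inclusion, and let $p:W(\mathfrak g)\otimes\Omega(M)\to S(\mathfrak g^*)\otimes\Omega(M)$ be the algebra homomorphism given by $\omega^a\mapsto0$ (and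 the identity on $\phi^a$ and on $\Omega(M)$). Then: 1. $(A,d)$ and $(B,\delta)$ are differential algebras: $d$ and $\delta$ are antiderivations of degree $1$ and of square zero. The differential $d$ maps $A_{\rm basic}$ to itself, and $D$ is an antiderivation of degree $1$ and of square zero of the algebra $(S(\mathfrak g^*)\otimes\Omega(M))^G$. 2. $j$ is injective with image $\bigcap_a\ker(I_a\otimes1)$, the algebra of the $\omega$-independent elements of $B$; the image under $j$ of $(S(\mathfrak g^*)\otimes\Omega(M))^G$ is the algebra of those $\omega$-independent elements that are annihilated by all $L_a\otimes1+1\otimes\mathcal L_a$; and on it $\delta$ restricts to the Cartan differential: $\delta\circ j=j\circ D$ on $(S(\mathfrak g^*)\otimes\Omega(M))^G$. 3. $(\omega^a\otimes\iota_a)^{\dim\mathfrak g+1}=0$, so the series defining $\psi$ terminates, and $\psi$ is an isomorphism of differential algebras $(B,\delta)\to(A,d)$: a degree-preserving automorphism of the algebra $W(\mathfrak g)\otimes\Omega(M)$ with $\psi\delta=d\psi$. 4. $\psi$ maps $j\big((S(\mathfrak g^*)\otimes\Omega(M))^G\big)$ onto $A_{\rm basic}$, and the restriction of $\psi^{-1}$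 to $A_{\rm basic}$ is $\omega^a\mapsto0$, i.e. $\psi^{-1}=j\circ p$ on $A_{\rm basic}$. 5. Hence $p$ restricts to a degree-preserving isomorphism of algebras $A_{\rm basic}\to(S(\mathfrak g^*)\otimes\Omega(M))^G$, with inverse $\psi\circ j$ and with $D\circ p=p\circ d$ on $A_{\rm basic}$: the Weil model $(A_{\rm basic},d)$ and the Cartan model $((S(\mathfrak g^*)\otimes\Omega(M))^G,D)$ are isomorphic as differential algebras. -/

import Mathlib

open scoped Manifold ContDiff TensorProduct

noncomputable section

namespace EquivariantForms

section Alternating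

variable (R V : Type*) [CommRing R] [AddCommGroup V] [Module R V]

/-- Alternating `R`-multilinear forms of degree `n` on the `R`-module `V`. -/
abbrev AltForm (n : ℕ) : Type _ := V [⋀^Fin n]→ₗ[R] R

/-- Families of alternating forms, one in each degree. -/
def Cochain : Type _ := (n : ℕ) → AltForm R V n

instance : AddCommGroup (Cochain R V) := inferInstanceAs (AddCommGroup ((n : ℕ) → AltForm R V n))
instance : Module R (Cochain R V) := inferInstanceAs (Module R ((n : ℕ) → AltForm R V n))

variable {R V}

@[ext] theorem Cochain.ext {α β : Cochain R V} (h : ∀ n, α n = β n) : α = β := funext h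
@[simp] theorem Cochain.add_apply (α β : Cochain R V) (n : ℕ) : (α + β) n = α n + β n := rfl
@[simp] theorem Cochain.sub_apply (α β : Cochain R V) (n : ℕ) : (α - β) n = α n - β n := rfl
@[simp] theorem Cochain.neg_apply (α : Cochain R V) (n : ℕ) : (-α) n = -α n := rfl
@[simp] theorem Cochain.zero_apply (n : ℕ) : (0 : Cochain R V) n = 0 := rfl
@[simp] theorem Cochain.smul_apply (f : R) (α : Cochain R V) (n : ℕ) : (f • α) n = f • α n := rfl

theorem alt_ext_zero {α β : AltForm R V 0} (h : α ![] = β ![]) : α = β := by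
  ext v
  rw [Subsingleton.elim v ![]]
  exact h

theorem alt_ext_succ {n : ℕ} {α β : AltForm R V (n + 1)}
    (h : ∀ X, α.curryLeft X = β.curryLeft X) : α = β := by
  ext v
  have := congrArg (fun γ : AltForm R V n => γ (Matrix.vecTail v)) (h (Matrix.vecHead v))
  simpa using this

theorem alt_eq_zero_of_curryLeft {n : ℕ} (α : AltForm R V (n + 1)) (X : V)
    (h : α.curryLeft X = 0) (v : Fin (n + 1) → V) (i : Fin (n + 1)) (hv : v i = X) :
    α v = 0 := by
  have key : ∀ w : Fin (n + 1) → V, w 0 = X → α w = 0 := by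
    intro w hw
    have := congrArg (fun γ : AltForm R V n => γ (Matrix.vecTail w)) h
    have e : Matrix.vecCons X (Matrix.vecTail w) = w := by
      rw [← hw]; exact Matrix.cons_head_tail w
    simpa [e] using this
  by_cases hi : i = 0
  · subst hi; exact key v hv
  · have := α.map_swap v (i := 0) (j := i) (Ne.symm hi)
    rw [key (v ∘ Equiv.swap 0 i) (by simpa using hv)] at this
    exact neg_eq_zero.mp this.symm

/-- The alternating form `(v₀, v₁, …, vₙ) ↦ F v₀ (v₁, …, vₙ)`. -/
def uncurryAlt {n : ℕ} (F : V →ₗ[R] AltForm R V n)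
    (hF : ∀ (X : V) (v : Fin n → V) (i : Fin n), v i = X → F X v = 0) :
    AltForm R V (n + 1) :=
  { LinearMap.uncurryLeft (AlternatingMap.toMultilinearMapLM ∘ₗ F) with
    map_eq_zero_of_eq' := by
      intro v i j hij hne
      change F (v 0) (Fin.tail v) = 0
      rcases Fin.eq_zero_or_eq_succ i with rfl | ⟨i, rfl⟩
      · rcases Fin.eq_zero_or_eq_succ j with rfl | ⟨j, rfl⟩
        · exact absurd rfl hne
        · exact hF _ _ j hij.symm
      · rcases Fin.eq_zero_or_eq_succ j with rfl | ⟨j, rfl⟩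
        · exact hF _ _ i hij
        · exact (F (v 0)).map_eq_zero_of_eq _ hij (fun h => hne (by rw [h])) }

@[simp] theorem uncurryAlt_curryLeft {n : ℕ} (F : V →ₗ[R] AltForm R V n) (hF) (X : V) :
    (uncurryAlt F hF).curryLeft X = F X := by
  ext v
  rfl

/-- The interior product `ι_X`: inserting `X` into the first slot. -/
def contr (X : V) : Cochain R V →ₗ[R] Cochain R V where
  toFun α := fun n => (α (n + 1)).curryLeft X
  map_add' _ _ := rfl
  map_smul' _ _ := rfl

theorem contr_apply (X : V) (α : Cochain R V) (n : ℕ) :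
    contr X α n = (α (n + 1)).curryLeft X := rfl

theorem contr_contr (X : V) (α : Cochain R V) : contr X (contr X α) = 0 := by
  ext n v
  simp [contr_apply]

theorem contr_add (X Y : V) (α : Cochain R V) :
    contr (X + Y) α = contr X α + contr Y α := by
  ext n v
  simp [contr_apply]

theorem contr_smul (f : R) (X : V) (α : Cochain R V) :
    contr (f • X) α = f • contr X α := by
  ext n v
  simp [contr_apply]

theorem contr_swap (X Y : V) (α : Cochain R V) :
    contr X (contr Y α) = -contr Y (contr X α) := by
  have := contr_contr (X + Y) α
  rw [contr_add X Y α, map_add, contr_add, contr_add, contr_contr, contr_contr] at this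
  rw [zero_add, add_zero] at this
  exact eq_neg_of_add_eq_zero_right this

/-- The parity operator, `(-1)ⁿ` in degree `n`. -/
def sign : Cochain R V →ₗ[R] Cochain R V where
  toFun α := fun n => (-1 : R) ^ n • α n
  map_add' α β := Cochain.ext fun n => smul_add _ (α n) (β n)
  map_smul' f α := Cochain.ext fun n => smul_comm _ f (α n)

theorem sign_apply (α : Cochain R V) (n : ℕ) : sign α n = (-1 : R) ^ n • α n := rfl

theorem sign_sign (α : Cochain R V) : sign (sign α) = α := by
  ext n : 1
  rw [sign_apply, sign_apply, smul_smul, ← mul_pow]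
  simp

theorem contr_sign (X : V) (α : Cochain R V) : contr X (sign α) = -sign (contr X α) := by
  ext n v
  simp [contr_apply, sign_apply, pow_succ]

/-- The data of the degree `n` part of a product for which the interior products are
antiderivations. -/
abbrev WedgeStep (R V : Type*) [CommRing R] [AddCommGroup V] [Module R V] (n : ℕ) : Type _ :=
  { B : Cochain R V →ₗ[R] Cochain R V →ₗ[R] AltForm R V n //
    ∀ (α β : Cochain R V) (X : V) (v : Fin n → V) (i : Fin n), v i = X →
      (B (contr X α) β + B (sign α) (contr X β)) v = 0 }

def wedgeZero : WedgeStep R V 0 :=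
  ⟨LinearMap.mk₂ R
      (fun α β => AlternatingMap.constOfIsEmpty R V (Fin 0) (α 0 ![] * β 0 ![]))
      (fun _ _ _ => alt_ext_zero (by simp [add_mul]))
      (fun _ _ _ => alt_ext_zero (by simp [mul_assoc]))
      (fun _ _ _ => alt_ext_zero (by simp [mul_add]))
      (fun _ _ _ => alt_ext_zero (by simp [mul_left_comm])),
    fun _ _ _ _ i => i.elim0⟩

def wedgeSuccFun {n : ℕ} (B : WedgeStep R V n) (α β : Cochain R V) : AltForm R V (n + 1) :=
  uncurryAlt
    { toFun := fun X => B.1 (contr X α) β + B.1 (sign α) (contr X β)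
      map_add' := fun X Y => by
        simp only [contr_add, map_add, LinearMap.add_apply]; abel
      map_smul' := fun f X => by
        simp only [contr_smul, map_smul, LinearMap.smul_apply, smul_add, RingHom.id_apply] }
    (fun X v i h => B.2 α β X v i h)

theorem wedgeSuccFun_curryLeft {n : ℕ} (B : WedgeStep R V n) (α β : Cochain R V) (X : V) :
    (wedgeSuccFun B α β).curryLeft X = B.1 (contr X α) β + B.1 (sign α) (contr X β) :=
  uncurryAlt_curryLeft _ _ X

theorem curryLeft_add' {n : ℕ} (α β : AltForm R V (n + 1)) (X : V) :
    (α + β).curryLeft X = α.curryLeft X + β.curryLeft X := rfl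
theorem curryLeft_sub' {n : ℕ} (α β : AltForm R V (n + 1)) (X : V) :
    (α - β).curryLeft X = α.curryLeft X - β.curryLeft X := rfl
theorem curryLeft_smul' {n : ℕ} (f : R) (α : AltForm R V (n + 1)) (X : V) :
    (f • α).curryLeft X = f • α.curryLeft X := rfl

def wedgeSucc {n : ℕ} (B : WedgeStep R V n) : WedgeStep R V (n + 1) :=
  ⟨LinearMap.mk₂ R (wedgeSuccFun B)
      (fun _ _ _ => alt_ext_succ fun X => by
        simp only [curryLeft_add', wedgeSuccFun_curryLeft, map_add, LinearMap.add_apply]; abel)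
      (fun _ _ _ => alt_ext_succ fun X => by
        simp only [curryLeft_smul', wedgeSuccFun_curryLeft, map_smul, LinearMap.smul_apply,
          smul_add])
      (fun _ _ _ => alt_ext_succ fun X => by
        simp only [curryLeft_add', wedgeSuccFun_curryLeft, map_add]; abel)
      (fun _ _ _ => alt_ext_succ fun X => by
        simp only [curryLeft_smul', wedgeSuccFun_curryLeft, map_smul, smul_add]),
    fun α β X v i h => alt_eq_zero_of_curryLeft _ X
      (by
        simp only [LinearMap.mk₂_apply, curryLeft_add', wedgeSuccFun_curryLeft, contr_contr,
          contr_sign, sign_sign, map_zero, map_neg, LinearMap.zero_apply, LinearMap.neg_apply]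
        abel) v i h⟩

/-- The degree `n` part of the wedge product, by recursion on `n`. -/
def wedgeAux : (n : ℕ) → WedgeStep R V n
  | 0 => wedgeZero
  | n + 1 => wedgeSucc (wedgeAux n)

/-- The wedge product, characterised by `(α ∧ β)₀ = α₀ β₀` and
`ι_X (α ∧ β) = ι_X α ∧ β + (-1)^|α| α ∧ ι_X β`. -/
instance : Mul (Cochain R V) := ⟨fun α β n => (wedgeAux n).1 α β⟩

/-- The form of degree `0` given by `f`. -/
def constForm (f : R) : Cochain R V
  | 0 => AlternatingMap.constOfIsEmpty R V (Fin 0) f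
  | _ + 1 => 0

instance : One (Cochain R V) := ⟨constForm 1⟩

theorem one_def : (1 : Cochain R V) = constForm 1 := rfl

theorem mul_apply (α β : Cochain R V) (n : ℕ) : (α * β) n = (wedgeAux n).1 α β := rfl

theorem mul_zero_apply (α β : Cochain R V) : (α * β) 0 ![] = α 0 ![] * β 0 ![] := rfl

theorem contr_mul (X : V) (α β : Cochain R V) :
    contr X (α * β) = contr X α * β + sign α * contr X β := by
  ext n : 1
  exact wedgeSuccFun_curryLeft _ _ _ X

theorem contr_constForm (X : V) (f : R) : contr X (constForm f : Cochain R V) = 0 := by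
  ext n v
  simp [contr_apply, constForm]

theorem sign_constForm (f : R) : sign (constForm f : Cochain R V) = constForm f := by
  ext n : 1
  cases n <;> simp [sign_apply, constForm]

theorem mul_apply_succ (X : V) (α β : Cochain R V) (n : ℕ) :
    ((α * β) (n + 1)).curryLeft X = (contr X α * β) n + (sign α * contr X β) n :=
  congrFun (contr_mul X α β) n

theorem constForm_mul (f : R) (β : Cochain R V) : constForm f * β = f • β := by
  have key : ∀ n (β : Cochain R V), (constForm f * β : Cochain R V) n = f • β n := by
    intro n
    induction n with
    | zero => exact fun β => alt_ext_zero (by simp [mul_zero_apply, constForm])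
    | succ n ih =>
      intro β
      refine alt_ext_succ fun X => ?_
      rw [mul_apply_succ, contr_constForm, sign_constForm, ih, mul_apply, map_zero]
      exact zero_add _
  ext n : 1
  exact key n β

theorem mul_constForm (f : R) (α : Cochain R V) : α * constForm f = f • α := by
  have key : ∀ n (α : Cochain R V), (α * constForm f : Cochain R V) n = f • α n := by
    intro n
    induction n with
    | zero => exact fun α => alt_ext_zero (by simp [mul_zero_apply, constForm, mul_comm])
    | succ n ih =>
      intro α
      refine alt_ext_succ fun X => ?_
      rw [mul_apply_succ, contr_constForm, ih, mul_apply, map_zero]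
      exact add_zero _
  ext n : 1
  exact key n α

theorem sign_mul (α β : Cochain R V) : sign (α * β) = sign α * sign β := by
  have key : ∀ n (α β : Cochain R V), sign (α * β) n = (sign α * sign β) n := by
    intro n
    induction n with
    | zero =>
      exact fun α β => alt_ext_zero (by simp [sign_apply, mul_zero_apply])
    | succ n ih =>
      intro α β
      refine alt_ext_succ fun X => ?_
      have h1 : ((sign (α * β)) (n + 1)).curryLeft X = contr X (sign (α * β)) n := rfl
      rw [h1, contr_sign, contr_mul, mul_apply_succ, contr_sign, contr_sign, map_add,
        Cochain.neg_apply, Cochain.add_apply, ih, ih, mul_apply, mul_apply, mul_apply, mul_apply,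
        map_neg, map_neg, LinearMap.neg_apply, neg_add]
  ext n : 1
  exact key n α β

theorem mul_assoc_aux (α β γ : Cochain R V) : α * β * γ = α * (β * γ) := by
  have add_m : ∀ (n : ℕ) (a b c : Cochain R V), ((a + b) * c) n = (a * c) n + (b * c) n := by
    intro n a b c
    simp only [mul_apply, map_add, LinearMap.add_apply]
  have m_add : ∀ (n : ℕ) (a b c : Cochain R V), (a * (b + c)) n = (a * b) n + (a * c) n := by
    intro n a b c
    simp only [mul_apply, map_add]
  have key : ∀ n (α β γ : Cochain R V), (α * β * γ) n = (α * (β * γ)) n := by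
    intro n
    induction n with
    | zero =>
      exact fun α β γ => alt_ext_zero (by simp [mul_zero_apply, mul_assoc])
    | succ n ih =>
      intro α β γ
      refine alt_ext_succ fun X => ?_
      rw [mul_apply_succ, mul_apply_succ, contr_mul, contr_mul, sign_mul, add_m, m_add,
        ih, ih, ih, add_assoc]
  ext n : 1
  exact key n α β γ

instance : Ring (Cochain R V) :=
  { (inferInstance : AddCommGroup (Cochain R V)) with
    mul := (· * ·)
    one := 1
    left_distrib := fun α β γ => Cochain.ext fun n => by
      simp only [mul_apply, map_add, Cochain.add_apply]
    right_distrib := fun α β γ => Cochain.ext fun n => by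
      simp only [mul_apply, map_add, Cochain.add_apply, LinearMap.add_apply]
    zero_mul := fun α => Cochain.ext fun n => by
      simp only [mul_apply, map_zero, LinearMap.zero_apply, Cochain.zero_apply]
    mul_zero := fun α => Cochain.ext fun n => by
      simp only [mul_apply, map_zero, Cochain.zero_apply]
    mul_assoc := mul_assoc_aux
    one_mul := fun α => (constForm_mul 1 α).trans (one_smul R α)
    mul_one := fun α => (mul_constForm 1 α).trans (one_smul R α) }

instance : Algebra R (Cochain R V) :=
  Algebra.ofModule
    (fun f α β => by rw [← constForm_mul, ← constForm_mul, mul_assoc])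
    (fun f α β => Cochain.ext fun n => by
      simp only [mul_apply, map_smul, Cochain.smul_apply])

theorem wedge_eq_zero (n : ℕ) :
    ∀ (p q : ℕ) (α β : Cochain R V), (∀ k, p ≤ k → α k = 0) → (∀ k, q ≤ k → β k = 0) →
      p + q ≤ n + 1 → (α * β) n = 0 := by
  induction n with
  | zero =>
    intro p q α β hα hβ hpq
    refine alt_ext_zero ?_
    rw [mul_zero_apply]
    rcases Nat.eq_zero_or_pos p with hp | hp
    · rw [hα 0 hp.le]; simp
    · rw [hβ 0 (by omega)]; simp
  | succ n ih =>
    intro p q α β hα hβ hpq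
    refine alt_ext_succ fun X => ?_
    have c0 : ∀ (r : ℕ) (γ : Cochain R V), (∀ k, r ≤ k → γ k = 0) →
        ∀ k, r - 1 ≤ k → contr X γ k = 0 := fun r γ h k hk => by
      rw [contr_apply, h (k + 1) (by omega)]; rfl
    have z0 : ∀ (γ : Cochain R V), (∀ k, 0 ≤ k → γ k = 0) → γ = 0 := fun γ h =>
      Cochain.ext fun k => h k (Nat.zero_le k)
    rw [mul_apply_succ]
    have h1 : (contr X α * β) n = 0 := by
      rcases Nat.eq_zero_or_pos p with hp | hp
      · subst hp; rw [z0 α hα, map_zero, zero_mul]; rfl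
      · exact ih (p - 1) q _ _ (c0 p α hα) hβ (by omega)
    have h2 : (sign α * contr X β) n = 0 := by
      rcases Nat.eq_zero_or_pos q with hq | hq
      · subst hq; rw [z0 β hβ, map_zero, mul_zero]; rfl
      · exact ih p (q - 1) _ _ (fun k hk => by rw [sign_apply, hα k hk, smul_zero])
          (c0 q β hβ) (by omega)
    rw [h1, h2, add_zero]
    rfl

end Alternating

section DeRham

variable (R : Type*) [CommRing R] [Algebra ℝ R]

/-- Vector fields, as derivations of the algebra `R` of functions. If `R` is the algebra of smooth
functions on a Hausdorff manifold, these are the smooth vector fields, and the smooth differential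
forms of degree `n` are the alternating `R`-multilinear maps of degree `n` on them. -/
abbrev VField : Type _ := Derivation ℝ R R

variable {R}

instance {V : Type*} [AddCommGroup V] [Module R V] : Algebra ℝ (Cochain R V) :=
  Algebra.compHom (Cochain R V) (algebraMap ℝ R)

theorem Cochain.real_smul_def {V : Type*} [AddCommGroup V] [Module R V] (c : ℝ)
    (α : Cochain R V) : c • α = algebraMap ℝ R c • α := rfl

instance {V : Type*} [AddCommGroup V] [Module R V] : IsScalarTower ℝ R (Cochain R V) :=
  ⟨fun c f α => by rw [Cochain.real_smul_def, Algebra.smul_def c f, mul_smul]⟩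

theorem lie_smul_vfield (X Y : VField R) (f : R) : ⁅X, f • Y⁆ = f • ⁅X, Y⁆ + X f • Y := by
  ext g
  simp [Derivation.commutator_apply]

theorem smul_lie_vfield (X Y : VField R) (f : R) : ⁅f • X, Y⁆ = f • ⁅X, Y⁆ - Y f • X := by
  rw [← lie_skew, lie_smul_vfield, ← lie_skew X Y]
  simp only [smul_neg, neg_add_rev]
  abel

/-- The data of the Lie derivative along `X` in degree `n`. -/
abbrev LieStep (X : VField R) (n : ℕ) : Type _ :=
  { T : Cochain R (VField R) →+ AltForm R (VField R) n //
    (∀ (f : R) (α : Cochain R (VField R)), T (f • α) = X f • α n + f • T α) ∧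
    ∀ (α : Cochain R (VField R)) (Y : VField R) (v : Fin n → VField R) (i : Fin n), v i = Y →
      (T (contr Y α) - contr ⁅X, Y⁆ α n) v = 0 }

def lieZero (X : VField R) : LieStep X 0 :=
  ⟨{ toFun := fun α => AlternatingMap.constOfIsEmpty R (VField R) (Fin 0) (X (α 0 ![]))
     map_zero' := alt_ext_zero (by simp)
     map_add' := fun _ _ => alt_ext_zero (by simp) },
   fun f α => alt_ext_zero (by simp [mul_comm, add_comm]),
   fun _ _ _ i => i.elim0⟩

def lieSuccFun (X : VField R) {n : ℕ} (T : LieStep X n) (α : Cochain R (VField R)) :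
    AltForm R (VField R) (n + 1) :=
  uncurryAlt
    { toFun := fun Y => T.1 (contr Y α) - contr ⁅X, Y⁆ α n
      map_add' := fun Y Z => by
        simp only [contr_add, map_add, lie_add, Cochain.add_apply]; abel
      map_smul' := fun f Y => by
        simp only [contr_smul, T.2.1, lie_smul_vfield, contr_add, Cochain.add_apply,
          Cochain.smul_apply, RingHom.id_apply, smul_sub]
        abel }
    (fun Y v i h => T.2.2 α Y v i h)

theorem lieSuccFun_curryLeft (X : VField R) {n : ℕ} (T : LieStep X n)
    (α : Cochain R (VField R)) (Y : VField R) :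
    (lieSuccFun X T α).curryLeft Y = T.1 (contr Y α) - contr ⁅X, Y⁆ α n :=
  uncurryAlt_curryLeft _ _ Y

def lieSucc (X : VField R) {n : ℕ} (T : LieStep X n) : LieStep X (n + 1) :=
  ⟨{ toFun := lieSuccFun X T
     map_zero' := alt_ext_succ fun Y => by
       rw [lieSuccFun_curryLeft, map_zero, map_zero, map_zero]
       exact sub_zero _
     map_add' := fun α β => alt_ext_succ fun Y => by
       simp only [curryLeft_add', lieSuccFun_curryLeft, map_add, Cochain.add_apply]; abel },
   fun f α => alt_ext_succ fun Y => by
     change (lieSuccFun X T _).curryLeft Y = X f • contr Y α n + f • (lieSuccFun X T α).curryLeft Y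
     simp only [lieSuccFun_curryLeft, map_smul, T.2.1, Cochain.smul_apply, smul_sub]
     abel,
   fun α Y v i h => alt_eq_zero_of_curryLeft _ Y
     (by
       change (lieSuccFun X T _).curryLeft Y - contr Y (contr ⁅X, Y⁆ α) n = 0
       rw [lieSuccFun_curryLeft, contr_contr, map_zero, contr_swap Y]
       simp) v i h⟩

def lieAux (X : VField R) : (n : ℕ) → LieStep X n
  | 0 => lieZero X
  | n + 1 => lieSucc X (lieAux X n)

/-- The Lie derivative `𝓛_X`, characterised by `𝓛_X f = X f` on functions and
`ι_Y (𝓛_X α) = 𝓛_X (ι_Y α) - ι_[X, Y] α`. -/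
def lieDer (X : VField R) : Cochain R (VField R) →ₗ[ℝ] Cochain R (VField R) where
  toFun α := fun n => (lieAux X n).1 α
  map_add' α β := Cochain.ext fun n => map_add _ α β
  map_smul' c α := Cochain.ext fun n => by
    change (lieAux X n).1 (algebraMap ℝ R c • α) = algebraMap ℝ R c • (lieAux X n).1 α
    rw [(lieAux X n).2.1, X.map_algebraMap, zero_smul, zero_add]

theorem lieDer_zero_apply (X : VField R) (α : Cochain R (VField R)) :
    lieDer X α 0 ![] = X (α 0 ![]) := rfl

theorem lieDer_smul (X : VField R) (f : R) (α : Cochain R (VField R)) :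
    lieDer X (f • α) = X f • α + f • lieDer X α :=
  Cochain.ext fun n => (lieAux X n).2.1 f α

theorem contr_lieDer (X Y : VField R) (α : Cochain R (VField R)) :
    contr Y (lieDer X α) = lieDer X (contr Y α) - contr ⁅X, Y⁆ α := by
  ext n : 1
  exact lieSuccFun_curryLeft X (lieAux X n) α Y

theorem lieDer_apply_succ (X Y : VField R) (α : Cochain R (VField R)) (n : ℕ) :
    ((lieDer X α) (n + 1)).curryLeft Y = (lieDer X (contr Y α)) n - contr ⁅X, Y⁆ α n :=
  congrFun (contr_lieDer X Y α) n

/-- The usual formula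
`(𝓛_X α)(v₁, …, vₙ) = X (α(v₁, …, vₙ)) - ∑ᵢ α(v₁, …, [X, vᵢ], …, vₙ)`. -/
theorem lieDer_apply (X : VField R) (n : ℕ) (α : Cochain R (VField R)) (v : Fin n → VField R) :
    lieDer X α n v = X (α n v) - ∑ i, α n (Function.update v i ⁅X, v i⁆) := by
  induction n generalizing α with
  | zero =>
    rw [Subsingleton.elim v ![], lieDer_zero_apply]
    simp
  | succ n ih =>
    have h := congrArg (fun γ : AltForm R (VField R) n => γ (Fin.tail v))
      (lieDer_apply_succ X (v 0) α n)
    have e : ∀ Y : VField R, ∀ w : Fin n → VField R, contr Y α n w = α (n + 1) (Fin.cons Y w) :=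
      fun Y w => rfl
    have h0 : ((lieDer X α (n + 1)).curryLeft (v 0)) (Fin.tail v) = lieDer X α (n + 1) v := by
      change lieDer X α (n + 1) (Fin.cons (v 0) (Fin.tail v)) = _
      rw [Fin.cons_self_tail]
    have h2 : Function.update v 0 ⁅X, v 0⁆ = Fin.cons ⁅X, v 0⁆ (Fin.tail v) := by
      conv_lhs => rw [← Fin.cons_self_tail v]
      rw [Fin.update_cons_zero, Fin.cons_zero]
    simp only [AlternatingMap.sub_apply] at h
    rw [h0, ih] at h
    rw [h, Fin.sum_univ_succ, h2]
    have hs : ∀ i : Fin n, Fin.cons (v 0) (Function.update (Fin.tail v) i ⁅X, Fin.tail v i⁆) =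
        Function.update v i.succ ⁅X, v i.succ⁆ := fun i => by
      rw [Fin.cons_update, Fin.cons_self_tail]
      rfl
    simp only [e, Fin.cons_self_tail, hs]
    abel

theorem lieDer_add_left (X Y : VField R) (α : Cochain R (VField R)) :
    lieDer (X + Y) α = lieDer X α + lieDer Y α := by
  ext n v
  simp only [lieDer_apply, Cochain.add_apply, AlternatingMap.add_apply, Derivation.add_apply,
    add_lie, AlternatingMap.map_update_add, Finset.sum_add_distrib]
  ring

/-- The `1`-form `df : X ↦ X f`. -/
def dFun (f : R) : Cochain R (VField R)
  | 0 => 0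
  | 1 => AlternatingMap.ofSubsingleton R (VField R) R 0
      { toFun := fun X => X f
        map_add' := fun _ _ => rfl
        map_smul' := fun _ _ => rfl }
  | _ + 2 => 0

theorem dFun_zero_apply (f : R) : dFun f 0 = 0 := rfl
theorem dFun_one_apply (f : R) (v : Fin 1 → VField R) : dFun f 1 v = v 0 f := rfl
theorem dFun_add_two_apply (f : R) (n : ℕ) : dFun f (n + 2) = 0 := rfl

theorem contr_dFun (X : VField R) (f : R) : contr X (dFun f) = constForm (X f) := by
  ext n v
  cases n with
  | zero => rfl
  | succ n => rfl

theorem sign_dFun (f : R) : sign (dFun f) = - dFun f := by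
  ext n : 1
  rw [sign_apply, Cochain.neg_apply]
  match n with
  | 0 => rw [dFun_zero_apply, smul_zero, neg_zero]
  | 1 => exact (congrArg (· • dFun f 1) (pow_one (-1 : R))).trans (neg_one_smul R (dFun f 1))
  | n + 2 => rw [dFun_add_two_apply, smul_zero, neg_zero]

theorem lieDer_smul_left (f : R) (X : VField R) (α : Cochain R (VField R)) :
    lieDer (f • X) α = f • lieDer X α + dFun f * contr X α := by
  have key : ∀ n (α : Cochain R (VField R)),
      lieDer (f • X) α n = (f • lieDer X α + dFun f * contr X α) n := by
    intro n
    induction n with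
    | zero =>
      intro α
      refine alt_ext_zero ?_
      rw [Cochain.add_apply, AlternatingMap.add_apply, mul_zero_apply]
      rw [dFun_zero_apply]
      simp [lieDer_zero_apply]
    | succ n ih =>
      intro α
      refine alt_ext_succ fun Y => ?_
      rw [lieDer_apply_succ, ih]
      change _ = contr Y (f • lieDer X α + dFun f * contr X α) n
      rw [map_add, map_smul, contr_mul, contr_dFun, sign_dFun, constForm_mul, contr_lieDer,
        smul_lie_vfield, contr_swap Y, sub_eq_add_neg (f • ⁅X, Y⁆), contr_add, contr_smul,
        ← neg_smul, contr_smul]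
      simp only [neg_mul_neg, smul_sub, Cochain.add_apply, Cochain.sub_apply, neg_smul,
        Cochain.neg_apply]
      abel
  ext n : 1
  exact key n α

/-- The data of the exterior derivative in degree `n`. -/
abbrev DStep (R : Type*) [CommRing R] [Algebra ℝ R] (n : ℕ) : Type _ :=
  { T : Cochain R (VField R) →+ AltForm R (VField R) n //
    (∀ (f : R) (α : Cochain R (VField R)), T (f • α) = f • T α + (dFun f * α) n) ∧
    ∀ (α : Cochain R (VField R)) (X : VField R) (v : Fin n → VField R) (i : Fin n), v i = X →
      (lieDer X α n - T (contr X α)) v = 0 }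

def dZero : DStep R 0 :=
  ⟨0, fun f α => alt_ext_zero (by
    rw [AlternatingMap.add_apply, mul_zero_apply, dFun_zero_apply]; simp), fun _ _ _ i => i.elim0⟩

def dSuccFun {n : ℕ} (T : DStep R n) (α : Cochain R (VField R)) :
    AltForm R (VField R) (n + 1) :=
  uncurryAlt
    { toFun := fun X => lieDer X α n - T.1 (contr X α)
      map_add' := fun X Y => by
        simp only [contr_add, map_add, lieDer_add_left, Cochain.add_apply]; abel
      map_smul' := fun f X => by
        simp only [contr_smul, T.2.1, lieDer_smul_left, Cochain.add_apply,
          Cochain.smul_apply, RingHom.id_apply, smul_sub]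
        abel }
    (fun X v i h => T.2.2 α X v i h)

theorem dSuccFun_curryLeft {n : ℕ} (T : DStep R n) (α : Cochain R (VField R)) (X : VField R) :
    (dSuccFun T α).curryLeft X = lieDer X α n - T.1 (contr X α) :=
  uncurryAlt_curryLeft _ _ X

def dSucc {n : ℕ} (T : DStep R n) : DStep R (n + 1) :=
  ⟨{ toFun := dSuccFun T
     map_zero' := alt_ext_succ fun Y => by
       rw [dSuccFun_curryLeft, map_zero, map_zero, map_zero]
       exact sub_zero _
     map_add' := fun α β => alt_ext_succ fun Y => by
       simp only [curryLeft_add', dSuccFun_curryLeft, map_add, Cochain.add_apply]; abel },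
   fun f α => alt_ext_succ fun X => by
     change (dSuccFun T _).curryLeft X = f • (dSuccFun T α).curryLeft X
       + contr X (dFun f * α) n
     simp only [dSuccFun_curryLeft, map_smul, T.2.1, lieDer_smul, contr_mul, contr_dFun,
       sign_dFun, constForm_mul, Cochain.add_apply, Cochain.smul_apply, smul_sub, neg_mul,
       Cochain.neg_apply]
     abel,
   fun α X v i h => alt_eq_zero_of_curryLeft _ X
     (by
       change contr X (lieDer X α) n - (dSuccFun T _).curryLeft X = 0
       rw [dSuccFun_curryLeft, contr_contr, map_zero, contr_lieDer, lie_self]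
       have h0 : contr (0 : VField R) α = 0 := by
         have := contr_smul (0 : R) (0 : VField R) α
         simpa using this
       rw [h0]
       simp) v i h⟩

def dAux : (n : ℕ) → DStep R n
  | 0 => dZero
  | n + 1 => dSucc (dAux n)

/-- The exterior derivative, characterised by Cartan's formula `ι_X d + d ι_X = 𝓛_X`. -/
def extD : Cochain R (VField R) →ₗ[ℝ] Cochain R (VField R) where
  toFun α := fun n => (dAux n).1 α
  map_add' α β := Cochain.ext fun n => map_add _ α β
  map_smul' c α := Cochain.ext fun n => by
    change (dAux n).1 (algebraMap ℝ R c • α) = algebraMap ℝ R c • (dAux n).1 α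
    have h : (dFun (algebraMap ℝ R c) : Cochain R (VField R)) = 0 := by
      ext n v
      match n with
      | 0 => rfl
      | 1 => exact (v 0).map_algebraMap c
      | n + 2 => rfl
    rw [(dAux n).2.1, h, zero_mul, Cochain.zero_apply, add_zero]

theorem extD_zero (α : Cochain R (VField R)) : extD α 0 = 0 := rfl

theorem contr_extD (X : VField R) (α : Cochain R (VField R)) :
    contr X (extD α) = lieDer X α - extD (contr X α) := by
  ext n : 1
  exact dSuccFun_curryLeft (dAux n) α X

theorem lieDer_constForm (X : VField R) (f : R) :
    lieDer X (constForm f : Cochain R (VField R)) = constForm (X f) := by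
  ext n v
  cases n with
  | zero => rfl
  | succ n => rw [lieDer_apply]; simp [constForm]

theorem extD_constForm (f : R) : extD (constForm f : Cochain R (VField R)) = dFun f := by
  ext n : 1
  cases n with
  | zero => rfl
  | succ n =>
    refine alt_ext_succ fun X => ?_
    change contr X (extD (constForm f)) n = contr X (dFun f) n
    rw [contr_extD, contr_constForm, map_zero, sub_zero, lieDer_constForm, contr_dFun]

theorem lieDer_eq_zero (X : VField R) (n : ℕ) (α : Cochain R (VField R)) (h : α n = 0) :
    lieDer X α n = 0 := by
  ext v
  simp [lieDer_apply, h]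

theorem extD_eq_zero (n : ℕ) (α : Cochain R (VField R)) (h : α n = 0) :
    extD α (n + 1) = 0 := by
  induction n generalizing α with
  | zero =>
    refine alt_ext_succ fun X => ?_
    change contr X (extD α) 0 = 0
    rw [contr_extD, Cochain.sub_apply, lieDer_eq_zero X 0 α h, extD_zero, sub_zero]
  | succ n ih =>
    refine alt_ext_succ fun X => ?_
    change contr X (extD α) (n + 1) = 0
    rw [contr_extD, Cochain.sub_apply, lieDer_eq_zero X _ α h, ih, sub_zero]
    rw [contr_apply, h]
    rfl

variable (R) in
/-- The algebra of differential forms: families of alternating forms, one in each degree, with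
finitely many of them non-zero, that is, the direct sum over `n` of the alternating `R`-multilinear
maps of degree `n` on vector fields, with the wedge product. -/
def Forms : Subalgebra ℝ (Cochain R (VField R)) where
  carrier := { α | ∃ N, ∀ k, N ≤ k → α k = 0 }
  mul_mem' := by
    rintro α β ⟨p, hp⟩ ⟨q, hq⟩
    exact ⟨p + q, fun k hk => wedge_eq_zero k p q α β hp hq (by omega)⟩
  add_mem' := by
    rintro α β ⟨p, hp⟩ ⟨q, hq⟩
    exact ⟨p + q, fun k hk => by
      rw [Cochain.add_apply, hp k (by omega), hq k (by omega), add_zero]⟩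
  algebraMap_mem' c := ⟨1, fun k hk => by
    rw [Algebra.algebraMap_eq_smul_one, Cochain.real_smul_def, Cochain.smul_apply]
    obtain ⟨k, rfl⟩ : ∃ j, k = j + 1 := ⟨k - 1, by omega⟩
    exact smul_zero _⟩

/-- The interior product on differential forms. -/
def Forms.contr (X : VField R) : Forms R →ₗ[ℝ] Forms R :=
  ((EquivariantForms.contr X).restrictScalars ℝ).restrict (p := (Forms R).toSubmodule)
    (q := (Forms R).toSubmodule) (by
    rintro α ⟨N, hN⟩
    exact ⟨N, fun k hk => by
      change EquivariantForms.contr X α k = 0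
      rw [contr_apply, hN (k + 1) (by omega)]; rfl⟩)

/-- The Lie derivative on differential forms. -/
def Forms.lieDer (X : VField R) : Forms R →ₗ[ℝ] Forms R :=
  (EquivariantForms.lieDer X).restrict (p := (Forms R).toSubmodule)
    (q := (Forms R).toSubmodule) (by
    rintro α ⟨N, hN⟩
    exact ⟨N, fun k hk => lieDer_eq_zero X k α (hN k hk)⟩)

/-- The exterior derivative on differential forms. -/
def Forms.extD : Forms R →ₗ[ℝ] Forms R :=
  EquivariantForms.extD.restrict (p := (Forms R).toSubmodule)
    (q := (Forms R).toSubmodule) (by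
    rintro α ⟨N, hN⟩
    exact ⟨N + 1, fun k hk => by
      obtain ⟨k, rfl⟩ : ∃ j, k = j + 1 := ⟨k - 1, by omega⟩
      exact extD_eq_zero k α (hN k (by omega))⟩)

variable (R) in
/-- The forms of degree `n`. -/
def Forms.deg (n : ℕ) : Submodule ℝ (Forms R) where
  carrier := { α | ∀ k, k ≠ n → (α : Cochain R (VField R)) k = 0 }
  add_mem' := fun {α β} hα hβ k hk => by
    change (α : Cochain R (VField R)) k + (β : Cochain R (VField R)) k = 0
    rw [hα k hk, hβ k hk, add_zero]
  zero_mem' := fun _ _ => rfl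
  smul_mem' := fun c α hα k hk => by
    change algebraMap ℝ R c • (α : Cochain R (VField R)) k = 0
    rw [hα k hk, smul_zero]

end DeRham

section Parity

/-- A super structure on an algebra, given by its parity involution. -/
structure Parity (A : Type*) [Ring A] [Algebra ℝ A] where
  /-- the involution, `+1` on even and `-1` on odd elements -/
  inv : A →ₐ[ℝ] A
  inv_inv : ∀ x, inv (inv x) = x

variable {A : Type*} [Ring A] [Algebra ℝ A]

/-- The even (`i = 0`) and odd (`i = 1`) parts. -/
def Parity.grading (p : Parity A) (i : ZMod 2) : Submodule ℝ A where
  carrier := { x | p.inv x = (-1 : ℤˣ) ^ i • x }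
  add_mem' := fun {x y} hx hy => by
    change p.inv (x + y) = _
    rw [map_add, hx, hy, smul_add]
  zero_mem' := by simp
  smul_mem' := fun c x hx => by
    change p.inv (c • x) = _
    rw [map_smul, hx, smul_comm]

theorem Parity.mem_grading (p : Parity A) (i : ZMod 2) (x : A) :
    x ∈ p.grading i ↔ p.inv x = (-1 : ℤˣ) ^ i • x := Iff.rfl

theorem Parity.even_mem (p : Parity A) (x : A) : (1 / 2 : ℝ) • (x + p.inv x) ∈ p.grading 0 := by
  rw [p.mem_grading, map_smul, map_add, p.inv_inv, add_comm]
  simp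

theorem Parity.odd_mem (p : Parity A) (x : A) : (1 / 2 : ℝ) • (x - p.inv x) ∈ p.grading 1 := by
  rw [p.mem_grading, map_smul, map_sub, p.inv_inv, uzpow_one, Units.neg_smul, one_smul, ← smul_neg,
    neg_sub]

instance (p : Parity A) : SetLike.GradedMonoid p.grading where
  one_mem := by simp [p.mem_grading]
  mul_mem := fun i j x y hx hy => by
    rw [p.mem_grading] at *
    rw [map_mul, hx, hy, uzpow_add, smul_mul_smul_comm]

/-- The decomposition of an element into its even and its odd part. -/
def Parity.decomposeMap (p : Parity A) : A →ₗ[ℝ] DirectSum (ZMod 2) fun i => p.grading i :=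
  DirectSum.lof ℝ (ZMod 2) (fun i => p.grading i) 0 ∘ₗ
      LinearMap.codRestrict (p.grading 0) ((1 / 2 : ℝ) • (LinearMap.id + p.inv.toLinearMap))
        (fun x => p.even_mem x) +
    DirectSum.lof ℝ (ZMod 2) (fun i => p.grading i) 1 ∘ₗ
      LinearMap.codRestrict (p.grading 1) ((1 / 2 : ℝ) • (LinearMap.id - p.inv.toLinearMap))
        (fun x => p.odd_mem x)

theorem Parity.decomposeMap_coe (p : Parity A) (i : ZMod 2) (x : p.grading i) :
    p.decomposeMap x = DirectSum.lof ℝ (ZMod 2) (fun i => p.grading i) i x := by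
  have hi : i = 0 ∨ i = 1 := (by decide : ∀ j : ZMod 2, j = 0 ∨ j = 1) i
  have hx := x.2
  rw [p.mem_grading] at hx
  rcases hi with rfl | rfl
  · have hx' : p.inv (x : A) = x := by rw [hx, uzpow_zero, one_smul]
    have e0 : LinearMap.codRestrict (p.grading 0)
        ((1 / 2 : ℝ) • (LinearMap.id + p.inv.toLinearMap)) (fun x => p.even_mem x) (x : A) = x :=
      Subtype.ext (by simp [hx']; module)
    have e1 : LinearMap.codRestrict (p.grading 1)
        ((1 / 2 : ℝ) • (LinearMap.id - p.inv.toLinearMap)) (fun x => p.odd_mem x) (x : A) = 0 :=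
      Subtype.ext (by simp [hx'])
    rw [Parity.decomposeMap, LinearMap.add_apply, LinearMap.comp_apply, LinearMap.comp_apply,
      e0, e1, map_zero, add_zero]
  · have hx' : p.inv (x : A) = -x := by rw [hx, uzpow_one, Units.neg_smul, one_smul]
    have e0 : LinearMap.codRestrict (p.grading 0)
        ((1 / 2 : ℝ) • (LinearMap.id + p.inv.toLinearMap)) (fun x => p.even_mem x) (x : A) = 0 :=
      Subtype.ext (by simp [hx'])
    have e1 : LinearMap.codRestrict (p.grading 1)
        ((1 / 2 : ℝ) • (LinearMap.id - p.inv.toLinearMap)) (fun x => p.odd_mem x) (x : A) = x :=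
      Subtype.ext (by simp [hx']; module)
    rw [Parity.decomposeMap, LinearMap.add_apply, LinearMap.comp_apply, LinearMap.comp_apply,
      e0, e1, map_zero, zero_add]

instance (p : Parity A) : GradedAlgebra p.grading where
  toDecomposition := DirectSum.Decomposition.ofLinearMap _ p.decomposeMap
    (by
      ext x
      simp [Parity.decomposeMap]
      module)
    (by
      ext i x : 2
      rw [LinearMap.comp_apply, LinearMap.comp_apply, DirectSum.coeLinearMap_lof,
        p.decomposeMap_coe]
      rfl)

end Parity

section FormsParity

variable (R : Type*) [CommRing R] [Algebra ℝ R]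

/-- The super structure on differential forms, given by the parity of the degree. -/
def Forms.parity : Parity (Forms R) where
  inv := AlgHom.ofLinearMap
    (((sign (R := R) (V := VField R)).restrictScalars ℝ).restrict (p := (Forms R).toSubmodule)
      (q := (Forms R).toSubmodule) (by
        rintro α ⟨N, hN⟩
        exact ⟨N, fun k hk => by
          change sign α k = 0
          rw [sign_apply, hN k hk, smul_zero]⟩))
    (Subtype.ext (sign_constForm (1 : R)))
    (fun α β => Subtype.ext (sign_mul (α : Cochain R (VField R)) β))
  inv_inv := fun α => Subtype.ext (sign_sign (α : Cochain R (VField R)))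

end FormsParity

section Sym

/-- The algebra homomorphism `s ↦ s + ε D s` into the dual numbers over the symmetric algebra, for
the derivation `D` extending `f`. -/
def symDual {V : Type*} [AddCommGroup V] [Module ℝ V] (f : V →ₗ[ℝ] V) :
    SymmetricAlgebra ℝ V →ₐ[ℝ] TrivSqZeroExt (SymmetricAlgebra ℝ V) (SymmetricAlgebra ℝ V) :=
  SymmetricAlgebra.lift
    { toFun := fun v => TrivSqZeroExt.inl (SymmetricAlgebra.ι ℝ V v) +
        TrivSqZeroExt.inr (SymmetricAlgebra.ι ℝ V (f v))
      map_add' := fun v w => by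
        simp only [map_add, TrivSqZeroExt.inl_add, TrivSqZeroExt.inr_add]; abel
      map_smul' := fun c v => by
        ext <;> simp }

theorem fst_symDual {V : Type*} [AddCommGroup V] [Module ℝ V] (f : V →ₗ[ℝ] V)
    (s : SymmetricAlgebra ℝ V) : (symDual f s).fst = s := by
  have : (TrivSqZeroExt.fstHom ℝ (SymmetricAlgebra ℝ V) (SymmetricAlgebra ℝ V)).comp (symDual f) =
      AlgHom.id ℝ _ := by
    ext v
    simp [symDual]
  exact congrArg (fun g => g s) this

/-- The extension of a linear endomorphism `f` of `V` to a derivation of the symmetric algebra of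
`V`. -/
def symDerivation {V : Type*} [AddCommGroup V] [Module ℝ V] (f : V →ₗ[ℝ] V) :
    Derivation ℝ (SymmetricAlgebra ℝ V) (SymmetricAlgebra ℝ V) :=
  Derivation.mk'
    { toFun := fun s => (symDual f s).snd
      map_add' := fun s t => by rw [map_add, TrivSqZeroExt.snd_add]
      map_smul' := fun c s => by rw [map_smul, TrivSqZeroExt.snd_smul]; rfl }
    (fun s t => by
      change (symDual f (s * t)).snd = s • (symDual f t).snd + t • (symDual f s).snd
      rw [map_mul, TrivSqZeroExt.snd_mul, fst_symDual, fst_symDual, op_smul_eq_smul])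

theorem symDerivation_ι {V : Type*} [AddCommGroup V] [Module ℝ V] (f : V →ₗ[ℝ] V) (v : V) :
    symDerivation f (SymmetricAlgebra.ι ℝ V v) = SymmetricAlgebra.ι ℝ V (f v) := by
  change (symDual f _).snd = _
  simp [symDual]

end Sym

section Weil

variable (𝔤 : Type*) [LieRing 𝔤] [LieAlgebra ℝ 𝔤]

/-- `S(𝔤*)`. -/
abbrev Sym : Type _ := SymmetricAlgebra ℝ (Module.Dual ℝ 𝔤)

/-- `Λ(𝔤*)`. -/
abbrev Ext : Type _ := ExteriorAlgebra ℝ (Module.Dual ℝ 𝔤)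

/-- The Weil algebra `W(𝔤) = S(𝔤*) ⊗ Λ(𝔤*)`. -/
def Weil : Type _ := Sym 𝔤 ⊗[ℝ] Ext 𝔤

instance : Ring (Weil 𝔤) := inferInstanceAs (Ring (Sym 𝔤 ⊗[ℝ] Ext 𝔤))
instance : Algebra ℝ (Weil 𝔤) := inferInstanceAs (Algebra ℝ (Sym 𝔤 ⊗[ℝ] Ext 𝔤))

variable {𝔤}

/-- The element `s ⊗ a` of the Weil algebra. -/
def Weil.tmul (s : Sym 𝔤) (a : Ext 𝔤) : Weil 𝔤 := s ⊗ₜ[ℝ] a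

/-- The operator `S ⊗ T` on the Weil algebra. -/
def Weil.map (S : Sym 𝔤 →ₗ[ℝ] Sym 𝔤) (T : Ext 𝔤 →ₗ[ℝ] Ext 𝔤) : Weil 𝔤 →ₗ[ℝ] Weil 𝔤 :=
  (TensorProduct.map S T : Sym 𝔤 ⊗[ℝ] Ext 𝔤 →ₗ[ℝ] Sym 𝔤 ⊗[ℝ] Ext 𝔤)

theorem Weil.tmul_add (s : Sym 𝔤) (a b : Ext 𝔤) :
    Weil.tmul s (a + b) = Weil.tmul s a + Weil.tmul s b := TensorProduct.tmul_add s a b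
theorem Weil.tmul_neg (s : Sym 𝔤) (a : Ext 𝔤) :
    Weil.tmul s (-a) = -Weil.tmul s a := TensorProduct.tmul_neg s a
theorem Weil.tmul_zero (s : Sym 𝔤) : Weil.tmul s (0 : Ext 𝔤) = 0 := TensorProduct.tmul_zero _ s
theorem Weil.add_tmul (s t : Sym 𝔤) (a : Ext 𝔤) :
    Weil.tmul (s + t) a = Weil.tmul s a + Weil.tmul t a := TensorProduct.add_tmul s t a
theorem Weil.smul_tmul (r : ℝ) (s : Sym 𝔤) (a : Ext 𝔤) :
    Weil.tmul (r • s) a = r • Weil.tmul s a := (TensorProduct.smul_tmul' r s a).symm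
theorem Weil.zero_tmul (a : Ext 𝔤) : Weil.tmul (0 : Sym 𝔤) a = 0 := TensorProduct.zero_tmul _ a
theorem Weil.one_def : (1 : Weil 𝔤) = Weil.tmul 1 1 := rfl
theorem Weil.tmul_mul_tmul (s t : Sym 𝔤) (a b : Ext 𝔤) :
    Weil.tmul s a * Weil.tmul t b = Weil.tmul (s * t) (a * b) :=
  Algebra.TensorProduct.tmul_mul_tmul s t a b
theorem Weil.map_tmul (S : Sym 𝔤 →ₗ[ℝ] Sym 𝔤) (T : Ext 𝔤 →ₗ[ℝ] Ext 𝔤) (s : Sym 𝔤) (a : Ext 𝔤) :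
    Weil.map S T (Weil.tmul s a) = Weil.tmul (S s) (T a) := rfl

theorem Weil.induction {P : Weil 𝔤 → Prop} (x : Weil 𝔤) (zero : P 0)
    (tmul : ∀ s a, P (Weil.tmul s a)) (add : ∀ x y, P x → P y → P (x + y)) : P x :=
  TensorProduct.induction_on (motive := P) x zero tmul add

variable (𝔤) in
/-- The super structure on the Weil algebra: `S(𝔤*)` is even, the parity on `Λ(𝔤*)` is that of the
degree. -/
def Weil.parity : Parity (Weil 𝔤) where
  inv := (Algebra.TensorProduct.map (AlgHom.id ℝ (Sym 𝔤)) CliffordAlgebra.involute :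
    Sym 𝔤 ⊗[ℝ] Ext 𝔤 →ₐ[ℝ] Sym 𝔤 ⊗[ℝ] Ext 𝔤)
  inv_inv := fun x => by
    have h : ∀ s a, (Algebra.TensorProduct.map (AlgHom.id ℝ (Sym 𝔤)) CliffordAlgebra.involute :
        Sym 𝔤 ⊗[ℝ] Ext 𝔤 →ₐ[ℝ] Sym 𝔤 ⊗[ℝ] Ext 𝔤) (s ⊗ₜ a) = s ⊗ₜ CliffordAlgebra.involute a :=
      fun _ _ => rfl
    refine TensorProduct.induction_on (motive := fun x : Sym 𝔤 ⊗[ℝ] Ext 𝔤 =>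
      (Algebra.TensorProduct.map (AlgHom.id ℝ (Sym 𝔤)) CliffordAlgebra.involute :
        Sym 𝔤 ⊗[ℝ] Ext 𝔤 →ₐ[ℝ] Sym 𝔤 ⊗[ℝ] Ext 𝔤) ((Algebra.TensorProduct.map
          (AlgHom.id ℝ (Sym 𝔤)) CliffordAlgebra.involute :
        Sym 𝔤 ⊗[ℝ] Ext 𝔤 →ₐ[ℝ] Sym 𝔤 ⊗[ℝ] Ext 𝔤) x) = x) x ?_ ?_ ?_
    · rw [map_zero, map_zero]
    · intro s a
      rw [h, h, CliffordAlgebra.involute_involute]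
    · intro x y hx hy
      rw [map_add, map_add, hx, hy]

theorem Weil.parity_tmul (s : Sym 𝔤) (a : Ext 𝔤) :
    (Weil.parity 𝔤).inv (Weil.tmul s a) = Weil.tmul s (CliffordAlgebra.involute a) := rfl

/-- The coadjoint action, `(x · l) y = - l [x, y]`. -/
def coadjoint (x : 𝔤) : Module.Dual ℝ 𝔤 →ₗ[ℝ] Module.Dual ℝ 𝔤 :=
  -(LieAlgebra.ad ℝ 𝔤 x).dualMap

/-- The coadjoint action on `S(𝔤*)`, by derivations. -/
def Sym.lie (x : 𝔤) : Derivation ℝ (Sym 𝔤) (Sym 𝔤) := symDerivation (coadjoint x)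

/-- The interior product on `Λ(𝔤*)`. -/
def Ext.contr (x : 𝔤) : Ext 𝔤 →ₗ[ℝ] Ext 𝔤 :=
  CliffordAlgebra.contractLeft (Q := (0 : QuadraticForm ℝ (Module.Dual ℝ 𝔤)))
    (Module.Dual.eval ℝ 𝔤 x)

/-- The generator of `W(𝔤)` of degree `2` given by an element of `𝔤*`. -/
def Weil.phi (l : Module.Dual ℝ 𝔤) : Weil 𝔤 := Weil.tmul (SymmetricAlgebra.ι ℝ _ l) 1

/-- The generator of `W(𝔤)` of degree `1` given by an element of `𝔤*`. -/
def Weil.omega (l : Module.Dual ℝ 𝔤) : Weil 𝔤 := Weil.tmul 1 (ExteriorAlgebra.ι ℝ l)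

/-- The interior product on `W(𝔤)`: the antiderivation with `φ(l) ↦ 0` and `ω(l) ↦ l x`. -/
def Weil.contr (x : 𝔤) : Weil 𝔤 →ₗ[ℝ] Weil 𝔤 := Weil.map LinearMap.id (Ext.contr x)

/-- The coadjoint action on the factor `S(𝔤*)` of `W(𝔤)`. -/
def Weil.symLie (x : 𝔤) : Weil 𝔤 →ₗ[ℝ] Weil 𝔤 :=
  Weil.map (Sym.lie x : Sym 𝔤 →ₗ[ℝ] Sym 𝔤) LinearMap.id

variable {ι : Type*} [Fintype ι] (ξ : Module.Basis ι ℝ 𝔤)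

/-- The structure constants `f^a_{bc}`, with `[ξ_b, ξ_c] = f^a_{bc} ξ_a`. -/
def structConst (a b c : ι) : ℝ := ξ.coord a ⁅ξ b, ξ c⁆

/-- The element `d ω^a = φ^a - ½ f^a_{bc} ω^b ω^c`. -/
def Weil.dOmega (a : ι) : Weil 𝔤 :=
  Weil.phi (ξ.coord a) - (1 / 2 : ℝ) •
    ∑ b, ∑ c, structConst ξ a b c • (Weil.omega (ξ.coord b) * Weil.omega (ξ.coord c))

/-- The differential of the Weil algebra, i.e. the antiderivation with
`d ω^a = φ^a - ½ f^a_{bc} ω^b ω^c` and `d φ^a = - f^a_{bc} ω^b φ^c`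
(see `Weil.d_mul`, `Weil.d_omega`, `Weil.d_phi`). -/
def Weil.d : Weil 𝔤 →ₗ[ℝ] Weil 𝔤 :=
  ∑ b, LinearMap.mulLeft ℝ (Weil.omega (ξ.coord b)) ∘ₗ Weil.symLie (ξ b) +
    ∑ a, LinearMap.mulLeft ℝ (Weil.dOmega ξ a) ∘ₗ Weil.contr (ξ a)

/-- The Lie derivative `L_a = I_a d + d I_a` on the Weil algebra. -/
def Weil.lie (a : ι) : Weil 𝔤 →ₗ[ℝ] Weil 𝔤 :=
  Weil.contr (ξ a) ∘ₗ Weil.d ξ + Weil.d ξ ∘ₗ Weil.contr (ξ a)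

theorem Weil.d_apply (x : Weil 𝔤) : Weil.d ξ x =
    ∑ b, Weil.omega (ξ.coord b) * Weil.symLie (ξ b) x +
    ∑ a, Weil.dOmega ξ a * Weil.contr (ξ a) x := by
  simp [Weil.d]

theorem Weil.d_omega (a : ι) : Weil.d ξ (Weil.omega (ξ.coord a)) = Weil.phi (ξ.coord a) -
    (1 / 2 : ℝ) •
      ∑ b, ∑ c, structConst ξ a b c • (Weil.omega (ξ.coord b) * Weil.omega (ξ.coord c)) := by
  classical
  have h1 : ∀ b, Weil.symLie (ξ b) (Weil.omega (ξ.coord a)) = 0 := fun b => by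
    rw [Weil.symLie, Weil.omega, Weil.map_tmul, Derivation.coeFn_coe, Derivation.map_one_eq_zero,
      Weil.zero_tmul]
  have h2 : ∀ b, Weil.contr (ξ b) (Weil.omega (ξ.coord a)) = if b = a then 1 else 0 := fun b => by
    rw [Weil.contr, Weil.omega, Weil.map_tmul, Ext.contr, ExteriorAlgebra.ι,
      CliffordAlgebra.contractLeft_ι]
    by_cases h : b = a
    · simp [h, Weil.one_def]
    · simp [h, Weil.tmul_zero]
  simp [Weil.d_apply, h1, h2, Weil.dOmega]

theorem coadjoint_coord (a b : ι) :
    coadjoint (ξ b) (ξ.coord a) = ∑ c, (-structConst ξ a b c) • ξ.coord c := by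
  classical
  refine ξ.ext fun c => ?_
  simp [coadjoint, structConst, Finsupp.single_apply]

theorem Weil.d_phi (a : ι) : Weil.d ξ (Weil.phi (ξ.coord a)) =
    -∑ b, ∑ c, structConst ξ a b c • (Weil.omega (ξ.coord b) * Weil.phi (ξ.coord c)) := by
  have h2 : ∀ b, Weil.contr (ξ b) (Weil.phi (ξ.coord a)) = 0 := fun b => by
    rw [Weil.contr, Weil.phi, Weil.map_tmul, Ext.contr, CliffordAlgebra.contractLeft_one,
      Weil.tmul_zero]
  have hs : ∀ b, ∀ s : Finset ι, Weil.tmul (SymmetricAlgebra.ι ℝ (Module.Dual ℝ 𝔤)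
      (∑ c ∈ s, (-structConst ξ a b c) • ξ.coord c)) 1 =
      ∑ c ∈ s, (-structConst ξ a b c) • Weil.phi (ξ.coord c) := fun b s => by
    classical
    induction s using Finset.induction_on with
    | empty => simp [Weil.zero_tmul]
    | insert c s hc ih =>
      rw [Finset.sum_insert hc, map_add, Weil.add_tmul, ih, map_smul, Weil.smul_tmul,
        Finset.sum_insert hc]
      rfl
  have h1 : ∀ b, Weil.symLie (ξ b) (Weil.phi (ξ.coord a)) =
      ∑ c, (-structConst ξ a b c) • Weil.phi (ξ.coord c) := fun b => by
    rw [Weil.symLie, Weil.phi, Weil.map_tmul, Derivation.coeFn_coe, Sym.lie, symDerivation_ι,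
      coadjoint_coord]
    exact hs b _
  simp only [Weil.d_apply, h1, h2, mul_zero, Finset.sum_const_zero, add_zero, neg_smul,
    Finset.sum_neg_distrib, mul_neg, Finset.mul_sum, mul_smul_comm]

theorem ext_contr_mul (l : Module.Dual ℝ (Module.Dual ℝ 𝔤)) (a b : Ext 𝔤) :
    CliffordAlgebra.contractLeft (Q := (0 : QuadraticForm ℝ (Module.Dual ℝ 𝔤))) l (a * b) =
      CliffordAlgebra.contractLeft (Q := (0 : QuadraticForm ℝ (Module.Dual ℝ 𝔤))) l a * b +
        CliffordAlgebra.involute a *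
          CliffordAlgebra.contractLeft (Q := (0 : QuadraticForm ℝ (Module.Dual ℝ 𝔤))) l b := by
  induction a using CliffordAlgebra.left_induction with
  | algebraMap r =>
    rw [CliffordAlgebra.contractLeft_algebraMap_mul, CliffordAlgebra.contractLeft_algebraMap,
      zero_mul, zero_add, AlgHom.commutes]
  | add x y hx hy =>
    simp only [add_mul, map_add, hx, hy]
    abel
  | ι_mul x m hx =>
    rw [mul_assoc, CliffordAlgebra.contractLeft_ι_mul, CliffordAlgebra.contractLeft_ι_mul, hx,
      map_mul, CliffordAlgebra.involute_ι]
    simp only [mul_add, sub_mul, smul_mul_assoc, mul_assoc, neg_mul]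
    abel

theorem ext_ι_mul (l : Module.Dual ℝ 𝔤) (a : Ext 𝔤) :
    ExteriorAlgebra.ι ℝ l * a = CliffordAlgebra.involute a * ExteriorAlgebra.ι ℝ l := by
  induction a using CliffordAlgebra.left_induction with
  | algebraMap r => rw [AlgHom.commutes]; exact (Algebra.commutes r _).symm
  | add x y hx hy => rw [mul_add, hx, hy, map_add, add_mul]
  | ι_mul x m hx =>
    have h : ExteriorAlgebra.ι ℝ l * ExteriorAlgebra.ι ℝ m =
        -(ExteriorAlgebra.ι ℝ m * ExteriorAlgebra.ι ℝ l) :=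
      eq_neg_of_add_eq_zero_left (ExteriorAlgebra.ι_add_mul_swap l m)
    rw [map_mul, CliffordAlgebra.involute_ι, mul_assoc, ← hx, ← mul_assoc]
    change (ExteriorAlgebra.ι ℝ l * ExteriorAlgebra.ι ℝ m) * x =
      -ExteriorAlgebra.ι ℝ m * (ExteriorAlgebra.ι ℝ l * x)
    rw [h, neg_mul, neg_mul, mul_assoc]

theorem Weil.contr_mul (z : 𝔤) (x y : Weil 𝔤) :
    Weil.contr z (x * y) = Weil.contr z x * y + (Weil.parity 𝔤).inv x * Weil.contr z y := by
  induction x using Weil.induction with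
  | zero => simp
  | add x x' h h' => simp only [add_mul, map_add, h, h']; abel
  | tmul s a =>
    induction y using Weil.induction with
    | zero => simp
    | add y y' h h' => simp only [mul_add, map_add, h, h']; abel
    | tmul t b =>
      simp only [Weil.parity_tmul, Weil.contr, Weil.map_tmul, Weil.tmul_mul_tmul,
        LinearMap.id_apply, Ext.contr, ext_contr_mul, Weil.tmul_add]

theorem Weil.symLie_mul (z : 𝔤) (x y : Weil 𝔤) :
    Weil.symLie z (x * y) = Weil.symLie z x * y + x * Weil.symLie z y := by
  induction x using Weil.induction with
  | zero => simp
  | add x x' h h' => simp only [add_mul, map_add, h, h']; abel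
  | tmul s a =>
    induction y using Weil.induction with
    | zero => simp
    | add y y' h h' => simp only [mul_add, map_add, h, h']; abel
    | tmul t b =>
      simp only [Weil.symLie, Weil.map_tmul, Weil.tmul_mul_tmul,
        LinearMap.id_apply, Derivation.coeFn_coe, Derivation.leibniz, Weil.add_tmul,
        smul_eq_mul]
      rw [mul_comm t, add_comm]

theorem Weil.omega_mul (l : Module.Dual ℝ 𝔤) (x : Weil 𝔤) :
    Weil.omega l * x = (Weil.parity 𝔤).inv x * Weil.omega l := by
  induction x using Weil.induction with
  | zero => simp
  | add x x' h h' => simp only [add_mul, mul_add, map_add, h, h']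
  | tmul s a =>
    simp only [Weil.parity_tmul, Weil.omega, Weil.tmul_mul_tmul, ext_ι_mul, one_mul, mul_one]

theorem Weil.dOmega_mul (a : ι) (x : Weil 𝔤) :
    Weil.dOmega ξ a * x = x * Weil.dOmega ξ a := by
  have h1 : ∀ l : Module.Dual ℝ 𝔤, Weil.phi l * x = x * Weil.phi l := fun l => by
    induction x using Weil.induction with
    | zero => simp
    | add x x' h h' => simp only [add_mul, mul_add, h, h']
    | tmul s a =>
      simp only [Weil.phi, Weil.tmul_mul_tmul, one_mul, mul_one, mul_comm]
  have h2 : ∀ l m : Module.Dual ℝ 𝔤, Weil.omega l * Weil.omega m * x =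
      x * (Weil.omega l * Weil.omega m) := fun l m => by
    rw [mul_assoc, Weil.omega_mul m x, ← mul_assoc, Weil.omega_mul l, (Weil.parity 𝔤).inv_inv,
      mul_assoc]
  simp only [Weil.dOmega, sub_mul, mul_sub, h1, smul_mul_assoc, mul_smul_comm, Finset.sum_mul,
    Finset.mul_sum, h2]

theorem Weil.d_mul (x y : Weil 𝔤) :
    Weil.d ξ (x * y) = Weil.d ξ x * y + (Weil.parity 𝔤).inv x * Weil.d ξ y := by
  have h1 : ∀ (z : 𝔤) (l : Module.Dual ℝ 𝔤), Weil.omega l * Weil.symLie z (x * y) =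
      (Weil.omega l * Weil.symLie z x) * y +
      (Weil.parity 𝔤).inv x * (Weil.omega l * Weil.symLie z y) := fun z l => by
    rw [Weil.symLie_mul, mul_add, ← mul_assoc, ← mul_assoc (Weil.omega l) x, Weil.omega_mul l x,
      mul_assoc ((Weil.parity 𝔤).inv x)]
  have h2 : ∀ a, Weil.dOmega ξ a * Weil.contr (ξ a) (x * y) =
      (Weil.dOmega ξ a * Weil.contr (ξ a) x) * y +
      (Weil.parity 𝔤).inv x * (Weil.dOmega ξ a * Weil.contr (ξ a) y) := fun a => by
    rw [Weil.contr_mul, mul_add, ← mul_assoc, ← mul_assoc, Weil.dOmega_mul ξ a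
      ((Weil.parity 𝔤).inv x), mul_assoc ((Weil.parity 𝔤).inv x)]
  simp only [Weil.d_apply, h1, h2, Finset.sum_add_distrib, add_mul, mul_add, Finset.sum_mul,
    Finset.mul_sum]
  abel

end Weil

section FormsLeibniz

variable {R : Type*} [CommRing R] [Algebra ℝ R]

theorem lieDer_sign (X : VField R) (α : Cochain R (VField R)) :
    lieDer X (sign α) = sign (lieDer X α) := by
  ext n : 1
  change (lieAux X n).1 (sign α) = (-1 : R) ^ n • (lieAux X n).1 α
  ext v
  change lieDer X (sign α) n v = (-1 : R) ^ n • lieDer X α n v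
  rw [lieDer_apply, lieDer_apply]
  simp only [sign_apply, AlternatingMap.smul_apply, smul_eq_mul, Derivation.leibniz,
    Derivation.leibniz_pow, mul_sub, Finset.mul_sum]
  simp

theorem lieDer_mul (X : VField R) (α β : Cochain R (VField R)) :
    lieDer X (α * β) = lieDer X α * β + α * lieDer X β := by
  have key : ∀ n (α β : Cochain R (VField R)),
      lieDer X (α * β) n = (lieDer X α * β + α * lieDer X β) n := by
    intro n
    induction n with
    | zero =>
      intro α β
      refine alt_ext_zero ?_
      rw [lieDer_zero_apply, mul_zero_apply, Cochain.add_apply, AlternatingMap.add_apply,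
        mul_zero_apply, mul_zero_apply, lieDer_zero_apply, lieDer_zero_apply, Derivation.leibniz,
        smul_eq_mul, smul_eq_mul, mul_comm (β 0 ![]), add_comm]
    | succ n ih =>
      intro α β
      refine alt_ext_succ fun Y => ?_
      rw [lieDer_apply_succ, contr_mul, contr_mul, map_add]
      change _ = contr Y (lieDer X α * β + α * lieDer X β) n
      rw [map_add, contr_mul, contr_mul, contr_lieDer, contr_lieDer, Cochain.add_apply, ih, ih,
        lieDer_sign]
      simp only [sub_mul, mul_sub, Cochain.add_apply, Cochain.sub_apply]
      abel
  ext n : 1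
  exact key n α β

theorem Forms.lieDer_mul (X : VField R) (α β : Forms R) :
    Forms.lieDer X (α * β) = Forms.lieDer X α * β + α * Forms.lieDer X β :=
  Subtype.ext (EquivariantForms.lieDer_mul X (α : Cochain R (VField R)) β)

theorem Forms.contr_mul (X : VField R) (α β : Forms R) :
    Forms.contr X (α * β) = Forms.contr X α * β + (Forms.parity R).inv α * Forms.contr X β :=
  Subtype.ext (EquivariantForms.contr_mul X (α : Cochain R (VField R)) β)

theorem Forms.parity_contr (X : VField R) (α : Forms R) :
    (Forms.parity R).inv (Forms.contr X α) = -Forms.contr X ((Forms.parity R).inv α) :=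
  Subtype.ext (by
    change sign (EquivariantForms.contr X (α : Cochain R (VField R))) =
      -EquivariantForms.contr X (sign α)
    rw [contr_sign, neg_neg])

theorem Forms.parity_lieDer (X : VField R) (α : Forms R) :
    (Forms.parity R).inv (Forms.lieDer X α) = Forms.lieDer X ((Forms.parity R).inv α) :=
  Subtype.ext (lieDer_sign X (α : Cochain R (VField R))).symm

end FormsLeibniz

section WeilParity

variable {𝔤 : Type*} [LieRing 𝔤] [LieAlgebra ℝ 𝔤]

theorem ext_involute_contr (l : Module.Dual ℝ (Module.Dual ℝ 𝔤)) (a : Ext 𝔤) :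
    CliffordAlgebra.involute
        (CliffordAlgebra.contractLeft (Q := (0 : QuadraticForm ℝ (Module.Dual ℝ 𝔤))) l a) =
      -CliffordAlgebra.contractLeft (Q := (0 : QuadraticForm ℝ (Module.Dual ℝ 𝔤))) l
        (CliffordAlgebra.involute a) := by
  induction a using CliffordAlgebra.left_induction with
  | algebraMap r => simp [CliffordAlgebra.contractLeft_algebraMap]
  | add x y hx hy => rw [map_add, map_add, map_add, map_add, hx, hy, neg_add]
  | ι_mul x m hx =>
    have h : CliffordAlgebra.involute (CliffordAlgebra.ι 0 m * x) =
        -(CliffordAlgebra.ι 0 m * CliffordAlgebra.involute x) := by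
      rw [map_mul, CliffordAlgebra.involute_ι, neg_mul]
    rw [h, CliffordAlgebra.contractLeft_ι_mul, map_sub, map_mul, hx, LinearMap.map_neg,
      CliffordAlgebra.contractLeft_ι_mul, CliffordAlgebra.involute_ι, map_smul, neg_mul_neg,
      neg_neg]

theorem Weil.parity_contr (z : 𝔤) (x : Weil 𝔤) :
    (Weil.parity 𝔤).inv (Weil.contr z x) = -Weil.contr z ((Weil.parity 𝔤).inv x) := by
  induction x using Weil.induction with
  | zero => simp
  | add x x' h h' => simp only [map_add, h, h', neg_add]
  | tmul s a =>
    simp only [Weil.parity_tmul, Weil.contr, Weil.map_tmul, LinearMap.id_apply, Ext.contr,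
      ext_involute_contr, Weil.tmul_neg]

variable {ι : Type*} [Fintype ι] (ξ : Module.Basis ι ℝ 𝔤)

theorem Weil.parity_symLie (z : 𝔤) (x : Weil 𝔤) :
    (Weil.parity 𝔤).inv (Weil.symLie z x) = Weil.symLie z ((Weil.parity 𝔤).inv x) := by
  induction x using Weil.induction with
  | zero => simp
  | add x x' h h' => simp only [map_add, h, h']
  | tmul s a =>
    simp only [Weil.parity_tmul, Weil.symLie, Weil.map_tmul, LinearMap.id_apply]

theorem Weil.parity_omega (l : Module.Dual ℝ 𝔤) :
    (Weil.parity 𝔤).inv (Weil.omega l) = -Weil.omega l := by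
  rw [Weil.omega, Weil.parity_tmul, ← Weil.tmul_neg]
  exact congrArg _ (CliffordAlgebra.involute_ι l)

theorem Weil.parity_phi (l : Module.Dual ℝ 𝔤) :
    (Weil.parity 𝔤).inv (Weil.phi l) = Weil.phi l := by
  rw [Weil.phi, Weil.parity_tmul, map_one]

theorem Weil.parity_dOmega (a : ι) :
    (Weil.parity 𝔤).inv (Weil.dOmega ξ a) = Weil.dOmega ξ a := by
  simp only [Weil.dOmega, map_sub, map_smul, map_sum, map_mul, Weil.parity_phi, Weil.parity_omega,
    neg_mul_neg]

theorem Weil.parity_d (x : Weil 𝔤) :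
    (Weil.parity 𝔤).inv (Weil.d ξ x) = -Weil.d ξ ((Weil.parity 𝔤).inv x) := by
  simp only [Weil.d_apply, map_add, map_sum, map_mul, Weil.parity_omega, Weil.parity_dOmega,
    Weil.parity_symLie, Weil.parity_contr]
  simp only [neg_mul, mul_neg, Finset.sum_neg_distrib, neg_add]

theorem Weil.parity_lie (a : ι) (x : Weil 𝔤) :
    (Weil.parity 𝔤).inv (Weil.lie ξ a x) = Weil.lie ξ a ((Weil.parity 𝔤).inv x) := by
  simp only [Weil.lie, LinearMap.add_apply, LinearMap.comp_apply, map_add, Weil.parity_d,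
    Weil.parity_contr, map_neg, neg_neg]

theorem Weil.lie_mul (a : ι) (x y : Weil 𝔤) :
    Weil.lie ξ a (x * y) = Weil.lie ξ a x * y + x * Weil.lie ξ a y := by
  simp only [Weil.lie, LinearMap.add_apply, LinearMap.comp_apply, map_add, Weil.d_mul,
    Weil.contr_mul, Weil.parity_d, Weil.parity_contr, (Weil.parity 𝔤).inv_inv, add_mul, mul_add,
    neg_mul]
  abel

end WeilParity

section Total

variable (𝔤 : Type*) [LieRing 𝔤] [LieAlgebra ℝ 𝔤] (R : Type*) [CommRing R] [Algebra ℝ R]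

/-- The graded tensor product `W(𝔤) ⊗ Ω`. -/
abbrev Total : Type _ := (Weil.parity 𝔤).grading ᵍ⊗[ℝ] (Forms.parity R).grading

instance : Ring (Total 𝔤 R) := inferInstance
instance : Algebra ℝ (Total 𝔤 R) := inferInstance
instance : Semiring (Total 𝔤 R) := inferInstance
instance : AddCommGroup (Total 𝔤 R) := inferInstance
instance : AddCommMonoid (Total 𝔤 R) := inferInstance
instance : Module ℝ (Total 𝔤 R) := inferInstance

variable {𝔤 R}

/-- The operator `S ⊗ T`, without signs, on `W(𝔤) ⊗ Ω`. -/
def Total.map (S : Weil 𝔤 →ₗ[ℝ] Weil 𝔤) (T : Forms R →ₗ[ℝ] Forms R) :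
    Total 𝔤 R →ₗ[ℝ] Total 𝔤 R :=
  (GradedTensorProduct.of ℝ (Weil.parity 𝔤).grading (Forms.parity R).grading).toLinearMap ∘ₗ
    TensorProduct.map S T ∘ₗ
      (GradedTensorProduct.of ℝ (Weil.parity 𝔤).grading (Forms.parity R).grading).symm.toLinearMap

/-- The operator `T ⊗ 1`. -/
def Total.left (T : Weil 𝔤 →ₗ[ℝ] Weil 𝔤) : Total 𝔤 R →ₗ[ℝ] Total 𝔤 R :=
  Total.map T LinearMap.id

/-- The operator `1 ⊗ T`, for an even operator `T`. -/
def Total.rightEven (T : Forms R →ₗ[ℝ] Forms R) : Total 𝔤 R →ₗ[ℝ] Total 𝔤 R :=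
  Total.map LinearMap.id T

/-- The operator `1 ⊗ T`, for an odd operator `T`: by the sign rule,
`(1 ⊗ T) (w ⊗ η) = (-1)^|w| w ⊗ T η`. -/
def Total.rightOdd (T : Forms R →ₗ[ℝ] Forms R) : Total 𝔤 R →ₗ[ℝ] Total 𝔤 R :=
  Total.map (Weil.parity 𝔤).inv.toLinearMap T

theorem Total.map_tmul (S : Weil 𝔤 →ₗ[ℝ] Weil 𝔤) (T : Forms R →ₗ[ℝ] Forms R) (w : Weil 𝔤)
    (η : Forms R) : Total.map S T (w ᵍ⊗ₜ[ℝ] η : Total 𝔤 R) = S w ᵍ⊗ₜ[ℝ] T η := rfl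

/-- The parity involution of `W(𝔤) ⊗ Ω`. -/
def Total.sgn : Total 𝔤 R →ₗ[ℝ] Total 𝔤 R :=
  Total.map (Weil.parity 𝔤).inv.toLinearMap (Forms.parity R).inv.toLinearMap

theorem Parity.induction {A : Type*} [Ring A] [Algebra ℝ A] (p : Parity A) {P : A → Prop}
    (add : ∀ x y, P x → P y → P (x + y)) (mem : ∀ i, ∀ x ∈ p.grading i, P x) (x : A) : P x := by
  have : x = (1 / 2 : ℝ) • (x + p.inv x) + (1 / 2 : ℝ) • (x - p.inv x) := by module
  rw [this]
  exact add _ _ (mem 0 _ (p.even_mem x)) (mem 1 _ (p.odd_mem x))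

theorem Total.tmul_add (w : Weil 𝔤) (η η' : Forms R) :
    (w ᵍ⊗ₜ[ℝ] (η + η') : Total 𝔤 R) = w ᵍ⊗ₜ[ℝ] η + w ᵍ⊗ₜ[ℝ] η' := by
  rw [GradedTensorProduct.tmul, TensorProduct.tmul_add, map_add]

theorem Total.add_tmul (w w' : Weil 𝔤) (η : Forms R) :
    ((w + w') ᵍ⊗ₜ[ℝ] η : Total 𝔤 R) = w ᵍ⊗ₜ[ℝ] η + w' ᵍ⊗ₜ[ℝ] η := by
  rw [GradedTensorProduct.tmul, TensorProduct.add_tmul, map_add]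

theorem Total.induction₂ {P : Total 𝔤 R → Total 𝔤 R → Prop}
    (zero_left : ∀ y, P 0 y) (zero_right : ∀ x, P x 0)
    (add_left : ∀ x x' y, P x y → P x' y → P (x + x') y)
    (add_right : ∀ x y y', P x y → P x y' → P x (y + y'))
    (tmul : ∀ (i j : ZMod 2) (w w' : Weil 𝔤) (η η' : Forms R), η ∈ (Forms.parity R).grading j →
      w' ∈ (Weil.parity 𝔤).grading i → P (w ᵍ⊗ₜ[ℝ] η) (w' ᵍ⊗ₜ[ℝ] η')) (x y : Total 𝔤 R) :
    P x y := by
  induction x using TensorProduct.induction_on with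
  | zero => exact zero_left y
  | add x x' h h' => exact add_left x x' y h h'
  | tmul w η =>
    induction y using TensorProduct.induction_on with
    | zero => exact zero_right _
    | add y y' h h' => exact add_right _ y y' h h'
    | tmul w' η' =>
      refine (Forms.parity R).induction (P := fun η => P (w ᵍ⊗ₜ[ℝ] η) (w' ᵍ⊗ₜ[ℝ] η')) ?_ ?_ η
      · intro η₁ η₂ h₁ h₂
        rw [Total.tmul_add]
        exact add_left _ _ _ h₁ h₂
      · intro j η hη
        refine (Weil.parity 𝔤).induction (P := fun w' => P (w ᵍ⊗ₜ[ℝ] η) (w' ᵍ⊗ₜ[ℝ] η')) ?_ ?_ w'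
        · intro w₁ w₂ h₁ h₂
          rw [Total.add_tmul]
          exact add_right _ _ _ h₁ h₂
        · intro i w' hw'
          exact tmul i j w w' η η' hη hw'

theorem Total.tmul_mul_tmul (i j : ZMod 2) (w w' : Weil 𝔤) (η η' : Forms R)
    (hη : η ∈ (Forms.parity R).grading j) (hw : w' ∈ (Weil.parity 𝔤).grading i) :
    (w ᵍ⊗ₜ[ℝ] η * w' ᵍ⊗ₜ[ℝ] η' : Total 𝔤 R) = (-1 : ℤˣ) ^ (j * i) • ((w * w') ᵍ⊗ₜ[ℝ] (η * η')) :=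
  GradedTensorProduct.tmul_coe_mul_coe_tmul (R := ℝ) (Weil.parity 𝔤).grading
    (Forms.parity R).grading w ⟨η, hη⟩ ⟨w', hw⟩ η'

theorem Total.map_units_smul (T : Total 𝔤 R →ₗ[ℝ] Total 𝔤 R) (u : ℤˣ) (x : Total 𝔤 R) :
    T (u • x) = u • T x := by
  rcases Int.units_eq_one_or u with rfl | rfl <;> simp

theorem Total.neg_tmul (w : Weil 𝔤) (η : Forms R) :
    ((-w) ᵍ⊗ₜ[ℝ] η : Total 𝔤 R) = -(w ᵍ⊗ₜ[ℝ] η) := by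
  rw [GradedTensorProduct.tmul, TensorProduct.neg_tmul, map_neg]

theorem Total.tmul_neg (w : Weil 𝔤) (η : Forms R) :
    (w ᵍ⊗ₜ[ℝ] (-η) : Total 𝔤 R) = -(w ᵍ⊗ₜ[ℝ] η) := by
  rw [GradedTensorProduct.tmul, TensorProduct.tmul_neg, map_neg]

theorem Parity.odd_shift {A : Type*} [Ring A] [Algebra ℝ A] (p : Parity A) {T : A →ₗ[ℝ] A}
    (hT : ∀ x, p.inv (T x) = -T (p.inv x)) {i : ZMod 2} {x : A} (hx : x ∈ p.grading i) :
    T x ∈ p.grading (i + 1) := by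
  rw [p.mem_grading] at *
  rw [hT, hx, uzpow_add, uzpow_one, mul_neg_one, Units.neg_smul]
  congr 1
  rcases Int.units_eq_one_or ((-1) ^ i) with h | h <;> simp [h]

theorem Parity.even_shift {A : Type*} [Ring A] [Algebra ℝ A] (p : Parity A) {T : A →ₗ[ℝ] A}
    (hT : ∀ x, p.inv (T x) = T (p.inv x)) {i : ZMod 2} {x : A} (hx : x ∈ p.grading i) :
    T x ∈ p.grading i := by
  rw [p.mem_grading] at *
  rw [hT, hx]
  rcases Int.units_eq_one_or ((-1) ^ i) with h | h <;> simp [h]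

end Total

section Total
variable {𝔤 : Type*} [LieRing 𝔤] [LieAlgebra ℝ 𝔤] {R : Type*} [CommRing R] [Algebra ℝ R]

/-- Leibniz rule for `T ⊗ 1`, with `T` an odd derivation. -/
theorem Total.left_odd_mul {T : Weil 𝔤 →ₗ[ℝ] Weil 𝔤}
    (hT : ∀ x, (Weil.parity 𝔤).inv (T x) = -T ((Weil.parity 𝔤).inv x))
    (hm : ∀ x y, T (x * y) = T x * y + (Weil.parity 𝔤).inv x * T y) (x y : Total 𝔤 R) :
    Total.left T (x * y) = Total.left T x * y + Total.sgn x * Total.left T y := by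
  induction x, y using Total.induction₂ with
  | zero_left y => simp
  | zero_right x => simp
  | add_left x x' y h h' => simp only [add_mul, map_add, h, h']; abel
  | add_right x y y' h h' => simp only [mul_add, map_add, h, h']; abel
  | tmul i j w w' η η' hη hw =>
    have hη' : (Forms.parity R).inv η ∈ (Forms.parity R).grading j :=
      (Forms.parity R).even_shift (T := (Forms.parity R).inv.toLinearMap) (fun _ => rfl) hη
    rw [Total.tmul_mul_tmul i j _ _ _ _ hη hw, Total.map_units_smul]
    simp only [Total.left, Total.sgn, Total.map_tmul, LinearMap.id_apply, AlgHom.toLinearMap_apply]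
    rw [Total.tmul_mul_tmul i j _ _ _ _ hη hw,
      Total.tmul_mul_tmul (i + 1) j _ _ _ _ hη' ((Weil.parity 𝔤).odd_shift hT hw), hm,
      Total.add_tmul, smul_add, mul_add, mul_one, uzpow_add, mul_smul]
    rw [(Forms.parity R).mem_grading] at hη
    rw [hη]
    rcases Int.units_eq_one_or ((-1) ^ j) with h | h <;>
      simp [h, Total.tmul_neg]

/-- Leibniz rule for `T ⊗ 1`, with `T` an even derivation. -/
theorem Total.left_even_mul {T : Weil 𝔤 →ₗ[ℝ] Weil 𝔤}
    (hT : ∀ x, (Weil.parity 𝔤).inv (T x) = T ((Weil.parity 𝔤).inv x))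
    (hm : ∀ x y, T (x * y) = T x * y + x * T y) (x y : Total 𝔤 R) :
    Total.left T (x * y) = Total.left T x * y + x * Total.left T y := by
  induction x, y using Total.induction₂ with
  | zero_left y => simp
  | zero_right x => simp
  | add_left x x' y h h' => simp only [add_mul, map_add, h, h']; abel
  | add_right x y y' h h' => simp only [mul_add, map_add, h, h']; abel
  | tmul i j w w' η η' hη hw =>
    rw [Total.tmul_mul_tmul i j _ _ _ _ hη hw, Total.map_units_smul]
    simp only [Total.left, Total.map_tmul, LinearMap.id_apply]
    rw [Total.tmul_mul_tmul i j _ _ _ _ hη hw,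
      Total.tmul_mul_tmul i j _ _ _ _ hη ((Weil.parity 𝔤).even_shift hT hw), hm,
      Total.add_tmul, smul_add]

/-- Leibniz rule for `1 ⊗ T`, with `T` an odd derivation. -/
theorem Total.rightOdd_mul {T : Forms R →ₗ[ℝ] Forms R}
    (hT : ∀ x, (Forms.parity R).inv (T x) = -T ((Forms.parity R).inv x))
    (hm : ∀ x y, T (x * y) = T x * y + (Forms.parity R).inv x * T y) (x y : Total 𝔤 R) :
    Total.rightOdd T (x * y) = Total.rightOdd T x * y + Total.sgn x * Total.rightOdd T y := by
  induction x, y using Total.induction₂ with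
  | zero_left y => simp
  | zero_right x => simp
  | add_left x x' y h h' => simp only [add_mul, map_add, h, h']; abel
  | add_right x y y' h h' => simp only [mul_add, map_add, h, h']; abel
  | tmul i j w w' η η' hη hw =>
    rw [Total.tmul_mul_tmul i j _ _ _ _ hη hw, Total.map_units_smul]
    have hη' : (Forms.parity R).inv η ∈ (Forms.parity R).grading j :=
      (Forms.parity R).even_shift (T := (Forms.parity R).inv.toLinearMap) (fun _ => rfl) hη
    have hw' : (Weil.parity 𝔤).inv w' ∈ (Weil.parity 𝔤).grading i :=
      (Weil.parity 𝔤).even_shift (T := (Weil.parity 𝔤).inv.toLinearMap) (fun _ => rfl) hw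
    simp only [Total.rightOdd, Total.sgn, Total.map_tmul, AlgHom.toLinearMap_apply]
    rw [Total.tmul_mul_tmul i (j + 1) _ _ _ _ ((Forms.parity R).odd_shift hT hη) hw,
      Total.tmul_mul_tmul i j _ _ _ _ hη' hw', hm, map_mul, Total.tmul_add, smul_add, add_mul,
      one_mul, uzpow_add, mul_smul]
    rw [(Weil.parity 𝔤).mem_grading] at hw
    rw [hw]
    rcases Int.units_eq_one_or ((-1) ^ i) with h | h <;>
      simp [h, Total.neg_tmul]

/-- Leibniz rule for `1 ⊗ T`, with `T` an even derivation. -/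
theorem Total.rightEven_mul {T : Forms R →ₗ[ℝ] Forms R}
    (hT : ∀ x, (Forms.parity R).inv (T x) = T ((Forms.parity R).inv x))
    (hm : ∀ x y, T (x * y) = T x * y + x * T y) (x y : Total 𝔤 R) :
    Total.rightEven T (x * y) = Total.rightEven T x * y + x * Total.rightEven T y := by
  induction x, y using Total.induction₂ with
  | zero_left y => simp
  | zero_right x => simp
  | add_left x x' y h h' => simp only [add_mul, map_add, h, h']; abel
  | add_right x y y' h h' => simp only [mul_add, map_add, h, h']; abel
  | tmul i j w w' η η' hη hw =>
    rw [Total.tmul_mul_tmul i j _ _ _ _ hη hw, Total.map_units_smul]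
    simp only [Total.rightEven, Total.map_tmul, LinearMap.id_apply]
    rw [Total.tmul_mul_tmul i j _ _ _ _ ((Forms.parity R).even_shift hT hη) hw,
      Total.tmul_mul_tmul i j _ _ _ _ hη hw, hm, Total.tmul_add, smul_add]

theorem Total.sgn_one : Total.sgn (1 : Total 𝔤 R) = 1 := by
  rw [← GradedTensorProduct.of_one, Algebra.TensorProduct.one_def]
  simp only [Total.sgn, Total.map_tmul, AlgHom.toLinearMap_apply, map_one]

end Total

section Models

variable {𝔤 : Type*} [LieRing 𝔤] [LieAlgebra ℝ 𝔤] {R : Type*} [CommRing R] [Algebra ℝ R]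
  {ι : Type*} [Fintype ι] (ξ : Module.Basis ι ℝ 𝔤) (V : 𝔤 → VField R)

/-- The differential `d = d_W ⊗ 1 + 1 ⊗ d` on `W(𝔤) ⊗ Ω`. -/
def weilD : Total 𝔤 R →ₗ[ℝ] Total 𝔤 R :=
  Total.left (Weil.d ξ) + Total.rightOdd Forms.extD

/-- The interior product `I_a ⊗ 1 + 1 ⊗ ι_a` on `W(𝔤) ⊗ Ω`. -/
def totalContr (a : ι) : Total 𝔤 R →ₗ[ℝ] Total 𝔤 R :=
  Total.left (Weil.contr (ξ a)) + Total.rightOdd (Forms.contr (V (ξ a)))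

/-- The Lie derivative `L_a ⊗ 1 + 1 ⊗ 𝓛_a` on `W(𝔤) ⊗ Ω`. -/
def totalLie (a : ι) : Total 𝔤 R →ₗ[ℝ] Total 𝔤 R :=
  Total.left (Weil.lie ξ a) + Total.rightEven (Forms.lieDer (V (ξ a)))

/-- The operator `ω^a ⊗ ι_a` on `W(𝔤) ⊗ Ω` (summed over `a`). -/
def omegaContr : Total 𝔤 R →ₗ[ℝ] Total 𝔤 R :=
  ∑ a, LinearMap.mulLeft ℝ (Weil.omega (ξ.coord a) ᵍ⊗ₜ[ℝ] 1 : Total 𝔤 R) ∘ₗ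
    Total.rightOdd (Forms.contr (V (ξ a)))

/-- The BRST differential `δ = d + ω^a ⊗ 𝓛_a - φ^b ⊗ ι_b`. -/
def brstD : Total 𝔤 R →ₗ[ℝ] Total 𝔤 R :=
  weilD ξ +
    ∑ a, LinearMap.mulLeft ℝ (Weil.omega (ξ.coord a) ᵍ⊗ₜ[ℝ] 1 : Total 𝔤 R) ∘ₗ
      Total.rightEven (Forms.lieDer (V (ξ a))) -
    ∑ b, LinearMap.mulLeft ℝ (Weil.phi (ξ.coord b) ᵍ⊗ₜ[ℝ] 1 : Total 𝔤 R) ∘ₗ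
      Total.rightOdd (Forms.contr (V (ξ b)))

/-- The map `ψ = exp (- ω^a ⊗ ι_a)`. The exponential series terminates, since `ω^a ⊗ ι_a` (summed
over `a`) is a sum of `card ι` commuting operators of square zero. -/
def psi : Module.End ℝ (Total 𝔤 R) :=
  ∑ k ∈ Finset.range (Fintype.card ι + 1), ((k.factorial : ℝ)⁻¹) • (-(omegaContr ξ V)) ^ k

theorem totalContr_mul (a : ι) (x y : Total 𝔤 R) :
    totalContr ξ V a (x * y) = totalContr ξ V a x * y + Total.sgn x * totalContr ξ V a y := by
  simp only [totalContr, LinearMap.add_apply]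
  rw [Total.left_odd_mul (Weil.parity_contr _) (Weil.contr_mul _),
    Total.rightOdd_mul (Forms.parity_contr _) (Forms.contr_mul _), add_mul, mul_add]
  abel

theorem totalLie_mul (a : ι) (x y : Total 𝔤 R) :
    totalLie ξ V a (x * y) = totalLie ξ V a x * y + x * totalLie ξ V a y := by
  simp only [totalLie, LinearMap.add_apply]
  rw [Total.left_even_mul (Weil.parity_lie ξ a) (Weil.lie_mul ξ a),
    Total.rightEven_mul (Forms.parity_lieDer _) (Forms.lieDer_mul _), add_mul, mul_add]
  abel

theorem totalContr_one (a : ι) : totalContr ξ V a (1 : Total 𝔤 R) = 0 := by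
  have h := totalContr_mul ξ V a 1 1
  rwa [mul_one, mul_one, Total.sgn_one, one_mul, left_eq_add] at h

theorem totalLie_one (a : ι) : totalLie ξ V a (1 : Total 𝔤 R) = 0 := by
  have h := totalLie_mul ξ V a 1 1
  rwa [mul_one, mul_one, one_mul, left_eq_add] at h

/-- The basic subalgebra `(W(𝔤) ⊗ Ω)_basic`. -/
def weilBasic : Subalgebra ℝ (Total 𝔤 R) where
  carrier := { x | (∀ a, totalContr ξ V a x = 0) ∧ ∀ b, totalLie ξ V b x = 0 }
  mul_mem' := fun {x y} hx hy => ⟨fun a => by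
    rw [totalContr_mul, hx.1 a, hy.1 a, zero_mul, mul_zero, add_zero], fun b => by
    rw [totalLie_mul, hx.2 b, hy.2 b, zero_mul, mul_zero, add_zero]⟩
  add_mem' := fun {x y} hx hy => ⟨fun a => by
    rw [map_add, hx.1 a, hy.1 a, add_zero], fun b => by
    rw [map_add, hx.2 b, hy.2 b, add_zero]⟩
  algebraMap_mem' c := ⟨fun a => by
    rw [Algebra.algebraMap_eq_smul_one, map_smul, totalContr_one, smul_zero], fun b => by
    rw [Algebra.algebraMap_eq_smul_one, map_smul, totalLie_one, smul_zero]⟩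

end Models

section Cartan

variable (𝔤 : Type*) [LieRing 𝔤] [LieAlgebra ℝ 𝔤] (R : Type*) [CommRing R] [Algebra ℝ R]

/-- The algebra `S(𝔤*) ⊗ Ω`. (As `S(𝔤*)` is even, there is no sign in the product.) -/
def CartanTotal : Type _ := Sym 𝔤 ⊗[ℝ] Forms R

instance : Ring (CartanTotal 𝔤 R) := inferInstanceAs (Ring (Sym 𝔤 ⊗[ℝ] Forms R))
instance : Algebra ℝ (CartanTotal 𝔤 R) := inferInstanceAs (Algebra ℝ (Sym 𝔤 ⊗[ℝ] Forms R))

variable {𝔤 R}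

/-- The element `s ⊗ η` of `S(𝔤*) ⊗ Ω`. -/
def CartanTotal.tmul (s : Sym 𝔤) (η : Forms R) : CartanTotal 𝔤 R := s ⊗ₜ[ℝ] η

/-- The operator `S ⊗ T` on `S(𝔤*) ⊗ Ω`. -/
def CartanTotal.map (S : Sym 𝔤 →ₗ[ℝ] Sym 𝔤) (T : Forms R →ₗ[ℝ] Forms R) :
    CartanTotal 𝔤 R →ₗ[ℝ] CartanTotal 𝔤 R :=
  (TensorProduct.map S T : Sym 𝔤 ⊗[ℝ] Forms R →ₗ[ℝ] Sym 𝔤 ⊗[ℝ] Forms R)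

theorem CartanTotal.map_tmul (S : Sym 𝔤 →ₗ[ℝ] Sym 𝔤) (T : Forms R →ₗ[ℝ] Forms R) (s : Sym 𝔤)
    (η : Forms R) :
    CartanTotal.map S T (CartanTotal.tmul s η) = CartanTotal.tmul (S s) (T η) := rfl

theorem CartanTotal.tmul_mul_tmul (s t : Sym 𝔤) (η θ : Forms R) :
    CartanTotal.tmul s η * CartanTotal.tmul t θ = CartanTotal.tmul (s * t) (η * θ) :=
  Algebra.TensorProduct.tmul_mul_tmul s t η θ

theorem CartanTotal.one_def : (1 : CartanTotal 𝔤 R) = CartanTotal.tmul 1 1 := rfl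

theorem CartanTotal.add_tmul (s t : Sym 𝔤) (η : Forms R) :
    CartanTotal.tmul (s + t) η = CartanTotal.tmul s η + CartanTotal.tmul t η :=
  TensorProduct.add_tmul s t η

theorem CartanTotal.tmul_add (s : Sym 𝔤) (η θ : Forms R) :
    CartanTotal.tmul s (η + θ) = CartanTotal.tmul s η + CartanTotal.tmul s θ :=
  TensorProduct.tmul_add s η θ

theorem CartanTotal.induction {P : CartanTotal 𝔤 R → Prop} (x : CartanTotal 𝔤 R) (zero : P 0)
    (tmul : ∀ s η, P (CartanTotal.tmul s η)) (add : ∀ x y, P x → P y → P (x + y)) : P x :=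
  TensorProduct.induction_on (motive := P) x zero tmul add

theorem Total.units_smul_map (T : Total 𝔤 R →ₗ[ℝ] CartanTotal 𝔤 R) (u : ℤˣ) (x : Total 𝔤 R) :
    T (u • x) = u • T x := by
  rcases Int.units_eq_one_or u with rfl | rfl <;> simp

/-- The parity involution of `S(𝔤*) ⊗ Ω`. -/
def CartanTotal.sgn : CartanTotal 𝔤 R →ₗ[ℝ] CartanTotal 𝔤 R :=
  CartanTotal.map LinearMap.id (Forms.parity R).inv.toLinearMap

variable (𝔤 R) in
/-- The linear map underlying `cartanIncl`. -/
def cartanInclLinear : CartanTotal 𝔤 R →ₗ[ℝ] Total 𝔤 R :=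
  (GradedTensorProduct.of ℝ (Weil.parity 𝔤).grading (Forms.parity R).grading).toLinearMap ∘ₗ
    (TensorProduct.map (Algebra.TensorProduct.includeLeft :
      Sym 𝔤 →ₐ[ℝ] Sym 𝔤 ⊗[ℝ] Ext 𝔤).toLinearMap LinearMap.id :
        Sym 𝔤 ⊗[ℝ] Forms R →ₗ[ℝ] Weil 𝔤 ⊗[ℝ] Forms R)

theorem cartanInclLinear_tmul (s : Sym 𝔤) (η : Forms R) :
    cartanInclLinear 𝔤 R (CartanTotal.tmul s η) = (Weil.tmul s 1 ᵍ⊗ₜ[ℝ] η : Total 𝔤 R) := rfl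

theorem cartanInclLinear_mul (x y : CartanTotal 𝔤 R) :
    cartanInclLinear 𝔤 R (x * y) = cartanInclLinear 𝔤 R x * cartanInclLinear 𝔤 R y := by
  induction x using CartanTotal.induction with
  | zero => simp
  | add x x' h h' => simp only [add_mul, map_add, h, h']
  | tmul s η =>
    induction y using CartanTotal.induction with
    | zero => simp
    | add y y' h h' => simp only [mul_add, map_add, h, h']
    | tmul t θ =>
      have ht : Weil.tmul t (1 : Ext 𝔤) ∈ (Weil.parity 𝔤).grading 0 := by
        rw [Parity.mem_grading, Weil.parity_tmul, map_one, uzpow_zero, one_smul]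
      rw [CartanTotal.tmul_mul_tmul, cartanInclLinear_tmul, cartanInclLinear_tmul,
        cartanInclLinear_tmul]
      refine (Forms.parity R).induction (P := fun η => (Weil.tmul (s * t) 1 ᵍ⊗ₜ[ℝ] (η * θ) :
        Total 𝔤 R) = Weil.tmul s 1 ᵍ⊗ₜ[ℝ] η * Weil.tmul t 1 ᵍ⊗ₜ[ℝ] θ) ?_ ?_ η
      · intro a b ha hb
        rw [add_mul, Total.tmul_add, Total.tmul_add, add_mul, ha, hb]
      · intro i a ha
        rw [Total.tmul_mul_tmul 0 i _ _ _ _ ha ht, mul_zero, uzpow_zero, one_smul,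
          Weil.tmul_mul_tmul, mul_one]

variable (𝔤 R) in
/-- The inclusion `S(𝔤*) ⊗ Ω → W(𝔤) ⊗ Ω`, `s ⊗ η ↦ (s ⊗ 1) ⊗ η`. -/
def cartanIncl : CartanTotal 𝔤 R →ₐ[ℝ] Total 𝔤 R :=
  AlgHom.ofLinearMap (cartanInclLinear 𝔤 R) rfl cartanInclLinear_mul

theorem cartanIncl_tmul (s : Sym 𝔤) (η : Forms R) :
    cartanIncl 𝔤 R (CartanTotal.tmul s η) = (Weil.tmul s 1 ᵍ⊗ₜ[ℝ] η : Total 𝔤 R) := rfl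

variable (𝔤) in
/-- The homomorphism `W(𝔤) → S(𝔤*)` with `ω^a ↦ 0` and `φ^a ↦ φ^a`. -/
def Weil.omegaZero : Weil 𝔤 →ₐ[ℝ] Sym 𝔤 :=
  (Algebra.TensorProduct.lift (AlgHom.id ℝ (Sym 𝔤))
    ((Algebra.ofId ℝ (Sym 𝔤)).comp ExteriorAlgebra.algebraMapInv) (fun _ _ => Commute.all _ _) :
    Sym 𝔤 ⊗[ℝ] Ext 𝔤 →ₐ[ℝ] Sym 𝔤)

theorem Weil.omegaZero_tmul (s : Sym 𝔤) (a : Ext 𝔤) : Weil.omegaZero 𝔤 (Weil.tmul s a) =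
    s * algebraMap ℝ (Sym 𝔤) (ExteriorAlgebra.algebraMapInv a) := rfl

theorem Weil.omegaZero_omega (l : Module.Dual ℝ 𝔤) : Weil.omegaZero 𝔤 (Weil.omega l) = 0 := by
  rw [Weil.omega, Weil.omegaZero_tmul, ExteriorAlgebra.algebraMapInv, ExteriorAlgebra.lift_ι_apply]
  simp

theorem Weil.omegaZero_phi (l : Module.Dual ℝ 𝔤) :
    Weil.omegaZero 𝔤 (Weil.phi l) = SymmetricAlgebra.ι ℝ _ l := by
  rw [Weil.phi, Weil.omegaZero_tmul, map_one, map_one, mul_one]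

theorem Weil.omegaZero_parity (x : Weil 𝔤) :
    Weil.omegaZero 𝔤 ((Weil.parity 𝔤).inv x) = Weil.omegaZero 𝔤 x := by
  induction x using Weil.induction with
  | zero => simp
  | add x x' h h' => simp only [map_add, h, h']
  | tmul s a =>
    rw [Weil.parity_tmul, Weil.omegaZero_tmul, Weil.omegaZero_tmul]
    congr 2
    induction a using CliffordAlgebra.left_induction with
    | algebraMap r => rw [AlgHom.commutes]
    | add x y hx hy => simp only [map_add, hx, hy]
    | ι_mul x m hx =>
      rw [map_mul, map_mul, map_mul, CliffordAlgebra.involute_ι, map_neg]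
      have : ExteriorAlgebra.algebraMapInv (R := ℝ) (CliffordAlgebra.ι 0 m : Ext 𝔤) = 0 :=
        ExteriorAlgebra.lift_ι_apply _ _ _ _
      rw [this]
      simp

variable (𝔤 R) in
/-- The linear map underlying `omegaZero`. -/
def omegaZeroLinear : Total 𝔤 R →ₗ[ℝ] CartanTotal 𝔤 R :=
  (TensorProduct.map (Weil.omegaZero 𝔤).toLinearMap LinearMap.id :
      Weil 𝔤 ⊗[ℝ] Forms R →ₗ[ℝ] Sym 𝔤 ⊗[ℝ] Forms R) ∘ₗ
    (GradedTensorProduct.of ℝ (Weil.parity 𝔤).grading (Forms.parity R).grading).symm.toLinearMap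

theorem omegaZeroLinear_tmul (w : Weil 𝔤) (η : Forms R) :
    omegaZeroLinear 𝔤 R (w ᵍ⊗ₜ[ℝ] η : Total 𝔤 R) = CartanTotal.tmul (Weil.omegaZero 𝔤 w) η := rfl

theorem omegaZeroLinear_mul (x y : Total 𝔤 R) :
    omegaZeroLinear 𝔤 R (x * y) = omegaZeroLinear 𝔤 R x * omegaZeroLinear 𝔤 R y := by
  induction x, y using Total.induction₂ with
  | zero_left y => simp
  | zero_right x => simp
  | add_left x x' y h h' => simp only [add_mul, map_add, h, h']
  | add_right x y y' h h' => simp only [mul_add, map_add, h, h']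
  | tmul i j w w' η η' hη hw =>
    have hi : i = 0 ∨ i = 1 := (by decide : ∀ j : ZMod 2, j = 0 ∨ j = 1) i
    rcases hi with rfl | rfl
    · rw [Total.tmul_mul_tmul 0 j _ _ _ _ hη hw, mul_zero, uzpow_zero, one_smul,
        omegaZeroLinear_tmul, omegaZeroLinear_tmul, omegaZeroLinear_tmul,
        CartanTotal.tmul_mul_tmul, map_mul]
    · have h0 : Weil.omegaZero 𝔤 w' = 0 := by
        have h := Weil.omegaZero_parity w'
        rw [Parity.mem_grading, uzpow_one, Units.neg_smul, one_smul] at hw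
        rw [hw, map_neg] at h
        have h2 : (2 : ℝ) • Weil.omegaZero 𝔤 w' = 0 := by
          rw [two_smul]
          nth_rewrite 1 [← h]
          exact neg_add_cancel _
        exact (smul_eq_zero_iff_right two_ne_zero).mp h2
      have hz : ∀ θ : Forms R, CartanTotal.tmul (0 : Sym 𝔤) θ = 0 := fun θ =>
        TensorProduct.zero_tmul _ θ
      rw [Total.tmul_mul_tmul 1 j _ _ _ _ hη hw, Total.units_smul_map, omegaZeroLinear_tmul,
        omegaZeroLinear_tmul, omegaZeroLinear_tmul, map_mul, h0, mul_zero, hz, hz, mul_zero,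
        smul_zero]

variable (𝔤 R) in
/-- The homomorphism `W(𝔤) ⊗ Ω → S(𝔤*) ⊗ Ω` with `ω^a ↦ 0`, and the identity on `S(𝔤*)` and on
`Ω`. -/
def omegaZero : Total 𝔤 R →ₐ[ℝ] CartanTotal 𝔤 R :=
  AlgHom.ofLinearMap (omegaZeroLinear 𝔤 R)
    (by
      change CartanTotal.tmul (Weil.omegaZero 𝔤 1) (1 : Forms R) = _
      rw [map_one, CartanTotal.one_def])
    omegaZeroLinear_mul

theorem omegaZero_tmul (w : Weil 𝔤) (η : Forms R) :
    omegaZero 𝔤 R (w ᵍ⊗ₜ[ℝ] η : Total 𝔤 R) = CartanTotal.tmul (Weil.omegaZero 𝔤 w) η := rfl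

variable {ι : Type*} [Fintype ι] (ξ : Module.Basis ι ℝ 𝔤) (V : 𝔤 → VField R)

/-- The action of `x` on `S(𝔤*) ⊗ Ω`: the coadjoint action on `S(𝔤*)` and the Lie derivative
on `Ω`. -/
def cartanLie (x : 𝔤) : CartanTotal 𝔤 R →ₗ[ℝ] CartanTotal 𝔤 R :=
  CartanTotal.map (Sym.lie x : Sym 𝔤 →ₗ[ℝ] Sym 𝔤) LinearMap.id +
    CartanTotal.map LinearMap.id (Forms.lieDer (V x))

theorem cartanLie_tmul (x : 𝔤) (s : Sym 𝔤) (η : Forms R) : cartanLie V x (CartanTotal.tmul s η) =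
    CartanTotal.tmul (Sym.lie x s) η + CartanTotal.tmul s (Forms.lieDer (V x) η) := rfl

theorem cartanLie_mul (x : 𝔤) (y z : CartanTotal 𝔤 R) :
    cartanLie V x (y * z) = cartanLie V x y * z + y * cartanLie V x z := by
  induction y using CartanTotal.induction with
  | zero => simp
  | add y y' h h' => simp only [add_mul, map_add, h, h']; abel
  | tmul s η =>
    induction z using CartanTotal.induction with
    | zero => simp
    | add z z' h h' => simp only [mul_add, map_add, h, h']; abel
    | tmul t θ =>
      simp only [CartanTotal.tmul_mul_tmul, cartanLie_tmul, Derivation.leibniz, Forms.lieDer_mul,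
        CartanTotal.add_tmul, CartanTotal.tmul_add, add_mul, mul_add, smul_eq_mul]
      rw [mul_comm t]
      abel

theorem cartanLie_one (x : 𝔤) : cartanLie V x (1 : CartanTotal 𝔤 R) = 0 := by
  have h := cartanLie_mul V x 1 1
  rwa [mul_one, mul_one, one_mul, left_eq_add] at h

/-- The (infinitesimally) `G`-invariant subalgebra `(S(𝔤*) ⊗ Ω)^G`. -/
def cartanAlgebra : Subalgebra ℝ (CartanTotal 𝔤 R) where
  carrier := { y | ∀ x, cartanLie V x y = 0 }
  mul_mem' := fun {y z} hy hz x => by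
    rw [cartanLie_mul, hy x, hz x, zero_mul, mul_zero, add_zero]
  add_mem' := fun {y z} hy hz x => by
    rw [map_add, hy x, hz x, add_zero]
  algebraMap_mem' c x := by
    rw [Algebra.algebraMap_eq_smul_one, map_smul, cartanLie_one, smul_zero]

/-- The Cartan differential `D = 1 ⊗ d - φ^b ⊗ ι_b`. -/
def cartanD : CartanTotal 𝔤 R →ₗ[ℝ] CartanTotal 𝔤 R :=
  CartanTotal.map LinearMap.id Forms.extD -
    ∑ b, CartanTotal.map (LinearMap.mulLeft ℝ (SymmetricAlgebra.ι ℝ _ (ξ.coord b)))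
      (Forms.contr (V (ξ b)))

end Cartan

section Degrees

variable (𝔤 : Type*) [LieRing 𝔤] [LieAlgebra ℝ 𝔤] (R : Type*) [CommRing R] [Algebra ℝ R]

/-- The homogeneous polynomials of polynomial degree `p` in `S(𝔤*)`. -/
def Sym.polyDeg (p : ℕ) : Submodule ℝ (Sym 𝔤) :=
  LinearMap.range (SymmetricAlgebra.ι ℝ (Module.Dual ℝ 𝔤)) ^ p

/-- The elements of degree `n` of `W(𝔤)`, where the `φ^a` have degree `2` and the `ω^a` have
degree `1`. -/
def Weil.deg (n : ℕ) : Submodule ℝ (Weil 𝔤) :=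
  Submodule.span ℝ { w | ∃ p q, 2 * p + q = n ∧
    ∃ s ∈ Sym.polyDeg 𝔤 p, ∃ a ∈ (⋀[ℝ]^q (Module.Dual ℝ 𝔤) : Submodule ℝ (Ext 𝔤)),
      w = Weil.tmul s a }

/-- The elements of total degree `n` of `W(𝔤) ⊗ Ω`. -/
def Total.deg (n : ℕ) : Submodule ℝ (Total 𝔤 R) :=
  Submodule.span ℝ { x | ∃ m k, m + k = n ∧
    ∃ w ∈ Weil.deg 𝔤 m, ∃ η ∈ Forms.deg R k, x = w ᵍ⊗ₜ[ℝ] η }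

/-- The elements of total degree `n` of `S(𝔤*) ⊗ Ω`, where the `φ^a` have degree `2`. -/
def CartanTotal.deg (n : ℕ) : Submodule ℝ (CartanTotal 𝔤 R) :=
  Submodule.span ℝ { x | ∃ p k, 2 * p + k = n ∧
    ∃ s ∈ Sym.polyDeg 𝔤 p, ∃ η ∈ Forms.deg R k, x = CartanTotal.tmul s η }

end Degrees

/-- `d` restricts to a differential on the subalgebra `C`: it is an antiderivation of degree `1` and
of square zero. Here `sgn` is the parity involution and `deg n` the space of elements of
degree `n`. -/
structure IsDifferential {A : Type*} [Ring A] [Algebra ℝ A] (sgn : A →ₗ[ℝ] A)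
    (deg : ℕ → Submodule ℝ A) (d : A →ₗ[ℝ] A) (C : Subalgebra ℝ A) : Prop where
  mem : ∀ x ∈ C, d x ∈ C
  degree : ∀ n, ∀ x ∈ C, x ∈ deg n → d x ∈ deg (n + 1)
  leibniz : ∀ x ∈ C, ∀ y ∈ C, d (x * y) = d x * y + sgn x * d y
  sq_zero : ∀ x ∈ C, d (d x) = 0

section Geometry

variable {k m : ℕ} {G : Type*} [TopologicalSpace G] [ChartedSpace (EuclideanSpace ℝ (Fin k)) G]
  [Group G] [LieGroup (𝓡 k) ∞ G]
  {M : Type*} [TopologicalSpace M] [ChartedSpace (EuclideanSpace ℝ (Fin m)) M]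
  [IsManifold (𝓡 m) ∞ M] [MulAction G M] [ContMDiffSMul (𝓡 k) (𝓡 m) ∞ G M]

instance : LieGroup (𝓡 k) (minSmoothness ℝ 3) G :=
  LieGroup.of_le (m := minSmoothness ℝ 3) (n := ∞) (by
    rw [minSmoothness_of_isRCLikeNormedField]
    exact WithTop.coe_le_coe.mpr le_top)

/-- The function `x ↦ - d/dt f(exp(tξ) x)` at `t = 0`, i.e. minus the derivative of `g ↦ f(g x)` at
the identity in the direction `ξ`. -/
def orbitDeriv (ξ : GroupLieAlgebra (𝓡 k) G) (f : C^∞⟮𝓡 m, M; ℝ⟯) (x : M) : ℝ :=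
  -(mfderiv (𝓡 k) 𝓘(ℝ, ℝ) (fun g : G => f (g • x)) 1 ξ)

theorem contMDiff_orbit (f : C^∞⟮𝓡 m, M; ℝ⟯) (x : M) :
    ContMDiff (𝓡 k) 𝓘(ℝ, ℝ) ∞ (fun g : G => f (g • x)) :=
  f.contMDiff.comp ((contMDiff_smul (I := 𝓡 k) (I' := 𝓡 m) (n := ∞) (G := G) (M := M)).comp
    (contMDiff_id.prodMk contMDiff_const))

theorem mdiff_orbit (f : C^∞⟮𝓡 m, M; ℝ⟯) (x : M) :
    MDifferentiableAt (𝓡 k) 𝓘(ℝ, ℝ) (fun g : G => f (g • x)) 1 :=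
  (contMDiff_orbit f x).mdifferentiableAt (by simp)

theorem contMDiff_orbitDeriv (ξ : GroupLieAlgebra (𝓡 k) G) (f : C^∞⟮𝓡 m, M; ℝ⟯) :
    ContMDiff (𝓡 m) 𝓘(ℝ, ℝ) ∞ (orbitDeriv ξ f) := by
  intro x₀
  have h := ContMDiffAt.mfderiv_apply (I := 𝓡 k) (I' := 𝓘(ℝ, ℝ)) (J := 𝓡 m) (J' := 𝓡 m) (m := ∞)
    (n := ∞) (x₀ := x₀) (fun (x : M) (g : G) => f (g • x)) (fun _ => (1 : G)) id (fun _ => ξ)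
    ((f.contMDiff.comp ((contMDiff_smul (I := 𝓡 k) (I' := 𝓡 m) (n := ∞) (G := G) (M := M)).comp
      (contMDiff_snd.prodMk contMDiff_fst))).contMDiffAt)
    contMDiffAt_const contMDiffAt_id contMDiffAt_const (by simp)
  refine h.neg.congr_of_eventuallyEq (Filter.Eventually.of_forall fun x => ?_)
  rw [orbitDeriv]
  refine congrArg Neg.neg ?_
  have hc := inTangentCoordinates_eq (I := 𝓡 k) (I' := 𝓘(ℝ, ℝ)) (fun _ : M => (1 : G))
    (fun x : M => f ((1 : G) • x))
    (fun x : M => mfderiv (𝓡 k) 𝓘(ℝ, ℝ) (fun g : G => f (g • x)) 1) (x₀ := x₀) (x := x)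
    (mem_chart_source _ _) (by rw [chartAt_self_eq]; exact Set.mem_univ _)
  refine Eq.trans ?_ (congrArg (fun T : EuclideanSpace ℝ (Fin k) →L[ℝ] ℝ => T ξ) hc).symm
  have h1 := (tangentBundleCore (𝓡 k) G).coordChange_self (achart _ (1 : G)) 1
    (mem_chart_source _ _) ξ
  have h2 := fun r : ℝ => (tangentBundleCore 𝓘(ℝ, ℝ) ℝ).coordChange_self
    (achart ℝ (f ((1 : G) • x))) (f ((1 : G) • x)) (mem_chart_source _ _) r
  have key : ∀ (A : EuclideanSpace ℝ (Fin k) →L[ℝ] ℝ)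
      (B : EuclideanSpace ℝ (Fin k) →L[ℝ] EuclideanSpace ℝ (Fin k)) (C : ℝ →L[ℝ] ℝ)
      (v : EuclideanSpace ℝ (Fin k)),
      B v = v → (∀ r, C r = r) → A v = (C ∘L A ∘L B) v := fun A B C v hB hC => by
    rw [ContinuousLinearMap.comp_apply, ContinuousLinearMap.comp_apply, hB, hC]
  exact key _ _ _ ξ h1 h2

/-- The vector field on `M` generated by `ξ`, with `(V_ξ f)(x) = - d/dt f(exp(tξ) x)` at `t = 0`. The
sign, needed for a left action, makes `ξ ↦ V_ξ` a homomorphism of Lie algebras. -/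
def fundField (M : Type*) [TopologicalSpace M] [ChartedSpace (EuclideanSpace ℝ (Fin m)) M]
    [IsManifold (𝓡 m) ∞ M] [MulAction G M] [ContMDiffSMul (𝓡 k) (𝓡 m) ∞ G M]
    (ξ : GroupLieAlgebra (𝓡 k) G) : VField C^∞⟮𝓡 m, M; ℝ⟯ :=
  Derivation.mk'
    { toFun := fun f => ⟨orbitDeriv ξ f, contMDiff_orbitDeriv ξ f⟩
      map_add' := fun f g => by
        ext x
        change orbitDeriv ξ (f + g) x = orbitDeriv ξ f x + orbitDeriv ξ g x
        have h := mfderiv_add (mdiff_orbit (k := k) (G := G) f x) (mdiff_orbit (k := k) (G := G) g x)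
        have e : (fun a : G => (f + g) (a • x)) =
          (fun a : G => f (a • x)) + (fun a : G => g (a • x)) := rfl
        have key : ∀ (A B : EuclideanSpace ℝ (Fin k) →L[ℝ] ℝ) (v : EuclideanSpace ℝ (Fin k)),
            -((A + B) v) = -(A v) + -(B v) := fun A B v => by
          rw [add_apply, neg_add]
        rw [orbitDeriv, e, h]
        exact key _ _ ξ
      map_smul' := fun c f => by
        ext x
        change orbitDeriv ξ (c • f) x = c * orbitDeriv ξ f x
        have h := ((mdiff_orbit (k := k) (G := G) f x).hasMFDerivAt.const_smul c).mfderiv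
        have e : (fun a : G => (c • f) (a • x)) = c • (fun a : G => f (a • x)) := rfl
        have key : ∀ (A : EuclideanSpace ℝ (Fin k) →L[ℝ] ℝ) (v : EuclideanSpace ℝ (Fin k)),
            -((c • A) v) = c * -(A v) := fun A v => by
          rw [smul_apply, smul_eq_mul, mul_neg]
        rw [orbitDeriv, e, h]
        exact key _ ξ }
    (fun f g => by
      ext x
      change orbitDeriv ξ (f * g) x = f x * orbitDeriv ξ g x + g x * orbitDeriv ξ f x
      have h := ((mdiff_orbit (k := k) (G := G) f x).hasMFDerivAt.mul
        (mdiff_orbit (k := k) (G := G) g x).hasMFDerivAt).mfderiv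
      have e : (fun a : G => (f * g) (a • x)) =
        (fun a : G => f (a • x)) * (fun a : G => g (a • x)) := rfl
      have key : ∀ (A B : EuclideanSpace ℝ (Fin k) →L[ℝ] ℝ) (v : EuclideanSpace ℝ (Fin k))
          (a b a' b' : ℝ), a' = a → b' = b →
          -((a' • A + b' • B) v) = a * -(A v) + b * -(B v) := fun A B v a b a' b' ha hb => by
        rw [ha, hb, add_apply, smul_apply, smul_apply, smul_eq_mul, smul_eq_mul]
        ring
      rw [orbitDeriv, e, h]
      exact key _ _ ξ _ _ _ _ (congrArg f (one_smul G x)) (congrArg g (one_smul G x)))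

theorem fundField_apply (ξ : GroupLieAlgebra (𝓡 k) G) (f : C^∞⟮𝓡 m, M; ℝ⟯) (x : M) :
    fundField M ξ f x = -(mfderiv (𝓡 k) 𝓘(ℝ, ℝ) (fun g : G => f (g • x)) 1 ξ) := rfl

end Geometry

end EquivariantForms

end

open EquivariantForms

/-!
# The Cartan model as the invariant horizontal part of the BRST algebra

Everything follows from conjugation with `ψ = exp(-E)`, where `E = ω^a ⊗ ι_a` is even, of degree `0`
and nilpotent, being a sum of `dim 𝔤` commuting operators of square zero (`omegaContr_pow`).

Each summand of `E` is the product of an odd element with an odd derivation, so that `E` is an even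
derivation and `ψ` an automorphism of the algebra (`psi_mul`). The commutator of `E` with `d` is
`ω^a 𝓛_a - φ^b ι_b` plus a term quadratic in `ω`, and the next commutator cancels this term, so that
the exponential series for `ψ⁻¹ d ψ = exp(E) d exp(-E)` stops and yields exactly the BRST
differential `δ` (`psiInv_mul_d_mul_psi`). Hence `δ` inherits from `d` that it is an antiderivation
of square zero. In the same way, `ψ` intertwines `I_a ⊗ 1` with `I_a ⊗ 1 + 1 ⊗ ι_a`
(`totalContr_mul_psi`), and it commutes with the Lie derivatives `L_a ⊗ 1 + 1 ⊗ 𝓛_a`, as `E` is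
invariant (`totalLie_mul_psi`). So `ψ` maps the invariant elements annihilated by all `I_a ⊗ 1` onto
the basic elements (`psi_image`).

The elements annihilated by all `I_a ⊗ 1` are those without `ω`, i.e. the image of the inclusion `j`
of `S(𝔤*) ⊗ Ω`: the product of the projections `1 - ω^a I_a` fixes them, and it is `ω^a ↦ 0`
(`eq_cartanIncl_of_contr`). If `y` is an invariant such element, then so is `δ y`, by Cartan's formula
for `δ` and `I_a ⊗ 1`. Therefore `δ y` is determined by its image under the homomorphism `p` setting
all `ω^a` to zero, and `p δ j = D` (`brstD_cartanIncl`). This also gives the properties of the Cartan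
differential. Finally `p ψ = p`, as `ψ - 1` produces factors `ω^a`, so that `ψ⁻¹ = j p` on basic
elements (`psiInv_eq`).

The input consists of the Cartan calculus on differential forms, of `d² = 0` in the Weil algebra, and
of the fact that `ξ ↦ V_ξ` is a homomorphism of Lie algebras (`fundField_lie`). On a Lie group with
the bracket of left-invariant vector fields, the latter amounts to the symmetry of the mixed second
derivatives of `(g, h) ↦ f ((g h) x)`.
-/

noncomputable section

namespace EquivariantForms

/-! ### Second derivatives on manifolds -/

/-- A Lie bracket of vector fields acts on functions as a commutator: the second derivatives of `F`
cancel by symmetry. -/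
theorem fderiv_lieBracket {E : Type*} [NormedAddCommGroup E] [NormedSpace ℝ E] {F : E → ℝ}
    {V W : E → E} {u : E} (hF : ContDiffAt ℝ 2 F u) (hV : DifferentiableAt ℝ V u)
    (hW : DifferentiableAt ℝ W u) :
    fderiv ℝ F u (VectorField.lieBracket ℝ V W u) =
      fderiv ℝ (fun y => fderiv ℝ F y (W y)) u (V u) -
        fderiv ℝ (fun y => fderiv ℝ F y (V y)) u (W u) := by
  have hF' : DifferentiableAt ℝ (fderiv ℝ F) u :=
    (hF.fderiv_right (m := 1) (by norm_num)).differentiableAt (by norm_num)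
  have hs : fderiv ℝ (fderiv ℝ F) u (V u) (W u) = fderiv ℝ (fderiv ℝ F) u (W u) (V u) :=
    (hF.isSymmSndFDerivAt (by simp)).eq _ _
  rw [fderiv_clm_apply hF' hW, fderiv_clm_apply hF' hV, VectorField.lieBracket]
  simp [hs]

/-- Mixed partial derivatives commute, and they exist in the iterated sense: the inner derivative is
differentiable in the outer variable. -/
theorem fderiv_fderiv_swap {E : Type*} [NormedAddCommGroup E] [NormedSpace ℝ E] {Φ : E × E → ℝ}
    {u : E} (h : ContDiffAt ℝ 2 Φ (u, u)) (a b : E) :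
    DifferentiableAt ℝ (fun x => fderiv ℝ (fun y => Φ (x, y)) u b) u ∧
    fderiv ℝ (fun x => fderiv ℝ (fun y => Φ (x, y)) u b) u a =
      fderiv ℝ (fun y => fderiv ℝ (fun x => Φ (x, y)) u a) u b := by
  have hd : ∀ᶠ p in nhds (u, u), DifferentiableAt ℝ Φ p :=
    (h.eventually (by simp)).mono fun p hp => hp.differentiableAt (by norm_num)
  have h1 : (fun x => fderiv ℝ (fun y => Φ (x, y)) u b) =ᶠ[nhds u]
      fun x => fderiv ℝ Φ (x, u) (0, b) := by
    have hc : Filter.Tendsto (fun x : E => (x, u)) (nhds u) (nhds (u, u)) :=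
      (Continuous.prodMk_left u).continuousAt
    filter_upwards [hc.eventually hd] with x hx
    have h2 : HasFDerivAt (fun y : E => (x, y)) (ContinuousLinearMap.inr ℝ E E) u :=
      hasFDerivAt_prodMk_right x u
    have h3 := (HasFDerivAt.comp u (f := fun y : E => (x, y)) hx.hasFDerivAt h2).fderiv
    exact congrArg (fun T : E →L[ℝ] ℝ => T b) h3
  have h1' : (fun y => fderiv ℝ (fun x => Φ (x, y)) u a) =ᶠ[nhds u]
      fun y => fderiv ℝ Φ (u, y) (a, 0) := by
    have hc : Filter.Tendsto (fun y : E => (u, y)) (nhds u) (nhds (u, u)) :=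
      (Continuous.prodMk_right u).continuousAt
    filter_upwards [hc.eventually hd] with y hy
    have h2 : HasFDerivAt (fun x : E => (x, y)) (ContinuousLinearMap.inl ℝ E E) u :=
      hasFDerivAt_prodMk_left u y
    have h3 := (HasFDerivAt.comp u (f := fun x : E => (x, y)) hy.hasFDerivAt h2).fderiv
    exact congrArg (fun T : E →L[ℝ] ℝ => T a) h3
  have h' : HasFDerivAt (fderiv ℝ Φ) (fderiv ℝ (fderiv ℝ Φ) (u, u)) (u, u) :=
    ((h.fderiv_right (m := 1) (by norm_num)).differentiableAt (by norm_num)).hasFDerivAt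
  have e1 : HasFDerivAt (fun x => fderiv ℝ Φ (x, u) (0, b))
      (((fderiv ℝ (fderiv ℝ Φ) (u, u)).comp (ContinuousLinearMap.inl ℝ E E)).flip (0, b)) u := by
    have := (HasFDerivAt.comp u (f := fun x : E => (x, u)) h' (hasFDerivAt_prodMk_left u u)).clm_apply
      (hasFDerivAt_const ((0 : E), b) u)
    simpa using this
  have e2 : HasFDerivAt (fun y => fderiv ℝ Φ (u, y) (a, 0))
      (((fderiv ℝ (fderiv ℝ Φ) (u, u)).comp (ContinuousLinearMap.inr ℝ E E)).flip (a, 0)) u := by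
    have := (HasFDerivAt.comp u (f := fun y : E => (u, y)) h' (hasFDerivAt_prodMk_right u u)).clm_apply
      (hasFDerivAt_const (a, (0 : E)) u)
    simpa using this
  refine ⟨h1.differentiableAt_iff.mpr e1.differentiableAt, ?_⟩
  rw [h1.fderiv_eq, h1'.fderiv_eq, e1.fderiv, e2.fderiv]
  simpa using (h.isSymmSndFDerivAt (by simp)).eq (a, 0) (0, b)

section ManifoldDerivatives

variable {E : Type*} [NormedAddCommGroup E] [NormedSpace ℝ E] [CompleteSpace E]
  {H : Type*} [TopologicalSpace H] {I : ModelWithCorners ℝ E H} [I.Boundaryless]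
  {M : Type*} [TopologicalSpace M] [ChartedSpace H M] [IsManifold I 2 M]

open VectorField

variable (I) in
/-- The derivative `dF_x(v)` of a real function in the direction `v`. The argument `v` is taken in the
model space `E`, to which every tangent space is definitionally equal, so that derivatives at
different points have the same type. -/
def mderiv (F : M → ℝ) (x : M) (v : E) : ℝ := mfderiv I 𝓘(ℝ, ℝ) F x v

variable (I) in
/-- The coordinate expression, in the chart at `x`, of a vector field. It is only meaningful on the
target of the chart. -/
def chartField (V : Π y : M, TangentSpace I y) (x : M) (u : E) : E :=
  mpullback 𝓘(ℝ, E) I (extChartAt I x).symm V u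

/-- The derivative computed in the chart at the base point itself, where the coordinate change of
the tangent bundle is the identity. -/
theorem mderiv_eq_fderiv {F : M → ℝ} {x : M} (hF : MDifferentiableAt I 𝓘(ℝ, ℝ) F x) (v : E) :
    mderiv I F x v = fderiv ℝ (F ∘ (extChartAt I x).symm) (extChartAt I x x) v := by
  have h : mfderiv I 𝓘(ℝ, ℝ) F x =
      fderivWithin ℝ (writtenInExtChartAt I 𝓘(ℝ, ℝ) x F) (Set.range I) (extChartAt I x x) :=
    if_pos hF
  have h' : mderiv I F x v =
      fderivWithin ℝ (writtenInExtChartAt I 𝓘(ℝ, ℝ) x F) (Set.range I) (extChartAt I x x) v :=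
    congrFun (congrArg DFunLike.coe h) v
  rw [h', I.range_eq_univ, fderivWithin_univ]
  rfl

theorem fderiv_chartField {F : M → ℝ} {x : M} {u : E} (hu : u ∈ (extChartAt I x).target)
    (hF : MDifferentiableAt I 𝓘(ℝ, ℝ) F ((extChartAt I x).symm u)) (V : Π y : M, TangentSpace I y) :
    fderiv ℝ (F ∘ (extChartAt I x).symm) u (chartField I V x u) =
      mderiv I F ((extChartAt I x).symm u) (V ((extChartAt I x).symm u)) := by
  have hs : MDifferentiableAt 𝓘(ℝ, E) I (extChartAt I x).symm u := by
    have := mdifferentiableWithinAt_extChartAt_symm (I := I) hu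
    rwa [I.range_eq_univ, mdifferentiableWithinAt_univ] at this
  have hi := isInvertible_mfderivWithin_extChartAt_symm (I := I) hu
  rw [I.range_eq_univ, mfderivWithin_univ] at hi
  rw [← mfderiv_eq_fderiv, mfderiv_comp u hF hs]
  exact congrArg (mderiv I F ((extChartAt I x).symm u)) (hi.self_apply_inverse _)

theorem differentiableAt_chartField {V : Π x : M, TangentSpace I x} {x : M}
    (hV : MDifferentiableAt I I.tangent (fun y => (V y : TangentBundle I M)) x) :
    DifferentiableAt ℝ (chartField I V x) (extChartAt I x x) := by
  have h := (mdifferentiableWithinAt_univ.mpr hV).differentiableWithinAt_mpullbackWithin_vectorField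
  rw [I.range_eq_univ, mpullbackWithin_univ, Set.preimage_univ, Set.univ_inter] at h
  exact differentiableWithinAt_univ.mp h

theorem chartField_self (V : Π x : M, TangentSpace I x) (x : M) :
    chartField I V x (extChartAt I x x) = V x := by
  have h := mfderivWithin_extChartAt_symm_inverse_apply (I := I) (x := x)
    (V ((extChartAt I x).symm (extChartAt I x x)))
  rw [I.range_eq_univ, mfderivWithin_univ] at h
  refine Eq.trans h ?_
  rw [extChartAt_to_inv]

/-- At the centre of the chart no coordinate change is left, so the bracket is that of the
coordinate expressions. -/
theorem mlieBracket_eq_lieBracket (V W : Π x : M, TangentSpace I x) (x : M) :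
    (mlieBracket I V W x : E) =
      lieBracket ℝ (chartField I V x) (chartField I W x) (extChartAt I x x) := by
  let w : E := lieBracketWithin ℝ
    (fun u : E => mpullbackWithin 𝓘(ℝ, E) I (extChartAt I x).symm V (Set.range I) u : E → E)
    (fun u : E => mpullbackWithin 𝓘(ℝ, E) I (extChartAt I x).symm W (Set.range I) u : E → E)
    ((extChartAt I x).symm ⁻¹' Set.univ ∩ Set.range I) (extChartAt I x x)
  have h : (mlieBracket I V W x : E) = (mfderiv I 𝓘(ℝ, E) (extChartAt I x) x).inverse w := rfl
  have hw : w = lieBracket ℝ (chartField I V x) (chartField I W x) (extChartAt I x x) := by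
    simp only [w]
    rw [I.range_eq_univ, mpullbackWithin_univ, mpullbackWithin_univ, Set.preimage_univ,
      Set.univ_inter]
    exact congrFun (lieBracketWithin_univ (V := chartField I V x) (W := chartField I W x)) _
  have hid : (mfderiv I 𝓘(ℝ, E) (extChartAt I x) x).inverse = ContinuousLinearMap.id ℝ E := by
    rw [mfderiv_extChartAt_self]
    exact ContinuousLinearMap.inverse_id
  exact h.trans ((congrFun (congrArg DFunLike.coe hid) w).trans hw)

/-- The Lie bracket of vector fields acts on functions as the commutator. -/
theorem mderiv_mlieBracket {F : M → ℝ} (hF : ContMDiff I 𝓘(ℝ, ℝ) 2 F)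
    {V W : Π x : M, TangentSpace I x} {x : M}
    (hV : MDifferentiableAt I I.tangent (fun y => (V y : TangentBundle I M)) x)
    (hW : MDifferentiableAt I I.tangent (fun y => (W y : TangentBundle I M)) x)
    (hFV : MDifferentiableAt I 𝓘(ℝ, ℝ) (fun y => mderiv I F y (V y)) x)
    (hFW : MDifferentiableAt I 𝓘(ℝ, ℝ) (fun y => mderiv I F y (W y)) x) :
    mderiv I F x (mlieBracket I V W x) =
      mderiv I (fun y => mderiv I F y (W y)) x (V x) -
        mderiv I (fun y => mderiv I F y (V y)) x (W x) := by
  have hu : extChartAt I x x ∈ (extChartAt I x).target := mem_extChartAt_target x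
  have hFd : ∀ y, MDifferentiableAt I 𝓘(ℝ, ℝ) F y := fun y => hF.mdifferentiableAt (by norm_num)
  have hFc : ContDiffAt ℝ 2 (F ∘ (extChartAt I x).symm) (extChartAt I x x) := by
    have := (hF.contMDiffOn (s := Set.univ)).comp (contMDiffOn_extChartAt_symm (I := I) (n := 2) x)
      (fun _ _ => Set.mem_univ _)
    exact (contMDiffOn_iff_contDiffOn.mp this).contDiffAt
      ((isOpen_extChartAt_target x).mem_nhds hu)
  have hnear : ∀ U : Π x : M, TangentSpace I x,
      (fun u => fderiv ℝ (F ∘ (extChartAt I x).symm) u (chartField I U x u)) =ᶠ[nhds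
        (extChartAt I x x)] (fun y => mderiv I F y (U y)) ∘ (extChartAt I x).symm := by
    intro U
    filter_upwards [(isOpen_extChartAt_target x).mem_nhds hu] with u hu'
    exact fderiv_chartField hu' (hFd _) U
  have h := fderiv_lieBracket hFc (differentiableAt_chartField hV) (differentiableAt_chartField hW)
  rw [(hnear W).fderiv_eq, (hnear V).fderiv_eq] at h
  refine (mderiv_eq_fderiv (hFd x) _).trans
    ((congrArg _ (mlieBracket_eq_lieBracket V W x)).trans (h.trans ?_))
  exact congrArg₂ (· - ·)
    ((congrArg _ (chartField_self V x)).trans (mderiv_eq_fderiv hFW _).symm)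
    ((congrArg _ (chartField_self W x)).trans (mderiv_eq_fderiv hFV _).symm)

/-- Mixed partial derivatives of a function on `M × M` commute. -/
theorem mderiv_mderiv_swap {Φ : M × M → ℝ} (hΦ : ContMDiff (I.prod I) 𝓘(ℝ, ℝ) 2 Φ) (x : M)
    (a b : E) :
    MDifferentiableAt I 𝓘(ℝ, ℝ) (fun g => mderiv I (fun h => Φ (g, h)) x b) x ∧
      mderiv I (fun g => mderiv I (fun h => Φ (g, h)) x b) x a =
        mderiv I (fun h => mderiv I (fun g => Φ (g, h)) x a) x b := by
  have hu : extChartAt I x x ∈ (extChartAt I x).target := mem_extChartAt_target x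
  have h1 : ∀ g, MDifferentiableAt I 𝓘(ℝ, ℝ) (fun h => Φ (g, h)) x := fun g =>
    (hΦ.comp (contMDiff_const.prodMk contMDiff_id)).mdifferentiableAt (by norm_num)
  have h2 : ∀ h, MDifferentiableAt I 𝓘(ℝ, ℝ) (fun g => Φ (g, h)) x := fun h =>
    (hΦ.comp (contMDiff_id.prodMk contMDiff_const)).mdifferentiableAt (by norm_num)
  set Ψ : E × E → ℝ := fun p => Φ ((extChartAt I x).symm p.1, (extChartAt I x).symm p.2) with hΨ
  have hc : ContDiffAt ℝ 2 Ψ (extChartAt I x x, extChartAt I x x) := by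
    have hs := contMDiffOn_extChartAt_symm (I := I) (n := 2) x
    have hf : ContMDiffOn 𝓘(ℝ, E × E) I 2 (fun p : E × E => (extChartAt I x).symm p.1)
        ((extChartAt I x).target ×ˢ (extChartAt I x).target) :=
      hs.comp contDiffOn_fst.contMDiffOn (fun p hp => hp.1)
    have hg : ContMDiffOn 𝓘(ℝ, E × E) I 2 (fun p : E × E => (extChartAt I x).symm p.2)
        ((extChartAt I x).target ×ˢ (extChartAt I x).target) :=
      hs.comp contDiffOn_snd.contMDiffOn (fun p hp => hp.2)
    have := (hΦ.contMDiffOn (s := Set.univ)).comp (hf.prodMk hg) (fun _ _ => Set.mem_univ _)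
    exact (contMDiffOn_iff_contDiffOn.mp this).contDiffAt
      (((isOpen_extChartAt_target x).prod (isOpen_extChartAt_target x)).mem_nhds ⟨hu, hu⟩)
  have e : (fun g => mderiv I (fun h => Φ (g, h)) x b) ∘ (extChartAt I x).symm =
      fun u => fderiv ℝ (fun v => Ψ (u, v)) (extChartAt I x x) b := by
    funext u
    exact mderiv_eq_fderiv (h1 _) b
  have e' : (fun h => mderiv I (fun g => Φ (g, h)) x a) ∘ (extChartAt I x).symm =
      fun v => fderiv ℝ (fun u => Ψ (u, v)) (extChartAt I x x) a := by
    funext v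
    exact mderiv_eq_fderiv (h2 _) a
  have hmd : ∀ {P : M → ℝ}, DifferentiableAt ℝ (P ∘ (extChartAt I x).symm) (extChartAt I x x) →
      MDifferentiableAt I 𝓘(ℝ, ℝ) P x := by
    intro P hP
    have h3 : MDifferentiableAt I 𝓘(ℝ, ℝ) ((P ∘ (extChartAt I x).symm) ∘ extChartAt I x) x :=
      hP.mdifferentiableAt.comp x (mdifferentiableAt_extChartAt (mem_chart_source H x))
    refine h3.congr_of_eventuallyEq ?_
    filter_upwards [extChartAt_source_mem_nhds (I := I) x] with y hy
    exact (congrArg P ((extChartAt I x).left_inv hy)).symm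
  obtain ⟨d1, s1⟩ := fderiv_fderiv_swap hc a b
  have hc' : ContDiffAt ℝ 2 (Ψ ∘ Prod.swap) (extChartAt I x x, extChartAt I x x) :=
    ContDiffAt.comp (extChartAt I x x, extChartAt I x x) hc (contDiff_snd.prodMk contDiff_fst).contDiffAt
  obtain ⟨d2, -⟩ := fderiv_fderiv_swap hc' b a
  have m1 := hmd (e ▸ d1)
  have m2 : MDifferentiableAt I 𝓘(ℝ, ℝ) (fun h => mderiv I (fun g => Φ (g, h)) x a) x :=
    hmd (e' ▸ d2)
  exact ⟨m1, by rw [mderiv_eq_fderiv m1, mderiv_eq_fderiv m2, e, e', s1]⟩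

end ManifoldDerivatives

/-! ### The fundamental vector fields form a Lie algebra homomorphism -/

section FundField

variable {k m : ℕ} {G : Type*} [TopologicalSpace G] [ChartedSpace (EuclideanSpace ℝ (Fin k)) G]
  [Group G] [LieGroup (𝓡 k) ∞ G]
  {M : Type*} [TopologicalSpace M] [ChartedSpace (EuclideanSpace ℝ (Fin m)) M]
  [IsManifold (𝓡 m) ∞ M] [MulAction G M] [ContMDiffSMul (𝓡 k) (𝓡 m) ∞ G M]

theorem fundField_eq_mderiv (ξ : GroupLieAlgebra (𝓡 k) G) (f : C^∞⟮𝓡 m, M; ℝ⟯) (x : M) :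
    fundField M ξ f x = -mderiv (𝓡 k) (fun g : G => f (g • x)) 1 ξ := rfl

theorem fundField_add (ξ η : GroupLieAlgebra (𝓡 k) G) :
    fundField (m := m) M (ξ + η) = fundField M ξ + fundField M η := by
  ext f x
  have h : ∀ (T : EuclideanSpace ℝ (Fin k) →L[ℝ] ℝ) (u v : EuclideanSpace ℝ (Fin k)),
      -T (u + v) = -T u + -T v := fun T u v => by rw [map_add, neg_add]
  exact h (mfderiv (𝓡 k) 𝓘(ℝ, ℝ) (fun g : G => f (g • x)) 1) ξ η

theorem fundField_smul (c : ℝ) (ξ : GroupLieAlgebra (𝓡 k) G) :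
    fundField (m := m) M (c • ξ) = c • fundField M ξ := by
  ext f x
  have h : ∀ (T : EuclideanSpace ℝ (Fin k) →L[ℝ] ℝ) (u : EuclideanSpace ℝ (Fin k)),
      -T (c • u) = c * -T u := fun T u => by rw [map_smul, smul_eq_mul, mul_neg]
  exact h (mfderiv (𝓡 k) 𝓘(ℝ, ℝ) (fun g : G => f (g • x)) 1) ξ

/-- Two infinitesimal actions applied to `f`, as a mixed derivative of the orbit map. -/
theorem fundField_fundField (ξ η : GroupLieAlgebra (𝓡 k) G) (f : C^∞⟮𝓡 m, M; ℝ⟯) (x : M) :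
    fundField M ξ (fundField M η f) x =
      mderiv (𝓡 k) (fun g => mderiv (𝓡 k) (fun h : G => f ((h * g) • x)) 1 η) (1 : G) ξ := by
  have h1 : (fun g : G => fundField M η f (g • x)) =
      -fun g => mderiv (𝓡 k) (fun h : G => f ((h * g) • x)) 1 η := by
    funext g
    rw [fundField_eq_mderiv]
    simp only [Pi.neg_apply, mul_smul]
  have h2 := mfderiv_neg (I := 𝓡 k) (f := fun g : G => fundField M η f (g • x)) (x := 1)
  rw [fundField_eq_mderiv]
  have h3 : (fun g => mderiv (𝓡 k) (fun h : G => f ((h * g) • x)) 1 η) =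
    -(fun g : G => fundField M η f (g • x)) := by rw [h1, neg_neg]
  rw [h3]
  exact (congrFun (congrArg DFunLike.coe h2) ξ).symm

/-- The left-invariant vector field of `ξ` differentiates `F` along right translations. -/
theorem mderiv_mulInvariantVectorField {F : G → ℝ} (hF : ContMDiff (𝓡 k) 𝓘(ℝ, ℝ) 2 F)
    (ξ : GroupLieAlgebra (𝓡 k) G) (g : G) :
    mderiv (𝓡 k) F g (mulInvariantVectorField ξ g) =
      mderiv (𝓡 k) (fun h => F (g * h)) 1 ξ := by
  have hm : MDifferentiableAt (𝓡 k) (𝓡 k) (fun h => g * h) (1 : G) :=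
    (contMDiff_mul_left (I := 𝓡 k) (n := ∞)).mdifferentiableAt (by simp)
  have hF' : MDifferentiableAt (𝓡 k) 𝓘(ℝ, ℝ) F (g * 1) := hF.mdifferentiableAt (by norm_num)
  have h := mfderiv_comp (1 : G) hF' hm
  have h' : mderiv (𝓡 k) (fun h => F (g * h)) 1 ξ = mderiv (𝓡 k) F (g * 1)
      (mulInvariantVectorField ξ g) := congrFun (congrArg DFunLike.coe h) ξ
  rw [h', mul_one]

/-- On the orbit map `F g = f (g x)`, the bracket `⁅ξ, η⁆` of left-invariant fields at the identity
is the commutator of derivatives along right translations. The composite `V_ξ V_η f`, however,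
differentiates `f ((h g) x)` in `h` first and in `g` second, so that exchanging the two derivatives
reverses the order; the sign in the definition of `V` compensates for this reversal. -/
theorem fundField_lie (ξ η : GroupLieAlgebra (𝓡 k) G) :
    fundField (m := m) M ⁅ξ, η⁆ = ⁅fundField (m := m) M ξ, fundField (m := m) M η⁆ := by
  ext f x
  rw [Derivation.commutator_apply]
  change _ = fundField M ξ (fundField M η f) x - fundField M η (fundField M ξ f) x
  have hle : (2 : WithTop ℕ∞) ≤ ∞ := WithTop.coe_le_coe.mpr (le_top : (2 : ℕ∞) ≤ ⊤)
  have : IsManifold (𝓡 k) 2 G := IsManifold.of_le (n := ∞) hle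
  have hF : ContMDiff (𝓡 k) 𝓘(ℝ, ℝ) 2 (fun g : G => f (g • x)) := (contMDiff_orbit f x).of_le hle
  have hF2 : ContMDiff ((𝓡 k).prod (𝓡 k)) 𝓘(ℝ, ℝ) 2 (fun p : G × G => f ((p.1 * p.2) • x)) :=
    hF.comp ((contMDiff_mul (𝓡 k) ∞).of_le hle)
  have hsw := fun a b => mderiv_mderiv_swap hF2 1 a b
  have hinv : ∀ ζ : GroupLieAlgebra (𝓡 k) G,
      (fun g => mderiv (𝓡 k) (fun g : G => f (g • x)) g (mulInvariantVectorField ζ g)) =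
      fun g => mderiv (𝓡 k) (fun h => f ((g * h) • x)) 1 ζ := fun ζ => by
    funext g
    exact mderiv_mulInvariantVectorField hF ζ g
  have hd : ∀ ζ : GroupLieAlgebra (𝓡 k) G, MDifferentiableAt (𝓡 k) 𝓘(ℝ, ℝ)
      (fun g => mderiv (𝓡 k) (fun g : G => f (g • x)) g (mulInvariantVectorField ζ g)) (1 : G) :=
    fun ζ => by
      rw [hinv]
      exact (hsw ζ ζ).1
  have h1 : ∀ ζ : GroupLieAlgebra (𝓡 k) G,
      (mulInvariantVectorField ζ (1 : G) : EuclideanSpace ℝ (Fin k)) = ζ := fun ζ => by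
    have h := mfderiv_id (I := 𝓡 k) (x := (1 : G))
    have e : (fun g : G => 1 * g) = id := funext one_mul
    change mfderiv (𝓡 k) (𝓡 k) (fun g : G => 1 * g) 1 ζ = ζ
    rw [e, h]
    rfl
  have hb := mderiv_mlieBracket hF (mdifferentiableAt_mulInvariantVectorField ξ)
    (mdifferentiableAt_mulInvariantVectorField η) (hd ξ) (hd η)
  rw [hinv, hinv] at hb
  rw [fundField_fundField, fundField_fundField, fundField_eq_mderiv]
  have hb' := hb.trans (congrArg₂ (· - ·) (congrArg _ (h1 ξ)) (congrArg _ (h1 η)))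
  refine (congrArg Neg.neg hb').trans ?_
  have s1 := (hsw ξ η).2
  have s2 := (hsw η ξ).2
  refine (congrArg Neg.neg (congrArg₂ (· - ·) s1 s2)).trans ?_
  exact neg_sub _ _

end FundField

/-! ### Cartan calculus on differential forms -/

section FormsCalculus

variable {R : Type*} [CommRing R] [Algebra ℝ R]

/-- As for all identities of this section, both sides are compared degree by degree: a form of
positive degree is determined by its interior products, and Cartan's formula
`ι_X d = 𝓛_X - d ι_X` (`contr_extD`) reduces the degree. -/
theorem sign_extD (α : Cochain R (VField R)) : sign (extD α) = -extD (sign α) := by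
  have key : ∀ n (α : Cochain R (VField R)), sign (extD α) n = (-extD (sign α)) n := by
    intro n
    induction n with
    | zero =>
      intro α
      rw [sign_apply, extD_zero, Cochain.neg_apply, extD_zero, smul_zero, neg_zero]
    | succ n ih =>
      intro α
      refine alt_ext_succ fun X => ?_
      change contr X (sign (extD α)) n = contr X (-extD (sign α)) n
      rw [contr_sign, contr_extD, map_sub, ← lieDer_sign, map_neg, contr_extD, contr_sign, map_neg]
      simp only [Cochain.neg_apply, Cochain.sub_apply, ih]
  ext n : 1
  exact key n α

theorem extD_mul (α β : Cochain R (VField R)) :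
    extD (α * β) = extD α * β + sign α * extD β := by
  have key : ∀ n (α β : Cochain R (VField R)),
      extD (α * β) n = (extD α * β + sign α * extD β) n := by
    intro n
    induction n with
    | zero =>
      intro α β
      refine alt_ext_zero ?_
      rw [Cochain.add_apply, AlternatingMap.add_apply, mul_zero_apply, mul_zero_apply, extD_zero,
        extD_zero, extD_zero]
      simp
    | succ n ih =>
      intro α β
      refine alt_ext_succ fun X => ?_
      change contr X (extD (α * β)) n = contr X (extD α * β + sign α * extD β) n
      rw [contr_extD, lieDer_mul, contr_mul, map_add, map_add, contr_mul, contr_mul, sign_extD,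
        contr_extD, contr_extD, contr_sign, sign_sign, Cochain.sub_apply, Cochain.add_apply (extD _),
        ih, ih, sign_sign]
      simp only [sub_mul, mul_sub, neg_mul, Cochain.add_apply, Cochain.sub_apply, Cochain.neg_apply]
      abel
  ext n : 1
  exact key n α β

theorem lieDer_lie (X Y : VField R) (α : Cochain R (VField R)) :
    lieDer ⁅X, Y⁆ α = lieDer X (lieDer Y α) - lieDer Y (lieDer X α) := by
  have key : ∀ n (α : Cochain R (VField R)),
      lieDer ⁅X, Y⁆ α n = (lieDer X (lieDer Y α) - lieDer Y (lieDer X α)) n := by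
    intro n
    induction n with
    | zero =>
      intro α
      refine alt_ext_zero ?_
      rw [Cochain.sub_apply, AlternatingMap.sub_apply]
      simp only [lieDer_zero_apply, Derivation.commutator_apply]
    | succ n ih =>
      intro α
      refine alt_ext_succ fun Z => ?_
      change contr Z (lieDer ⁅X, Y⁆ α) n = contr Z (lieDer X (lieDer Y α) - lieDer Y (lieDer X α)) n
      have hj : contr ⁅⁅X, Y⁆, Z⁆ α = contr ⁅X, ⁅Y, Z⁆⁆ α - contr ⁅Y, ⁅X, Z⁆⁆ α := by
        have := contr_add ⁅⁅X, Y⁆, Z⁆ ⁅Y, ⁅X, Z⁆⁆ α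
        rw [← leibniz_lie X Y Z] at this
        rw [this, add_sub_cancel_right]
      rw [contr_lieDer, Cochain.sub_apply, ih, hj]
      simp only [map_sub, contr_lieDer, Cochain.sub_apply]
      abel
  ext n : 1
  exact key n α

theorem lieDer_extD (X : VField R) (α : Cochain R (VField R)) :
    lieDer X (extD α) = extD (lieDer X α) := by
  have key : ∀ n (α : Cochain R (VField R)), lieDer X (extD α) n = extD (lieDer X α) n := by
    intro n
    induction n with
    | zero => exact fun α => lieDer_eq_zero X 0 _ (extD_zero α)
    | succ n ih =>
      intro α
      refine alt_ext_succ fun Y => ?_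
      change contr Y (lieDer X (extD α)) n = contr Y (extD (lieDer X α)) n
      simp only [contr_lieDer, contr_extD, map_sub, lieDer_lie, Cochain.sub_apply, ih]
      abel
  ext n : 1
  exact key n α

theorem extD_extD (α : Cochain R (VField R)) : extD (extD α) = 0 := by
  have key : ∀ n (α : Cochain R (VField R)), extD (extD α) n = 0 := by
    intro n
    induction n with
    | zero => exact fun α => extD_zero _
    | succ n ih =>
      intro α
      refine alt_ext_succ fun X => ?_
      change contr X (extD (extD α)) n = 0
      rw [contr_extD, contr_extD, map_sub, lieDer_extD, sub_sub_cancel, ih]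
  ext n : 1
  exact key n α

theorem Forms.contr_contr_swap (X Y : VField R) (α : Forms R) :
    Forms.contr X (Forms.contr Y α) = -Forms.contr Y (Forms.contr X α) :=
  Subtype.ext (contr_swap X Y (α : Cochain R (VField R)))

theorem Forms.contr_add_left (X Y : VField R) (α : Forms R) :
    Forms.contr (X + Y) α = Forms.contr X α + Forms.contr Y α :=
  Subtype.ext (contr_add X Y (α : Cochain R (VField R)))

theorem Forms.contr_smul_left (c : ℝ) (X : VField R) (α : Forms R) :
    Forms.contr (c • X) α = c • Forms.contr X α :=
  Subtype.ext (by
    change EquivariantForms.contr (c • X) (α : Cochain R (VField R)) =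
      algebraMap ℝ R c • EquivariantForms.contr X (α : Cochain R (VField R))
    rw [← contr_smul, algebraMap_smul])

theorem Forms.contr_lieDer (X Y : VField R) (α : Forms R) :
    Forms.contr Y (Forms.lieDer X α) =
      Forms.lieDer X (Forms.contr Y α) - Forms.contr ⁅X, Y⁆ α :=
  Subtype.ext (EquivariantForms.contr_lieDer X Y (α : Cochain R (VField R)))

theorem Forms.contr_extD (X : VField R) (α : Forms R) :
    Forms.contr X (Forms.extD α) = Forms.lieDer X α - Forms.extD (Forms.contr X α) :=
  Subtype.ext (EquivariantForms.contr_extD X (α : Cochain R (VField R)))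

theorem Forms.extD_extD (α : Forms R) : Forms.extD (Forms.extD α) = 0 :=
  Subtype.ext (EquivariantForms.extD_extD (α : Cochain R (VField R)))

theorem Forms.extD_mul (α β : Forms R) :
    Forms.extD (α * β) = Forms.extD α * β + (Forms.parity R).inv α * Forms.extD β :=
  Subtype.ext (EquivariantForms.extD_mul (α : Cochain R (VField R)) β)

theorem Forms.parity_extD (α : Forms R) :
    (Forms.parity R).inv (Forms.extD α) = -Forms.extD ((Forms.parity R).inv α) :=
  Subtype.ext (sign_extD (α : Cochain R (VField R)))

theorem Forms.contr_mem_deg (X : VField R) {n : ℕ} {α : Forms R} (h : α ∈ Forms.deg R (n + 1)) :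
    Forms.contr X α ∈ Forms.deg R n := fun k hk => by
  change (((α : Cochain R (VField R)) (k + 1)).curryLeft X) = 0
  rw [h (k + 1) (by omega)]
  rfl

theorem Forms.contr_deg_zero (X : VField R) {α : Forms R} (h : α ∈ Forms.deg R 0) :
    Forms.contr X α = 0 :=
  Subtype.ext (Cochain.ext fun k => by
    change (((α : Cochain R (VField R)) (k + 1)).curryLeft X) = 0
    rw [h (k + 1) (by omega)]
    rfl)

theorem Forms.extD_mem_deg {n : ℕ} {α : Forms R} (h : α ∈ Forms.deg R n) :
    Forms.extD α ∈ Forms.deg R (n + 1) := fun k hk => by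
  cases k with
  | zero => exact EquivariantForms.extD_zero (α : Cochain R (VField R))
  | succ k => exact extD_eq_zero k _ (h k (by omega))

end FormsCalculus

/-! ### The Weil algebra -/

section WeilCalculus

variable {𝔤 : Type*} [LieRing 𝔤] [LieAlgebra ℝ 𝔤]

variable (𝔤) in
/-- `Weil.omega` as a linear map. -/
def Weil.omegaLin : Module.Dual ℝ 𝔤 →ₗ[ℝ] Weil 𝔤 where
  toFun := Weil.omega
  map_add' l l' := by rw [Weil.omega, map_add, Weil.tmul_add]; rfl
  map_smul' c l := by
    rw [Weil.omega, map_smul]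
    exact TensorProduct.tmul_smul c (1 : Sym 𝔤) (ExteriorAlgebra.ι ℝ l)

variable (𝔤) in
/-- `Weil.phi` as a linear map. -/
def Weil.phiLin : Module.Dual ℝ 𝔤 →ₗ[ℝ] Weil 𝔤 where
  toFun := Weil.phi
  map_add' l l' := by rw [Weil.phi, map_add, Weil.add_tmul]; rfl
  map_smul' c l := by rw [Weil.phi, map_smul, Weil.smul_tmul]; rfl

theorem Weil.omegaLin_apply (l : Module.Dual ℝ 𝔤) : Weil.omegaLin 𝔤 l = Weil.omega l := rfl
theorem Weil.phiLin_apply (l : Module.Dual ℝ 𝔤) : Weil.phiLin 𝔤 l = Weil.phi l := rfl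

theorem Weil.smul_one_eq (r : ℝ) : r • (1 : Weil 𝔤) = Weil.tmul (algebraMap ℝ (Sym 𝔤) r) 1 := by
  rw [Algebra.algebraMap_eq_smul_one, Weil.smul_tmul, Weil.one_def]

/-- The Weil algebra is generated by the elements `φ(l)` and `ω(l)`. -/
theorem Weil.gen_induction {P : Weil 𝔤 → Prop} (x : Weil 𝔤) (one : P 1)
    (add : ∀ x y, P x → P y → P (x + y)) (smul : ∀ (r : ℝ) x, P x → P (r • x))
    (mul : ∀ x y, P x → P y → P (x * y))
    (phi : ∀ l, P (Weil.phi l)) (omega : ∀ l, P (Weil.omega l)) : P x := by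
  have hs : ∀ s : Sym 𝔤, P (Weil.tmul s 1) := fun s => by
    induction s using SymmetricAlgebra.induction with
    | algebraMap r => rw [← Weil.smul_one_eq]; exact smul r 1 one
    | ι l => exact phi l
    | mul a b ha hb =>
      rw [← mul_one (1 : Ext 𝔤), ← Weil.tmul_mul_tmul]; exact mul _ _ ha hb
    | add a b ha hb => rw [Weil.add_tmul]; exact add _ _ ha hb
  have ha : ∀ a : Ext 𝔤, P (Weil.tmul 1 a) := fun a => by
    induction a using ExteriorAlgebra.induction with
    | algebraMap r =>
      rw [Algebra.algebraMap_eq_smul_one]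
      exact (congrArg P (TensorProduct.tmul_smul r (1 : Sym 𝔤) (1 : Ext 𝔤))).mpr (smul r 1 one)
    | ι l => exact omega l
    | mul a b ha hb =>
      rw [← mul_one (1 : Sym 𝔤), ← Weil.tmul_mul_tmul]; exact mul _ _ ha hb
    | add a b ha hb => rw [Weil.tmul_add]; exact add _ _ ha hb
  induction x using Weil.induction with
  | zero => simpa using smul 0 1 one
  | add x y hx hy => exact add x y hx hy
  | tmul s a =>
    rw [← mul_one s, ← one_mul a, ← Weil.tmul_mul_tmul]
    exact mul _ _ (hs s) (ha a)

theorem Weil.contr_one (z : 𝔤) : Weil.contr z (1 : Weil 𝔤) = 0 := by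
  have h := Weil.contr_mul z 1 1
  rwa [mul_one, mul_one, map_one (Weil.parity 𝔤).inv, one_mul, left_eq_add] at h

theorem Weil.contr_tmul_one (z : 𝔤) (s : Sym 𝔤) : Weil.contr z (Weil.tmul s 1) = 0 := by
  rw [Weil.contr, Weil.map_tmul, Ext.contr, CliffordAlgebra.contractLeft_one, Weil.tmul_zero]

theorem Weil.contr_phi (z : 𝔤) (l : Module.Dual ℝ 𝔤) : Weil.contr z (Weil.phi l) = 0 :=
  Weil.contr_tmul_one z _

theorem Weil.contr_omega (z : 𝔤) (l : Module.Dual ℝ 𝔤) :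
    Weil.contr z (Weil.omega l) = l z • (1 : Weil 𝔤) := by
  rw [Weil.contr, Weil.omega, Weil.map_tmul, Ext.contr, ExteriorAlgebra.ι,
    CliffordAlgebra.contractLeft_ι, Algebra.algebraMap_eq_smul_one]
  exact TensorProduct.tmul_smul _ (1 : Sym 𝔤) (1 : Ext 𝔤)

theorem Weil.contr_omega_mul (z : 𝔤) (l : Module.Dual ℝ 𝔤) (x : Weil 𝔤) :
    Weil.contr z (Weil.omega l * x) = l z • x - Weil.omega l * Weil.contr z x := by
  rw [Weil.contr_mul, Weil.contr_omega, Weil.parity_omega, smul_one_mul, neg_mul, sub_eq_add_neg]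

theorem Weil.omega_mul_omega (l l' : Module.Dual ℝ 𝔤) :
    Weil.omega l * Weil.omega l' = -(Weil.omega l' * Weil.omega l) := by
  rw [Weil.omega_mul, Weil.parity_omega, neg_mul]

theorem Weil.omega_mul_self (l : Module.Dual ℝ 𝔤) : Weil.omega l * Weil.omega l = 0 := by
  rw [Weil.omega, Weil.tmul_mul_tmul, ExteriorAlgebra.ι_sq_zero, Weil.tmul_zero]

theorem Weil.phi_mul (l : Module.Dual ℝ 𝔤) (x : Weil 𝔤) : Weil.phi l * x = x * Weil.phi l := by
  induction x using Weil.induction with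
  | zero => simp
  | add x x' h h' => simp only [add_mul, mul_add, h, h']
  | tmul s a => simp only [Weil.phi, Weil.tmul_mul_tmul, one_mul, mul_one, mul_comm]

variable {ι : Type*} [Fintype ι] (ξ : Module.Basis ι ℝ 𝔤)

theorem coadjoint_apply (x y : 𝔤) (l : Module.Dual ℝ 𝔤) : coadjoint x l y = -l ⁅x, y⁆ := rfl

theorem sum_coord_smul_coord (l : Module.Dual ℝ 𝔤) : ∑ b, l (ξ b) • ξ.coord b = l := by
  classical
  refine ξ.ext fun c => ?_
  simp

/-- The coadjoint action is a representation. -/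
theorem coadjoint_lie (x y : 𝔤) (l : Module.Dual ℝ 𝔤) :
    coadjoint ⁅x, y⁆ l = coadjoint x (coadjoint y l) - coadjoint y (coadjoint x l) := by
  ext z
  simp only [coadjoint_apply, LinearMap.sub_apply, lie_lie, map_sub]
  ring

/-- The canonical element `∑ ξ^b ⊗ ξ_b` of `𝔤* ⊗ 𝔤` is invariant. -/
theorem sum_coadjoint_add_sum_lie {N : Type*} [AddCommGroup N] [Module ℝ N]
    (B : Module.Dual ℝ 𝔤 →ₗ[ℝ] 𝔤 →ₗ[ℝ] N) (x : 𝔤) :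
    ∑ b, B (coadjoint x (ξ.coord b)) (ξ b) + ∑ b, B (ξ.coord b) ⁅x, ξ b⁆ = 0 := by
  have h1 : ∀ b, B (coadjoint x (ξ.coord b)) (ξ b) =
      -∑ c, ξ.coord b ⁅x, ξ c⁆ • B (ξ.coord c) (ξ b) := fun b => by
    conv_lhs => rw [← sum_coord_smul_coord ξ (coadjoint x (ξ.coord b))]
    rw [map_sum, LinearMap.sum_apply, ← Finset.sum_neg_distrib]
    refine Finset.sum_congr rfl fun c _ => ?_
    rw [map_smul, LinearMap.smul_apply, coadjoint_apply, neg_smul]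
  have h2 : ∀ b, B (ξ.coord b) ⁅x, ξ b⁆ = ∑ c, ξ.coord c ⁅x, ξ b⁆ • B (ξ.coord b) (ξ c) :=
    fun b => by
      conv_lhs => rw [← ξ.sum_repr ⁅x, ξ b⁆]
      simp only [map_sum, map_smul, Module.Basis.coord_apply]
  simp only [h1, h2, Finset.sum_neg_distrib]
  rw [Finset.sum_comm, neg_add_cancel]

/-- The quadratic part `½ ∑ ω^b ω(ad*(ξ_b) l)` of `d ω(l)`. -/
def Weil.beta : Module.Dual ℝ 𝔤 →ₗ[ℝ] Weil 𝔤 :=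
  (1 / 2 : ℝ) • ∑ b, LinearMap.mulLeft ℝ (Weil.omega (ξ.coord b)) ∘ₗ Weil.omegaLin 𝔤 ∘ₗ
    coadjoint (ξ b)

theorem Weil.beta_apply (l : Module.Dual ℝ 𝔤) : Weil.beta ξ l =
    (1 / 2 : ℝ) • ∑ b, Weil.omega (ξ.coord b) * Weil.omega (coadjoint (ξ b) l) := by
  simp [Weil.beta, Weil.omegaLin_apply]

theorem Weil.dOmega_eq (a : ι) :
    Weil.dOmega ξ a = Weil.phi (ξ.coord a) + Weil.beta ξ (ξ.coord a) := by
  rw [Weil.dOmega, Weil.beta_apply, sub_eq_add_neg, ← smul_neg, ← Finset.sum_neg_distrib]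
  refine congrArg _ (congrArg _ (Finset.sum_congr rfl fun b _ => ?_))
  rw [coadjoint_coord, ← Weil.omegaLin_apply (∑ c, _), map_sum, Finset.mul_sum,
    ← Finset.sum_neg_distrib]
  refine Finset.sum_congr rfl fun c _ => ?_
  rw [map_smul, mul_smul_comm, neg_smul, Weil.omegaLin_apply]

theorem Weil.symLie_one_tmul (z : 𝔤) (a : Ext 𝔤) : Weil.symLie z (Weil.tmul 1 a) = 0 := by
  rw [Weil.symLie, Weil.map_tmul, Derivation.coeFn_coe, Derivation.map_one_eq_zero,
    Weil.zero_tmul]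

/-- The basis-free form `d ω(l) = φ(l) + β(l)` of the formula for `d ω^a`. -/
theorem Weil.d_omega_eq (l : Module.Dual ℝ 𝔤) :
    Weil.d ξ (Weil.omega l) = Weil.phi l + Weil.beta ξ l := by
  rw [Weil.d_apply]
  simp only [Weil.contr_omega]
  have h : ∀ b, Weil.symLie (ξ b) (Weil.omega l) = 0 := fun b => Weil.symLie_one_tmul _ _
  simp only [h, mul_zero, Finset.sum_const_zero, zero_add, mul_smul_comm, mul_one, Weil.dOmega_eq]
  conv_rhs => rw [← sum_coord_smul_coord ξ l]
  rw [← Weil.phiLin_apply, map_sum, map_sum, ← Finset.sum_add_distrib]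
  simp only [map_smul, smul_add, Weil.phiLin_apply]

theorem Weil.d_one : Weil.d ξ (1 : Weil 𝔤) = 0 := by
  have h := Weil.d_mul ξ 1 1
  rwa [mul_one, mul_one, map_one (Weil.parity 𝔤).inv, one_mul, left_eq_add] at h

theorem Weil.contr_d (a : ι) (x : Weil 𝔤) :
    Weil.contr (ξ a) (Weil.d ξ x) = Weil.lie ξ a x - Weil.d ξ (Weil.contr (ξ a) x) := by
  rw [Weil.lie, LinearMap.add_apply, LinearMap.comp_apply, LinearMap.comp_apply,
    add_sub_cancel_right]

/-- On `S(𝔤*)` the Lie derivative is the coadjoint action. -/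
theorem Weil.lie_tmul_one (a : ι) (s : Sym 𝔤) :
    Weil.lie ξ a (Weil.tmul s 1) = Weil.tmul (Sym.lie (ξ a) s) 1 := by
  classical
  have h : ∀ b, Weil.symLie (ξ b) (Weil.tmul s 1) = Weil.tmul (Sym.lie (ξ b) s) 1 := fun b => rfl
  rw [Weil.lie, LinearMap.add_apply, LinearMap.comp_apply, LinearMap.comp_apply,
    Weil.contr_tmul_one, map_zero, add_zero, Weil.d_apply]
  simp only [Weil.contr_tmul_one, mul_zero, Finset.sum_const_zero, add_zero, map_sum,
    Weil.contr_omega_mul, h, sub_zero]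
  simp [Finsupp.single_apply]

theorem Weil.lie_phi (a : ι) (l : Module.Dual ℝ 𝔤) :
    Weil.lie ξ a (Weil.phi l) = Weil.phi (coadjoint (ξ a) l) := by
  rw [Weil.phi, Weil.lie_tmul_one, Sym.lie, symDerivation_ι]
  rfl

theorem Weil.contr_beta (a : ι) (l : Module.Dual ℝ 𝔤) :
    Weil.contr (ξ a) (Weil.beta ξ l) = Weil.omega (coadjoint (ξ a) l) := by
  classical
  have h1 : ∑ b, (ξ.coord b (ξ a)) • Weil.omega (coadjoint (ξ b) l) =
      Weil.omega (coadjoint (ξ a) l) := by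
    simp [Finsupp.single_apply]
  have h2 : ∑ b, (coadjoint (ξ b) l (ξ a)) • Weil.omega (ξ.coord b) =
      -Weil.omega (coadjoint (ξ a) l) := by
    have h := congrArg (Weil.omegaLin 𝔤) (sum_coord_smul_coord ξ (coadjoint (ξ a) l))
    rw [map_sum] at h
    rw [← Weil.omegaLin_apply, ← h, ← Finset.sum_neg_distrib]
    refine Finset.sum_congr rfl fun b _ => ?_
    rw [map_smul, ← neg_smul, coadjoint_apply, coadjoint_apply, neg_neg, ← lie_skew, map_neg,
      neg_neg, Weil.omegaLin_apply]
  rw [Weil.beta_apply, map_smul, map_sum]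
  simp only [Weil.contr_omega_mul, Weil.contr_omega, mul_smul_comm, mul_one,
    Finset.sum_sub_distrib, h1, h2]
  module

theorem Weil.lie_omega (a : ι) (l : Module.Dual ℝ 𝔤) :
    Weil.lie ξ a (Weil.omega l) = Weil.omega (coadjoint (ξ a) l) := by
  rw [Weil.lie, LinearMap.add_apply, LinearMap.comp_apply, LinearMap.comp_apply,
    Weil.contr_omega, map_smul, Weil.d_one, smul_zero, add_zero, Weil.d_omega_eq, map_add,
    Weil.contr_phi, zero_add, Weil.contr_beta]

/-- `β` is equivariant. -/
theorem Weil.lie_beta (a : ι) (l : Module.Dual ℝ 𝔤) :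
    Weil.lie ξ a (Weil.beta ξ l) = Weil.beta ξ (coadjoint (ξ a) l) := by
  have h := sum_coadjoint_add_sum_lie ξ ((LinearMap.mul ℝ (Weil 𝔤)).compl₁₂ (Weil.omegaLin 𝔤)
    (Weil.omegaLin 𝔤 ∘ₗ (-(LieAlgebra.ad ℝ 𝔤 : 𝔤 →ₗ[ℝ] Module.End ℝ 𝔤).compr₂ l)) ) (ξ a)
  have hc : ∀ y : 𝔤, (-(LieAlgebra.ad ℝ 𝔤 : 𝔤 →ₗ[ℝ] Module.End ℝ 𝔤).compr₂ l) y =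
      coadjoint y l := fun y => rfl
  simp only [LinearMap.compl₁₂_apply, LinearMap.mul_apply', LinearMap.comp_apply, hc,
    Weil.omegaLin_apply, coadjoint_lie] at h
  have hs : ∀ l l' : Module.Dual ℝ 𝔤, Weil.omega (l - l') = Weil.omega l - Weil.omega l' :=
    fun l l' => map_sub (Weil.omegaLin 𝔤) l l'
  simp only [hs, mul_sub, Finset.sum_sub_distrib] at h
  rw [Weil.beta_apply, Weil.beta_apply, map_smul, map_sum]
  simp only [Weil.lie_mul, Weil.lie_omega, Finset.sum_add_distrib]
  rw [← add_sub_assoc, sub_eq_zero] at h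
  rw [h]

/-- Setting the single generator `ω^a` to zero. -/
def Weil.killOne (a : ι) : Weil 𝔤 →ₗ[ℝ] Weil 𝔤 :=
  LinearMap.id - LinearMap.mulLeft ℝ (Weil.omega (ξ.coord a)) ∘ₗ Weil.contr (ξ a)

theorem Weil.killOne_apply (a : ι) (x : Weil 𝔤) :
    Weil.killOne ξ a x = x - Weil.omega (ξ.coord a) * Weil.contr (ξ a) x := rfl

theorem Weil.killOne_mul (a : ι) (x y : Weil 𝔤) :
    Weil.killOne ξ a (x * y) = Weil.killOne ξ a x * Weil.killOne ξ a y := by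
  have h0 : Weil.omega (ξ.coord a) * Weil.contr (ξ a) x *
      (Weil.omega (ξ.coord a) * Weil.contr (ξ a) y) = 0 := by
    rw [Weil.omega_mul, mul_assoc, ← mul_assoc (Weil.omega _), Weil.omega_mul_self, zero_mul,
      mul_zero]
  rw [Weil.killOne_apply, Weil.killOne_apply, Weil.killOne_apply, Weil.contr_mul, mul_sub, sub_mul,
    sub_mul, h0, mul_add, ← mul_assoc, ← mul_assoc _ _ (Weil.contr _ y), ← mul_assoc x,
    Weil.omega_mul _ ((Weil.parity 𝔤).inv x), (Weil.parity 𝔤).inv_inv]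
  abel

/-- Setting the generators `ω^a` to zero, for all `a` in a list. -/
def Weil.killList (L : List ι) : Module.End ℝ (Weil 𝔤) := (L.map (Weil.killOne ξ)).prod

theorem Weil.killList_cons (a : ι) (L : List ι) (x : Weil 𝔤) :
    Weil.killList ξ (a :: L) x = Weil.killOne ξ a (Weil.killList ξ L x) := by
  rw [Weil.killList, List.map_cons, List.prod_cons]
  rfl

theorem Weil.killList_mul (L : List ι) (x y : Weil 𝔤) :
    Weil.killList ξ L (x * y) = Weil.killList ξ L x * Weil.killList ξ L y := by
  induction L with
  | nil => rfl
  | cons a L ih => simp only [Weil.killList_cons, ih, Weil.killOne_mul]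

theorem Weil.killList_of_contr (L : List ι) {x : Weil 𝔤} (h : ∀ a, Weil.contr (ξ a) x = 0) :
    Weil.killList ξ L x = x := by
  induction L with
  | nil => rfl
  | cons a L ih => rw [Weil.killList_cons, ih, Weil.killOne_apply, h, mul_zero, sub_zero]

theorem Weil.killOne_omega [DecidableEq ι] (a b : ι) : Weil.killOne ξ a (Weil.omega (ξ.coord b)) =
    if a = b then 0 else Weil.omega (ξ.coord b) := by
  rw [Weil.killOne_apply, Weil.contr_omega]
  by_cases h : a = b
  · subst h; simp
  · simp [h, Ne.symm h]

theorem Weil.killList_omega [DecidableEq ι] (L : List ι) (b : ι) :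
    Weil.killList ξ L (Weil.omega (ξ.coord b)) = if b ∈ L then 0 else Weil.omega (ξ.coord b) := by
  induction L with
  | nil => rfl
  | cons a L ih =>
    rw [Weil.killList_cons, ih]
    by_cases h : b ∈ L
    · simp [h]
    · rw [if_neg h, Weil.killOne_omega]
      simp [h, eq_comm]

/-- Setting all `ω^a` to zero one after the other is the projection onto `S(𝔤*)`. -/
theorem Weil.killList_univ (x : Weil 𝔤) :
    Weil.killList ξ Finset.univ.toList x = Weil.tmul (Weil.omegaZero 𝔤 x) 1 := by
  classical
  induction x using Weil.gen_induction with
  | one => rw [Weil.killList_of_contr ξ _ fun a => Weil.contr_one _, map_one]; rfl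
  | add x y hx hy => rw [map_add, map_add, Weil.add_tmul, hx, hy]
  | smul r x hx => rw [map_smul, map_smul, Weil.smul_tmul, hx]
  | mul x y hx hy =>
    rw [Weil.killList_mul, map_mul, hx, hy, Weil.tmul_mul_tmul, mul_one]
  | phi l =>
    rw [Weil.killList_of_contr ξ _ fun a => Weil.contr_phi _ _, Weil.omegaZero_phi]
    rfl
  | omega l =>
    rw [Weil.omegaZero_omega, Weil.zero_tmul, ← Weil.omegaLin_apply, ← sum_coord_smul_coord ξ l,
      map_sum, map_sum]
    refine Finset.sum_eq_zero fun b _ => ?_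
    rw [map_smul, map_smul, Weil.omegaLin_apply, Weil.killList_omega, if_pos (by simp), smul_zero]

theorem Weil.eq_tmul_of_contr {x : Weil 𝔤} (h : ∀ a, Weil.contr (ξ a) x = 0) :
    x = Weil.tmul (Weil.omegaZero 𝔤 x) 1 := by
  rw [← Weil.killList_univ ξ, Weil.killList_of_contr ξ _ h]

/-- An odd element annihilated by all interior products vanishes. -/
theorem Weil.eq_zero_of_contr_of_odd {x : Weil 𝔤} (h : ∀ a, Weil.contr (ξ a) x = 0)
    (hx : (Weil.parity 𝔤).inv x = -x) : x = 0 := by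
  have h1 := Weil.omegaZero_parity x
  rw [hx, map_neg] at h1
  have h2 : (2 : ℝ) • Weil.omegaZero 𝔤 x = 0 := by
    rw [two_smul]
    nth_rewrite 1 [← h1]
    exact neg_add_cancel _
  have h1 : Weil.omegaZero 𝔤 x = 0 := (smul_eq_zero_iff_right two_ne_zero).mp h2
  rw [Weil.eq_tmul_of_contr ξ h, h1, Weil.zero_tmul]

theorem Weil.d_d_mul (x y : Weil 𝔤) : Weil.d ξ (Weil.d ξ (x * y)) =
    Weil.d ξ (Weil.d ξ x) * y + x * Weil.d ξ (Weil.d ξ y) := by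
  rw [Weil.d_mul, map_add, Weil.d_mul, Weil.d_mul, Weil.parity_d, (Weil.parity 𝔤).inv_inv]
  noncomm_ring

theorem Weil.d_d_omega (l : Module.Dual ℝ 𝔤) : Weil.d ξ (Weil.d ξ (Weil.omega l)) = 0 := by
  refine Weil.eq_zero_of_contr_of_odd ξ (fun a => ?_) ?_
  · rw [Weil.contr_d, Weil.contr_d, Weil.contr_omega, map_smul, Weil.d_one, smul_zero, sub_zero,
      Weil.lie_omega, Weil.d_omega_eq, Weil.d_omega_eq, map_add, Weil.lie_phi, Weil.lie_beta,
      sub_self]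
  · rw [Weil.parity_d, Weil.parity_d, Weil.parity_omega]
    simp only [map_neg, neg_neg]

/-- As `d²` is a derivation, it is enough that it kills generators. It kills `ω(l)`, as `d² ω(l)` is
odd and annihilated by all interior products, by the equivariance of `φ` and `β`; and
`φ(l) = d ω(l) - β(l)` is a polynomial in the `ω` and their differentials. -/
theorem Weil.d_d (x : Weil 𝔤) : Weil.d ξ (Weil.d ξ x) = 0 := by
  induction x using Weil.gen_induction with
  | one => rw [Weil.d_one, map_zero]
  | add x y hx hy => simp only [map_add, hx, hy, add_zero]
  | smul r x hx => simp only [map_smul, hx, smul_zero]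
  | mul x y hx hy => rw [Weil.d_d_mul, hx, hy, zero_mul, mul_zero, add_zero]
  | phi l =>
    have h : Weil.phi l = Weil.d ξ (Weil.omega l) - Weil.beta ξ l := by
      rw [Weil.d_omega_eq, add_sub_cancel_right]
    rw [h, map_sub, Weil.d_d_omega, zero_sub, map_neg, Weil.beta_apply, map_smul, map_smul, map_sum,
      map_sum, Finset.sum_eq_zero, smul_zero, neg_zero]
    intro b _
    rw [Weil.d_d_mul, Weil.d_d_omega, Weil.d_d_omega, zero_mul, mul_zero, add_zero]
  | omega l => exact Weil.d_d_omega ξ l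

end WeilCalculus

/-! ### Exponentials of nilpotent operators -/

section Exponential

/-- The exponential series of `a`, truncated after `n` terms. -/
def expSum {A : Type*} [Ring A] [Algebra ℝ A] (n : ℕ) (a : A) : A :=
  ∑ k ∈ Finset.range n, ((k.factorial : ℝ)⁻¹) • a ^ k

/-- The rational structure on a real vector space. The exponential of nilpotent elements in Mathlib
is formulated over `ℚ`. -/
abbrev ratModule (A : Type*) [AddCommGroup A] [Module ℝ A] : Module ℚ A :=
  Module.compHom A (algebraMap ℚ ℝ)

theorem expSum_eq_exp {A : Type*} [Ring A] [Algebra ℝ A] {n : ℕ} {a : A} (h : a ^ n = 0) :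
    expSum n a = letI := ratModule A; IsNilpotent.exp a := by
  let := ratModule A
  rw [IsNilpotent.exp_eq_sum h]
  refine Finset.sum_congr rfl fun k _ => ?_
  change _ = (algebraMap ℚ ℝ ((k.factorial : ℚ)⁻¹)) • a ^ k
  simp

theorem expSum_neg_mul_expSum {A : Type*} [Ring A] [Algebra ℝ A] {n : ℕ} {a : A} (h : a ^ n = 0) :
    expSum n (-a) * expSum n a = 1 := by
  let := ratModule A
  rw [expSum_eq_exp h, expSum_eq_exp (by rw [neg_pow, h, mul_zero])]
  exact IsNilpotent.exp_neg_mul_exp_self ⟨n, h⟩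

theorem expSum_mul_expSum_neg {A : Type*} [Ring A] [Algebra ℝ A] {n : ℕ} {a : A} (h : a ^ n = 0) :
    expSum n a * expSum n (-a) = 1 := by
  have := expSum_neg_mul_expSum (a := -a) (n := n) (by rw [neg_pow, h, mul_zero])
  rwa [neg_neg] at this

/-- The exponential of a nilpotent derivation is multiplicative. -/
theorem expSum_derivation {B : Type*} [Ring B] [Algebra ℝ B] {n : ℕ} {D : Module.End ℝ B}
    (h : D ^ n = 0) (hD : ∀ x y, D (x * y) = x * D y + D x * y) (x y : B) :
    expSum n D (x * y) = expSum n D x * expSum n D y := by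
  let := ratModule B
  have e : expSum n D = IsNilpotent.exp D := by
    rw [IsNilpotent.exp_eq_sum h]
    refine Finset.sum_congr rfl fun k _ => ?_
    ext z
    change _ = (algebraMap ℚ ℝ ((k.factorial : ℚ)⁻¹)) • (D ^ k) z
    simp
  rw [e]
  exact Module.End.exp_mul_of_derivation ℝ B D hD ⟨n, h⟩ x y

/-- `exp(a) y exp(-a) = y + [a, y] + ½ [a, [a, y]]` if the next commutator vanishes. -/
theorem expSum_conj {A : Type*} [Ring A] [Algebra ℝ A] {n : ℕ} {a y z w : A} (h : a ^ n = 0)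
    (h1 : a * y - y * a = z) (h2 : a * z - z * a = w) (h3 : a * w - w * a = 0) :
    expSum n a * y * expSum n (-a) = y + z + (1 / 2 : ℝ) • w := by
  let := ratModule A
  let := ratModule (Module.End ℝ A)
  have hn : (-a) ^ n = 0 := by rw [neg_pow, h, mul_zero]
  have hL : (LinearMap.mulLeft ℝ a) ^ n = 0 := by
    rw [LinearMap.pow_mulLeft, h]; exact LinearMap.mulLeft_zero_eq_zero ℝ A
  have hR : (LinearMap.mulRight ℝ (-a)) ^ n = 0 := by
    rw [LinearMap.pow_mulRight, hn]; exact LinearMap.mulRight_zero_eq_zero ℝ A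
  have hc : Commute (LinearMap.mulLeft ℝ a) (LinearMap.mulRight ℝ (-a)) :=
    LinearMap.commute_mulLeft_right a (-a)
  have e1 : ∀ y, expSum n (LinearMap.mulLeft ℝ a) y = expSum n a * y := fun y => by
    simp only [expSum, LinearMap.pow_mulLeft, LinearMap.sum_apply, LinearMap.smul_apply,
      LinearMap.mulLeft_apply, Finset.sum_mul, smul_mul_assoc]
  have e2 : ∀ y, expSum n (LinearMap.mulRight ℝ (-a)) y = y * expSum n (-a) := fun y => by
    simp only [expSum, LinearMap.pow_mulRight, LinearMap.sum_apply, LinearMap.smul_apply,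
      LinearMap.mulRight_apply, Finset.mul_sum, mul_smul_comm]
  have e3 := IsNilpotent.exp_add_of_commute hc ⟨n, hL⟩ ⟨n, hR⟩
  have had : ∀ x, (LinearMap.mulLeft ℝ a + LinearMap.mulRight ℝ (-a)) x = a * x - x * a := fun x => by
    simp [sub_eq_add_neg]
  have h4 : ((LinearMap.mulLeft ℝ a + LinearMap.mulRight ℝ (-a)) ^ 3) • y = 0 := by
    change (LinearMap.mulLeft ℝ a + LinearMap.mulRight ℝ (-a)) ((LinearMap.mulLeft ℝ a +
      LinearMap.mulRight ℝ (-a)) ((LinearMap.mulLeft ℝ a + LinearMap.mulRight ℝ (-a)) y)) = 0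
    rw [had, had, had, h1, h2, h3]
  have h5 := IsNilpotent.exp_smul_eq_sum h4 (hc.isNilpotent_add ⟨n, hL⟩ ⟨n, hR⟩)
  rw [e3, ← expSum_eq_exp hL, ← expSum_eq_exp hR] at h5
  have h6 : (expSum n (LinearMap.mulLeft ℝ a) * expSum n (LinearMap.mulRight ℝ (-a))) • y =
      expSum n a * y * expSum n (-a) := by
    change expSum n (LinearMap.mulLeft ℝ a) (expSum n (LinearMap.mulRight ℝ (-a)) y) = _
    rw [e2, e1, mul_assoc]
  have hq : ∀ (q : ℚ) (x : A), q • x = (algebraMap ℚ ℝ q) • x := fun _ _ => rfl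
  rw [← h6, h5, Finset.sum_range_succ, Finset.sum_range_succ, Finset.sum_range_one]
  simp only [Module.End.smul_def, pow_succ, pow_zero, one_mul, Module.End.mul_apply, had, h1, h2,
    Module.End.one_apply, hq]
  norm_num

end Exponential
/-! ### Operators on `W(𝔤) ⊗ Ω` -/

section TotalOps
variable {𝔤 : Type*} [LieRing 𝔤] [LieAlgebra ℝ 𝔤] {R : Type*} [CommRing R] [Algebra ℝ R]

theorem Total.induction {P : Total 𝔤 R → Prop} (x : Total 𝔤 R) (zero : P 0)
    (tmul : ∀ w η, P (w ᵍ⊗ₜ[ℝ] η)) (add : ∀ x y, P x → P y → P (x + y)) : P x :=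
  TensorProduct.induction_on (motive := P) x zero tmul add

theorem Total.hom_ext {N : Type*} [AddCommGroup N] [Module ℝ N] {S T : Total 𝔤 R →ₗ[ℝ] N}
    (h : ∀ w η, S (w ᵍ⊗ₜ[ℝ] η) = T (w ᵍ⊗ₜ[ℝ] η)) : S = T := by
  refine LinearMap.ext fun x => ?_
  induction x using Total.induction with
  | zero => rw [map_zero, map_zero]
  | tmul w η => exact h w η
  | add x y hx hy => rw [map_add, map_add, hx, hy]

theorem Total.smul_tmul (c : ℝ) (w : Weil 𝔤) (η : Forms R) :
    ((c • w) ᵍ⊗ₜ[ℝ] η : Total 𝔤 R) = c • (w ᵍ⊗ₜ[ℝ] η) := by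
  rw [GradedTensorProduct.tmul, ← TensorProduct.smul_tmul', map_smul]

theorem Total.tmul_smul (c : ℝ) (w : Weil 𝔤) (η : Forms R) :
    (w ᵍ⊗ₜ[ℝ] (c • η) : Total 𝔤 R) = c • (w ᵍ⊗ₜ[ℝ] η) := by
  rw [GradedTensorProduct.tmul, TensorProduct.tmul_smul, map_smul]

variable (𝔤 R) in
/-- `S ↦ S ⊗ 1`. -/
def Total.leftHom : Module.End ℝ (Weil 𝔤) →ₐ[ℝ] Module.End ℝ (Total 𝔤 R) :=
  AlgHom.ofLinearMap
    { toFun := fun S => Total.left S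
      map_add' := fun S T => Total.hom_ext fun w η => Total.add_tmul (S w) (T w) η
      map_smul' := fun c S => Total.hom_ext fun w η => Total.smul_tmul c (S w) η }
    (Total.hom_ext fun _ _ => rfl) (fun _ _ => Total.hom_ext fun _ _ => rfl)

variable (𝔤 R) in
/-- `T ↦ 1 ⊗ T`, without signs. -/
def Total.rightHom : Module.End ℝ (Forms R) →ₐ[ℝ] Module.End ℝ (Total 𝔤 R) :=
  AlgHom.ofLinearMap
    { toFun := fun T => Total.rightEven T
      map_add' := fun S T => Total.hom_ext fun w η => Total.tmul_add w (S η) (T η)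
      map_smul' := fun c S => Total.hom_ext fun w η => Total.tmul_smul c w (S η) }
    (Total.hom_ext fun _ _ => rfl) (fun _ _ => Total.hom_ext fun _ _ => rfl)

theorem Total.leftHom_mul_rightHom (S : Module.End ℝ (Weil 𝔤)) (T : Module.End ℝ (Forms R)) :
    Total.leftHom 𝔤 R S * Total.rightHom 𝔤 R T = Total.rightHom 𝔤 R T * Total.leftHom 𝔤 R S :=
  Total.hom_ext fun _ _ => rfl

theorem Total.tmul_one_mul_tmul (w w' : Weil 𝔤) (η : Forms R) :
    (w ᵍ⊗ₜ[ℝ] 1 * w' ᵍ⊗ₜ[ℝ] η : Total 𝔤 R) = (w * w') ᵍ⊗ₜ[ℝ] η := by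
  have h1 : (1 : Forms R) ∈ (Forms.parity R).grading 0 := SetLike.GradedOne.one_mem
  refine (Weil.parity 𝔤).induction (P := fun w' =>
    (w ᵍ⊗ₜ[ℝ] 1 * w' ᵍ⊗ₜ[ℝ] η : Total 𝔤 R) = (w * w') ᵍ⊗ₜ[ℝ] η) ?_ ?_ w'
  · intro a b ha hb
    rw [Total.add_tmul, mul_add, ha, hb, mul_add, Total.add_tmul]
  · intro i a ha
    rw [Total.tmul_mul_tmul i 0 _ _ _ _ h1 ha, zero_mul, uzpow_zero, one_smul, one_mul]

theorem Total.mulLeft_tmul_one (w : Weil 𝔤) :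
    LinearMap.mulLeft ℝ (w ᵍ⊗ₜ[ℝ] 1 : Total 𝔤 R) = Total.leftHom 𝔤 R (LinearMap.mulLeft ℝ w) :=
  Total.hom_ext fun w' η => Total.tmul_one_mul_tmul w w' η

/-- An element `w ⊗ 1`, with `w` odd and supercentral in `W(𝔤)`, is supercentral. -/
theorem Total.mul_tmul_one {w : Weil 𝔤} (hw : (Weil.parity 𝔤).inv w = -w)
    (hc : ∀ x, w * x = (Weil.parity 𝔤).inv x * w) (x : Total 𝔤 R) :
    (w ᵍ⊗ₜ[ℝ] 1 : Total 𝔤 R) * Total.sgn x = x * (w ᵍ⊗ₜ[ℝ] 1) := by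
  have hw1 : w ∈ (Weil.parity 𝔤).grading 1 := by
    rw [Parity.mem_grading, hw, uzpow_one, Units.neg_smul, one_smul]
  induction x using Total.induction with
  | zero => simp
  | add x y hx hy => rw [map_add, mul_add, add_mul, hx, hy]
  | tmul w' η =>
    refine (Forms.parity R).induction (P := fun η => (w ᵍ⊗ₜ[ℝ] 1 : Total 𝔤 R) *
      Total.sgn (w' ᵍ⊗ₜ[ℝ] η) = w' ᵍ⊗ₜ[ℝ] η * (w ᵍ⊗ₜ[ℝ] 1)) ?_ ?_ η
    · intro a b ha hb
      rw [Total.tmul_add, map_add, mul_add, add_mul, ha, hb]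
    · intro j η hη
      rw [Total.tmul_mul_tmul 1 j _ _ _ _ hη hw1, mul_one, mul_one, Total.sgn, Total.map_tmul,
        Total.tmul_one_mul_tmul, AlgHom.toLinearMap_apply, AlgHom.toLinearMap_apply, hc,
        (Weil.parity 𝔤).inv_inv]
      rw [(Forms.parity R).mem_grading] at hη
      rw [hη]
      rcases Int.units_eq_one_or ((-1) ^ j) with h | h <;> simp [h, Total.tmul_neg]

theorem Total.rightOdd_mul_left_even {S : Module.End ℝ (Weil 𝔤)}
    (hS : ∀ x, (Weil.parity 𝔤).inv (S x) = S ((Weil.parity 𝔤).inv x)) (T : Module.End ℝ (Forms R)) :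
    (Total.rightOdd T : Module.End ℝ (Total 𝔤 R)) * Total.leftHom 𝔤 R S =
      Total.leftHom 𝔤 R S * Total.rightOdd T := by
  refine Total.hom_ext fun w η => ?_
  change ((Weil.parity 𝔤).inv (S w) ᵍ⊗ₜ[ℝ] T η : Total 𝔤 R) = S ((Weil.parity 𝔤).inv w) ᵍ⊗ₜ[ℝ] T η
  rw [hS]

theorem Total.rightOdd_mul_left_odd {S : Module.End ℝ (Weil 𝔤)}
    (hS : ∀ x, (Weil.parity 𝔤).inv (S x) = -S ((Weil.parity 𝔤).inv x))
    (T : Module.End ℝ (Forms R)) :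
    (Total.rightOdd T : Module.End ℝ (Total 𝔤 R)) * Total.leftHom 𝔤 R S =
      -(Total.leftHom 𝔤 R S * Total.rightOdd T) := by
  refine Total.hom_ext fun w η => ?_
  change ((Weil.parity 𝔤).inv (S w) ᵍ⊗ₜ[ℝ] T η : Total 𝔤 R) =
    -(S ((Weil.parity 𝔤).inv w) ᵍ⊗ₜ[ℝ] T η)
  rw [hS, Total.neg_tmul]

theorem Total.rightOdd_mul_rightOdd (S T : Module.End ℝ (Forms R)) :
    (Total.rightOdd S : Module.End ℝ (Total 𝔤 R)) * Total.rightOdd T =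
      Total.rightHom 𝔤 R (S * T) := by
  refine Total.hom_ext fun w η => ?_
  change ((Weil.parity 𝔤).inv ((Weil.parity 𝔤).inv w) ᵍ⊗ₜ[ℝ] S (T η) : Total 𝔤 R) =
    w ᵍ⊗ₜ[ℝ] S (T η)
  rw [(Weil.parity 𝔤).inv_inv]

end TotalOps

/-! ### Commutation relations on `W(𝔤) ⊗ Ω` -/

section Conjugation

variable {𝔤 : Type*} [LieRing 𝔤] [LieAlgebra ℝ 𝔤] {R : Type*} [CommRing R] [Algebra ℝ R]

variable (𝔤 R) in
/-- Multiplication by `w ⊗ 1`. -/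
def Total.mulW : Weil 𝔤 →ₗ[ℝ] Module.End ℝ (Total 𝔤 R) :=
  (Total.leftHom 𝔤 R).toLinearMap ∘ₗ LinearMap.mul ℝ (Weil 𝔤)

theorem Total.mulW_eq_leftHom (w : Weil 𝔤) :
    Total.mulW 𝔤 R w = Total.leftHom 𝔤 R (LinearMap.mulLeft ℝ w) := rfl

theorem Total.mulW_eq_mulLeft (w : Weil 𝔤) :
    Total.mulW 𝔤 R w = LinearMap.mulLeft ℝ (w ᵍ⊗ₜ[ℝ] 1 : Total 𝔤 R) :=
  (Total.mulLeft_tmul_one w).symm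

theorem Total.mulW_mul (w w' : Weil 𝔤) :
    Total.mulW 𝔤 R (w * w') = Total.mulW 𝔤 R w * Total.mulW 𝔤 R w' := by
  rw [Total.mulW_eq_leftHom, LinearMap.mulLeft_mul]
  exact map_mul (Total.leftHom 𝔤 R) (LinearMap.mulLeft ℝ w) (LinearMap.mulLeft ℝ w')

theorem Total.leftHom_mul_mulW_of_odd {S : Module.End ℝ (Weil 𝔤)} {w w' : Weil 𝔤}
    (h : ∀ x, S (w * x) = w' * x - w * S x) :
    Total.leftHom 𝔤 R S * Total.mulW 𝔤 R w =
      Total.mulW 𝔤 R w' - Total.mulW 𝔤 R w * Total.leftHom 𝔤 R S := by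
  simp only [Total.mulW_eq_leftHom, ← map_mul, ← map_sub]
  exact congrArg _ (LinearMap.ext h)

theorem Total.leftHom_mul_mulW_of_even {S : Module.End ℝ (Weil 𝔤)} {w w' : Weil 𝔤}
    (h : ∀ x, S (w * x) = w' * x + w * S x) :
    Total.leftHom 𝔤 R S * Total.mulW 𝔤 R w =
      Total.mulW 𝔤 R w' + Total.mulW 𝔤 R w * Total.leftHom 𝔤 R S := by
  simp only [Total.mulW_eq_leftHom, ← map_mul, ← map_add]
  exact congrArg _ (LinearMap.ext h)

theorem Total.rightOdd_mul_mulW_of_odd {w : Weil 𝔤} (hw : (Weil.parity 𝔤).inv w = -w)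
    (T : Module.End ℝ (Forms R)) :
    (Total.rightOdd T : Module.End ℝ (Total 𝔤 R)) * Total.mulW 𝔤 R w =
      -(Total.mulW 𝔤 R w * Total.rightOdd T) :=
  Total.rightOdd_mul_left_odd (S := LinearMap.mulLeft ℝ w) (fun x => by
    rw [LinearMap.mulLeft_apply, LinearMap.mulLeft_apply, map_mul, hw, neg_mul]) T

theorem Total.rightOdd_mul_mulW_of_even {w : Weil 𝔤} (hw : (Weil.parity 𝔤).inv w = w)
    (T : Module.End ℝ (Forms R)) :
    (Total.rightOdd T : Module.End ℝ (Total 𝔤 R)) * Total.mulW 𝔤 R w =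
      Total.mulW 𝔤 R w * Total.rightOdd T :=
  Total.rightOdd_mul_left_even (S := LinearMap.mulLeft ℝ w) (fun x => by
    rw [LinearMap.mulLeft_apply, LinearMap.mulLeft_apply, map_mul, hw]) T

theorem Total.rightHom_mul_mulW (w : Weil 𝔤) (T : Module.End ℝ (Forms R)) :
    Total.rightHom 𝔤 R T * Total.mulW 𝔤 R w = Total.mulW 𝔤 R w * Total.rightHom 𝔤 R T :=
  (Total.leftHom_mul_rightHom _ _).symm

theorem Total.mulW_omega_swap (l l' : Module.Dual ℝ 𝔤) :
    Total.mulW 𝔤 R (Weil.omega l) * Total.mulW 𝔤 R (Weil.omega l') =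
      -(Total.mulW 𝔤 R (Weil.omega l') * Total.mulW 𝔤 R (Weil.omega l)) := by
  rw [← Total.mulW_mul, ← Total.mulW_mul, Weil.omega_mul_omega, map_neg]

theorem Total.mulW_phi_comm (l : Module.Dual ℝ 𝔤) (w : Weil 𝔤) :
    Total.mulW 𝔤 R (Weil.phi l) * Total.mulW 𝔤 R w =
      Total.mulW 𝔤 R w * Total.mulW 𝔤 R (Weil.phi l) := by
  rw [← Total.mulW_mul, ← Total.mulW_mul, Weil.phi_mul]

variable (V : 𝔤 →ₗ⁅ℝ⁆ VField R)

/-- The operator `1 ⊗ ι_x`. -/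
def Total.io : 𝔤 →ₗ[ℝ] Module.End ℝ (Total 𝔤 R) where
  toFun x := Total.rightOdd (Forms.contr (V x))
  map_add' x y := Total.hom_ext fun w η => by
    simp only [Total.rightOdd, LinearMap.add_apply, Total.map_tmul, map_add,
      Forms.contr_add_left, Total.tmul_add]
  map_smul' c x := Total.hom_ext fun w η => by
    simp only [Total.rightOdd, RingHom.id_apply, LinearMap.smul_apply, Total.map_tmul, map_smul,
      Forms.contr_smul_left, Total.tmul_smul]

/-- The operator `1 ⊗ 𝓛_x`. -/
def Total.li (x : 𝔤) : Module.End ℝ (Total 𝔤 R) := Total.rightHom 𝔤 R (Forms.lieDer (V x))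

theorem Total.io_mul_omega (x : 𝔤) (l : Module.Dual ℝ 𝔤) :
    Total.io V x * Total.mulW 𝔤 R (Weil.omega l) =
      -(Total.mulW 𝔤 R (Weil.omega l) * Total.io V x) :=
  Total.rightOdd_mul_mulW_of_odd (Weil.parity_omega l) _

theorem Total.io_mul_phi (x : 𝔤) (l : Module.Dual ℝ 𝔤) :
    Total.io V x * Total.mulW 𝔤 R (Weil.phi l) = Total.mulW 𝔤 R (Weil.phi l) * Total.io V x :=
  Total.rightOdd_mul_mulW_of_even (Weil.parity_phi l) _

theorem Total.io_mul_io (x y : 𝔤) :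
    Total.io V x * Total.io V y = -(Total.io V y * Total.io V x) := by
  change Total.rightOdd _ * Total.rightOdd _ = -(Total.rightOdd _ * Total.rightOdd _)
  rw [Total.rightOdd_mul_rightOdd, Total.rightOdd_mul_rightOdd, ← map_neg]
  exact congrArg _ (LinearMap.ext fun α => Forms.contr_contr_swap _ _ α)

theorem Total.io_mul_self (x : 𝔤) : Total.io V x * Total.io V x = 0 := by
  have h := Total.io_mul_io V x x
  have h2 : (2 : ℝ) • (Total.io V x * Total.io V x) = 0 := by
    rw [two_smul]
    nth_rewrite 1 [h]
    exact neg_add_cancel _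
  exact (smul_eq_zero_iff_right two_ne_zero).mp h2

theorem Total.li_mul_mulW (x : 𝔤) (w : Weil 𝔤) :
    Total.li V x * Total.mulW 𝔤 R w = Total.mulW 𝔤 R w * Total.li V x :=
  Total.rightHom_mul_mulW w _

theorem Total.li_mul_io (x y : 𝔤) :
    Total.li V x * Total.io V y = Total.io V y * Total.li V x + Total.io V ⁅x, y⁆ := by
  refine Total.hom_ext fun w η => ?_
  change ((Weil.parity 𝔤).inv w ᵍ⊗ₜ[ℝ] Forms.lieDer (V x) (Forms.contr (V y) η) : Total 𝔤 R) =
    (Weil.parity 𝔤).inv w ᵍ⊗ₜ[ℝ] Forms.contr (V y) (Forms.lieDer (V x) η) +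
      (Weil.parity 𝔤).inv w ᵍ⊗ₜ[ℝ] Forms.contr (V ⁅x, y⁆) η
  rw [Forms.contr_lieDer, LieHom.map_lie, ← Total.tmul_add, sub_add_cancel]

variable {ι : Type*} [Fintype ι] (ξ : Module.Basis ι ℝ 𝔤)

theorem Total.d_mul_omega (l : Module.Dual ℝ 𝔤) :
    weilD ξ * Total.mulW 𝔤 R (Weil.omega l) = Total.mulW 𝔤 R (Weil.phi l) +
      Total.mulW 𝔤 R (Weil.beta ξ l) - Total.mulW 𝔤 R (Weil.omega l) * weilD ξ := by
  have h1 := Total.leftHom_mul_mulW_of_odd (R := R) (S := Weil.d ξ) (w := Weil.omega l)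
    (w' := Weil.phi l + Weil.beta ξ l) (fun x => by
      rw [Weil.d_mul, Weil.d_omega_eq, Weil.parity_omega, neg_mul, sub_eq_add_neg])
  have h2 := Total.rightOdd_mul_mulW_of_odd (R := R) (Weil.parity_omega l) Forms.extD
  change (Total.leftHom 𝔤 R (Weil.d ξ) + Total.rightOdd Forms.extD) * _ =
    _ - _ * (Total.leftHom 𝔤 R (Weil.d ξ) + Total.rightOdd Forms.extD)
  rw [add_mul, h1, h2, map_add, mul_add]
  abel

theorem Total.d_mul_io (x : 𝔤) :
    weilD ξ * Total.io V x = Total.li V x - Total.io V x * weilD ξ := by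
  have h1 := Total.rightOdd_mul_left_odd (R := R) (S := Weil.d ξ) (Weil.parity_d ξ)
    (Forms.contr (V x))
  have h2 : (Total.rightOdd (Forms.contr (V x)) : Module.End ℝ (Total 𝔤 R)) *
      Total.rightOdd Forms.extD =
      Total.li V x - Total.rightOdd Forms.extD * Total.rightOdd (Forms.contr (V x)) := by
    rw [Total.rightOdd_mul_rightOdd, Total.rightOdd_mul_rightOdd, Total.li, ← map_sub]
    exact congrArg _ (LinearMap.ext fun α => Forms.contr_extD _ α)
  change (Total.leftHom 𝔤 R (Weil.d ξ) + Total.rightOdd Forms.extD) *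
      Total.rightOdd (Forms.contr (V x)) = _ - Total.rightOdd (Forms.contr (V x)) *
      (Total.leftHom 𝔤 R (Weil.d ξ) + Total.rightOdd Forms.extD)
  rw [add_mul, mul_add, h1, h2]
  abel

theorem Total.d_mul_d : (weilD ξ : Module.End ℝ (Total 𝔤 R)) * weilD ξ = 0 := by
  have h1 := Total.rightOdd_mul_left_odd (R := R) (S := Weil.d ξ) (Weil.parity_d ξ) Forms.extD
  have h2 : (Total.rightOdd Forms.extD : Module.End ℝ (Total 𝔤 R)) * Total.rightOdd Forms.extD =
      0 := by
    rw [Total.rightOdd_mul_rightOdd, ← map_zero (Total.rightHom 𝔤 R)]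
    exact congrArg _ (LinearMap.ext fun α => Forms.extD_extD α)
  have h3 : Total.leftHom 𝔤 R (Weil.d ξ) * Total.leftHom 𝔤 R (Weil.d ξ) = 0 := by
    rw [← map_mul, ← map_zero (Total.leftHom 𝔤 R)]
    exact congrArg _ (LinearMap.ext fun α => Weil.d_d ξ α)
  change (Total.leftHom 𝔤 R (Weil.d ξ) + Total.rightOdd Forms.extD) *
      (Total.leftHom 𝔤 R (Weil.d ξ) + Total.rightOdd Forms.extD) = 0
  rw [add_mul, mul_add, mul_add, h1, h2, h3]
  abel

theorem omegaContr_eq : omegaContr ξ V =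
    ∑ a, Total.mulW 𝔤 R (Weil.omega (ξ.coord a)) * Total.io V (ξ a) :=
  Finset.sum_congr rfl fun a _ => by rw [Total.mulW_eq_mulLeft]; rfl

theorem brstD_eq : brstD ξ V = weilD ξ +
    ∑ a, Total.mulW 𝔤 R (Weil.omega (ξ.coord a)) * Total.li V (ξ a) -
    ∑ a, Total.mulW 𝔤 R (Weil.phi (ξ.coord a)) * Total.io V (ξ a) := by
  simp only [Total.mulW_eq_mulLeft]
  rfl

theorem omegaContr_mul_omega (l : Module.Dual ℝ 𝔤) :
    omegaContr ξ V * Total.mulW 𝔤 R (Weil.omega l) =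
      Total.mulW 𝔤 R (Weil.omega l) * omegaContr ξ V := by
  rw [omegaContr_eq, Finset.sum_mul, Finset.mul_sum]
  refine Finset.sum_congr rfl fun a _ => ?_
  rw [mul_assoc, Total.io_mul_omega, mul_neg, ← mul_assoc, Total.mulW_omega_swap, neg_mul, neg_neg,
    mul_assoc]

theorem omegaContr_mul_phi (l : Module.Dual ℝ 𝔤) :
    omegaContr ξ V * Total.mulW 𝔤 R (Weil.phi l) =
      Total.mulW 𝔤 R (Weil.phi l) * omegaContr ξ V := by
  rw [omegaContr_eq, Finset.sum_mul, Finset.mul_sum]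
  refine Finset.sum_congr rfl fun a _ => ?_
  rw [mul_assoc, Total.io_mul_phi, ← mul_assoc, ← mul_assoc, Total.mulW_phi_comm]

theorem omegaContr_mul_io (x : 𝔤) :
    omegaContr ξ V * Total.io V x = Total.io V x * omegaContr ξ V := by
  rw [omegaContr_eq, Finset.sum_mul, Finset.mul_sum]
  refine Finset.sum_congr rfl fun a _ => ?_
  rw [← mul_assoc (Total.io V x), Total.io_mul_omega, mul_assoc, Total.io_mul_io, mul_neg, neg_mul,
    mul_assoc]

theorem omegaContr_mul_li (x : 𝔤) :
    omegaContr ξ V * Total.li V x = Total.li V x * omegaContr ξ V -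
      ∑ b, Total.mulW 𝔤 R (Weil.omega (ξ.coord b)) * Total.io V ⁅x, ξ b⁆ := by
  rw [omegaContr_eq, Finset.sum_mul, Finset.mul_sum, ← Finset.sum_sub_distrib]
  refine Finset.sum_congr rfl fun a _ => ?_
  rw [← mul_assoc (Total.li V x), Total.li_mul_mulW, mul_assoc, mul_assoc, Total.li_mul_io, mul_add,
    add_sub_cancel_right]

/-- The operator `ω^a ω^b ι_{[ξ_a, ξ_b]}`. -/
def omegaOmegaContr : Module.End ℝ (Total 𝔤 R) :=
  ∑ a, ∑ b, Total.mulW 𝔤 R (Weil.omega (ξ.coord a)) *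
    (Total.mulW 𝔤 R (Weil.omega (ξ.coord b)) * Total.io V ⁅ξ a, ξ b⁆)

theorem omegaContr_mul_omegaOmegaContr :
    omegaContr ξ V * omegaOmegaContr V ξ = omegaOmegaContr V ξ * omegaContr ξ V := by
  rw [omegaOmegaContr, Finset.mul_sum, Finset.sum_mul]
  refine Finset.sum_congr rfl fun a _ => ?_
  rw [Finset.mul_sum, Finset.sum_mul]
  refine Finset.sum_congr rfl fun b _ => ?_
  rw [← mul_assoc, omegaContr_mul_omega, mul_assoc, ← mul_assoc (omegaContr ξ V),
    omegaContr_mul_omega, mul_assoc, mul_assoc, mul_assoc, omegaContr_mul_io]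

theorem sum_beta_mul_io : ∑ a, Total.mulW 𝔤 R (Weil.beta ξ (ξ.coord a)) * Total.io V (ξ a) =
    -((1 / 2 : ℝ) • omegaOmegaContr V ξ) := by
  have h := fun x => sum_coadjoint_add_sum_lie ξ ((LinearMap.mul ℝ (Module.End ℝ (Total 𝔤 R))).compl₁₂
    (Total.mulW 𝔤 R ∘ₗ Weil.omegaLin 𝔤) (Total.io V)) x
  simp only [LinearMap.compl₁₂_apply, LinearMap.mul_apply', LinearMap.comp_apply,
    Weil.omegaLin_apply] at h
  have h' := fun x => eq_neg_of_add_eq_zero_left (h x)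
  rw [← smul_neg, omegaOmegaContr, ← Finset.sum_neg_distrib]
  simp only [← Finset.mul_sum, ← mul_neg, ← h']
  simp only [Weil.beta_apply, map_smul, map_sum, smul_mul_assoc, ← Finset.smul_sum,
    Total.mulW_mul, Finset.sum_mul, Finset.mul_sum, mul_assoc]
  rw [Finset.sum_comm]

/-- The commutator of `ω^a ι_a` with `d` contains the terms `ω^a 𝓛_a - φ^b ι_b` of the BRST
differential, and a term quadratic in `ω` from `d ω^a`. -/
theorem omegaContr_mul_d : omegaContr ξ V * weilD ξ - weilD ξ * omegaContr ξ V =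
    ∑ a, Total.mulW 𝔤 R (Weil.omega (ξ.coord a)) * Total.li V (ξ a) -
      ∑ a, Total.mulW 𝔤 R (Weil.phi (ξ.coord a)) * Total.io V (ξ a) +
      (1 / 2 : ℝ) • omegaOmegaContr V ξ := by
  rw [← neg_neg ((1 / 2 : ℝ) • omegaOmegaContr V ξ), ← sum_beta_mul_io, omegaContr_eq,
    Finset.sum_mul, Finset.mul_sum, ← sub_eq_add_neg, ← Finset.sum_sub_distrib,
    ← Finset.sum_sub_distrib, ← Finset.sum_sub_distrib]
  refine Finset.sum_congr rfl fun a _ => ?_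
  rw [← mul_assoc (weilD ξ), Total.d_mul_omega, sub_mul, add_mul, mul_assoc _ (weilD ξ),
    Total.d_mul_io, mul_sub, mul_assoc]
  abel

/-- The second commutator of `ω^a ι_a` with `d`. Up to the factor `½` of the exponential series it
cancels the quadratic term of the first. -/
theorem omegaContr_mul_commutator :
    omegaContr ξ V * (∑ a, Total.mulW 𝔤 R (Weil.omega (ξ.coord a)) * Total.li V (ξ a) -
      ∑ a, Total.mulW 𝔤 R (Weil.phi (ξ.coord a)) * Total.io V (ξ a) +
      (1 / 2 : ℝ) • omegaOmegaContr V ξ) -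
    (∑ a, Total.mulW 𝔤 R (Weil.omega (ξ.coord a)) * Total.li V (ξ a) -
      ∑ a, Total.mulW 𝔤 R (Weil.phi (ξ.coord a)) * Total.io V (ξ a) +
      (1 / 2 : ℝ) • omegaOmegaContr V ξ) * omegaContr ξ V = -omegaOmegaContr V ξ := by
  have h1 : omegaContr ξ V * ∑ a, Total.mulW 𝔤 R (Weil.omega (ξ.coord a)) * Total.li V (ξ a) =
      (∑ a, Total.mulW 𝔤 R (Weil.omega (ξ.coord a)) * Total.li V (ξ a)) * omegaContr ξ V -
        omegaOmegaContr V ξ := by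
    rw [omegaOmegaContr, Finset.sum_mul, Finset.mul_sum, ← Finset.sum_sub_distrib]
    refine Finset.sum_congr rfl fun a _ => ?_
    rw [← mul_assoc, omegaContr_mul_omega, mul_assoc, omegaContr_mul_li, mul_sub, mul_assoc,
      Finset.mul_sum]
  have h2 : omegaContr ξ V * ∑ a, Total.mulW 𝔤 R (Weil.phi (ξ.coord a)) * Total.io V (ξ a) =
      (∑ a, Total.mulW 𝔤 R (Weil.phi (ξ.coord a)) * Total.io V (ξ a)) * omegaContr ξ V := by
    rw [Finset.sum_mul, Finset.mul_sum]
    refine Finset.sum_congr rfl fun a _ => ?_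
    rw [← mul_assoc, omegaContr_mul_phi, mul_assoc, omegaContr_mul_io, mul_assoc]
  rw [mul_add, mul_sub, add_mul, sub_mul, h1, h2, mul_smul_comm, smul_mul_assoc,
    omegaContr_mul_omegaOmegaContr]
  abel

/-- A sum of `n` commuting elements of square zero has vanishing power `n + 1`. -/
theorem sum_pow_card_succ {A κ : Type*} [Ring A] (s : Finset κ) (f : κ → A)
    (hf : ∀ i, f i * f i = 0) (hc : ∀ i j, f i * f j = f j * f i) :
    (∑ i ∈ s, f i) ^ (s.card + 1) = 0 := by
  classical
  induction s using Finset.induction_on with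
  | empty => simp
  | insert i s hi ih =>
    rw [Finset.sum_insert hi, Finset.card_insert_of_notMem hi]
    have hcomm : Commute (f i) (∑ j ∈ s, f j) := Commute.sum_right _ _ _ fun j _ => hc i j
    exact hcomm.add_pow_eq_zero_of_add_le_succ_of_pow_eq_zero (m := 2) (n := s.card + 1)
      (by rw [pow_two, hf]) ih (by omega)

theorem omegaContr_pow : omegaContr ξ V ^ (Fintype.card ι + 1) = 0 := by
  rw [omegaContr_eq]
  refine sum_pow_card_succ _ _ (fun a => ?_) (fun a b => ?_)
  · rw [mul_assoc, ← mul_assoc (Total.io V _), Total.io_mul_omega, neg_mul, mul_assoc _ (Total.io V _),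
      Total.io_mul_self, mul_zero, neg_zero, mul_zero]
  · have key : ∀ p q r s : Module.End ℝ (Total 𝔤 R), q * r = -(r * q) → s * p = -(p * s) →
        q * s = -(s * q) → p * r = -(r * p) → p * q * (r * s) = r * s * (p * q) := by
      intro p q r s h1 h2 h3 h4
      rw [mul_assoc, ← mul_assoc q, h1, mul_assoc r, ← mul_assoc s, h2, neg_mul, neg_mul, mul_assoc r q,
        h3, mul_assoc p]
      simp only [mul_neg, neg_neg, ← mul_assoc, h4, neg_mul]
    exact key _ _ _ _ (Total.io_mul_omega _ _ _) (Total.io_mul_omega _ _ _) (Total.io_mul_io _ _ _)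
      (Total.mulW_omega_swap _ _)

theorem psi_eq : psi ξ V = expSum (Fintype.card ι + 1) (-omegaContr ξ V) := rfl

/-- The inverse `exp(ω^a ⊗ ι_a)` of `psi`. -/
def psiInv : Module.End ℝ (Total 𝔤 R) := expSum (Fintype.card ι + 1) (omegaContr ξ V)

theorem psi_mul_psiInv : psi ξ V * psiInv V ξ = 1 := expSum_neg_mul_expSum (omegaContr_pow V ξ)
theorem psiInv_mul_psi : psiInv V ξ * psi ξ V = 1 := expSum_mul_expSum_neg (omegaContr_pow V ξ)

/-- The BRST differential is conjugate to `d` under `psi`. -/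
theorem psiInv_mul_d_mul_psi : psiInv V ξ * weilD ξ * psi ξ V = brstD ξ V := by
  have h := expSum_conj (omegaContr_pow V ξ) (omegaContr_mul_d V ξ) (omegaContr_mul_commutator V ξ)
    (by rw [mul_neg, neg_mul, omegaContr_mul_omegaOmegaContr, sub_self])
  rw [psiInv, psi_eq, h, brstD_eq]
  module

theorem d_mul_psi : weilD ξ * psi ξ V = psi ξ V * brstD ξ V := by
  rw [← psiInv_mul_d_mul_psi, ← mul_assoc, ← mul_assoc, psi_mul_psiInv, one_mul]

/-- The commutator of `ω^b ι_b` with `I_a ⊗ 1` is `- 1 ⊗ ι_a`. -/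
theorem leftContr_mul_omegaContr (a : ι) :
    omegaContr ξ V * Total.leftHom 𝔤 R (Weil.contr (ξ a)) -
      Total.leftHom 𝔤 R (Weil.contr (ξ a)) * omegaContr ξ V = -Total.io V (ξ a) := by
  classical
  have h1 : ∀ b, Total.leftHom 𝔤 R (Weil.contr (ξ a)) * Total.mulW 𝔤 R (Weil.omega (ξ.coord b)) =
      (if b = a then 1 else 0) - Total.mulW 𝔤 R (Weil.omega (ξ.coord b)) *
        Total.leftHom 𝔤 R (Weil.contr (ξ a)) := fun b => by
    rw [Total.leftHom_mul_mulW_of_odd (w' := (ξ.coord b (ξ a)) • 1) (fun x => by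
      rw [Weil.contr_omega_mul, smul_one_mul])]
    congr 1
    have h0 : Total.mulW 𝔤 R 1 = 1 := by
      rw [Total.mulW_eq_leftHom, LinearMap.mulLeft_one]; exact map_one (Total.leftHom 𝔤 R)
    rw [map_smul, h0]
    by_cases hb : b = a
    · simp [hb]
    · simp [hb]
  have h2 : ∀ b, Total.io V (ξ b) * Total.leftHom 𝔤 R (Weil.contr (ξ a)) =
      -(Total.leftHom 𝔤 R (Weil.contr (ξ a)) * Total.io V (ξ b)) := fun b =>
    Total.rightOdd_mul_left_odd (Weil.parity_contr _) _
  have h3 : ∑ b, (if b = a then (1 : Module.End ℝ (Total 𝔤 R)) else 0) * Total.io V (ξ b) =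
      Total.io V (ξ a) := by simp
  rw [← h3, omegaContr_eq, Finset.sum_mul, Finset.mul_sum, ← Finset.sum_sub_distrib,
    ← Finset.sum_neg_distrib]
  refine Finset.sum_congr rfl fun b _ => ?_
  rw [← mul_assoc, h1, mul_assoc, h2, sub_mul, mul_neg, mul_assoc]
  abel

theorem totalContr_eq (a : ι) : totalContr ξ V a =
    Total.leftHom 𝔤 R (Weil.contr (ξ a)) + Total.io V (ξ a) := rfl

theorem totalLie_eq (a : ι) : totalLie ξ V a =
    Total.leftHom 𝔤 R (Weil.lie ξ a) + Total.li V (ξ a) := rfl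

/-- Under `psi`, horizontal elements of `B` correspond to horizontal elements of `A`. -/
theorem totalContr_mul_psi (a : ι) :
    totalContr ξ V a * psi ξ V = psi ξ V * Total.leftHom 𝔤 R (Weil.contr (ξ a)) := by
  have h := expSum_conj (omegaContr_pow V ξ) (leftContr_mul_omegaContr V ξ a) (w := 0)
    (by rw [mul_neg, neg_mul, omegaContr_mul_io, sub_self]) (by rw [mul_zero, zero_mul, sub_zero])
  have h' := expSum_conj (omegaContr_pow V ξ) (y := Total.io V (ξ a)) (z := 0) (w := 0)
    (by rw [omegaContr_mul_io, sub_self])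
    (by rw [mul_zero, zero_mul, sub_zero]) (by rw [mul_zero, zero_mul, sub_zero])
  have h2 : psiInv V ξ * totalContr ξ V a * psi ξ V = Total.leftHom 𝔤 R (Weil.contr (ξ a)) := by
    rw [totalContr_eq, mul_add, add_mul, psiInv, psi_eq, h, h']
    simp
  rw [← h2, ← mul_assoc, ← mul_assoc, psi_mul_psiInv, one_mul]

/-- `ω^b ι_b` is invariant, as the canonical element of `𝔤* ⊗ 𝔤` is. -/
theorem totalLie_mul_omegaContr (a : ι) :
    omegaContr ξ V * totalLie ξ V a - totalLie ξ V a * omegaContr ξ V = 0 := by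
  have h := sum_coadjoint_add_sum_lie ξ ((LinearMap.mul ℝ (Module.End ℝ (Total 𝔤 R))).compl₁₂
    (Total.mulW 𝔤 R ∘ₗ Weil.omegaLin 𝔤) (Total.io V)) (ξ a)
  simp only [LinearMap.compl₁₂_apply, LinearMap.mul_apply', LinearMap.comp_apply,
    Weil.omegaLin_apply] at h
  have h1 : ∀ l, Total.leftHom 𝔤 R (Weil.lie ξ a) * Total.mulW 𝔤 R (Weil.omega l) =
      Total.mulW 𝔤 R (Weil.omega (coadjoint (ξ a) l)) + Total.mulW 𝔤 R (Weil.omega l) *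
        Total.leftHom 𝔤 R (Weil.lie ξ a) := fun l =>
    Total.leftHom_mul_mulW_of_even fun x => by rw [Weil.lie_mul, Weil.lie_omega]
  have h2 : ∀ b, Total.io V (ξ b) * Total.leftHom 𝔤 R (Weil.lie ξ a) =
      Total.leftHom 𝔤 R (Weil.lie ξ a) * Total.io V (ξ b) := fun b =>
    Total.rightOdd_mul_left_even (Weil.parity_lie ξ a) _
  have h3 : omegaContr ξ V * Total.leftHom 𝔤 R (Weil.lie ξ a) =
      Total.leftHom 𝔤 R (Weil.lie ξ a) * omegaContr ξ V -
        ∑ b, Total.mulW 𝔤 R (Weil.omega (coadjoint (ξ a) (ξ.coord b))) * Total.io V (ξ b) := by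
    rw [omegaContr_eq, Finset.sum_mul, Finset.mul_sum, ← Finset.sum_sub_distrib]
    refine Finset.sum_congr rfl fun b _ => ?_
    rw [← mul_assoc (Total.leftHom 𝔤 R (Weil.lie ξ a)), h1, add_mul, mul_assoc, h2, mul_assoc,
      add_sub_cancel_left]
  rw [totalLie_eq, mul_add, add_mul, h3, omegaContr_mul_li, eq_neg_of_add_eq_zero_left h]
  abel

theorem totalLie_mul_psi (a : ι) : totalLie ξ V a * psi ξ V = psi ξ V * totalLie ξ V a := by
  have h := expSum_conj (omegaContr_pow V ξ) (totalLie_mul_omegaContr V ξ a) (w := 0)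
    (by rw [mul_zero, zero_mul, sub_zero]) (by rw [mul_zero, zero_mul, sub_zero])
  have h2 : psiInv V ξ * totalLie ξ V a * psi ξ V = totalLie ξ V a := by
    rw [psiInv, psi_eq, h]
    simp
  nth_rewrite 2 [← h2]
  rw [← mul_assoc, ← mul_assoc, psi_mul_psiInv, one_mul]

/-- Cartan's formula on `W(𝔤) ⊗ Ω`. -/
theorem totalContr_mul_d (a : ι) :
    totalContr ξ V a * weilD ξ + weilD ξ * totalContr ξ V a = totalLie ξ V a := by
  have h1 := Total.rightOdd_mul_left_odd (R := R) (Weil.parity_contr (ξ a)) Forms.extD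
  have h2 : Total.leftHom 𝔤 R (Weil.contr (ξ a)) * Total.leftHom 𝔤 R (Weil.d ξ) +
      Total.leftHom 𝔤 R (Weil.d ξ) * Total.leftHom 𝔤 R (Weil.contr (ξ a)) =
      Total.leftHom 𝔤 R (Weil.lie ξ a) := by
    rw [← map_mul, ← map_mul, ← map_add]; rfl
  have h3 : Total.leftHom 𝔤 R (Weil.contr (ξ a)) * weilD ξ +
      weilD ξ * Total.leftHom 𝔤 R (Weil.contr (ξ a)) = Total.leftHom 𝔤 R (Weil.lie ξ a) := by
    change _ * (Total.leftHom 𝔤 R (Weil.d ξ) + Total.rightOdd Forms.extD) +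
      (Total.leftHom 𝔤 R (Weil.d ξ) + Total.rightOdd Forms.extD) * _ = _
    rw [← h2, mul_add, add_mul, h1]
    abel
  rw [totalContr_eq, totalLie_eq, add_mul, mul_add, ← h3, Total.d_mul_io]
  abel

/-- Conjugating Cartan's formula by `psi`. -/
theorem leftContr_mul_brstD (a : ι) :
    Total.leftHom 𝔤 R (Weil.contr (ξ a)) * brstD ξ V +
      brstD ξ V * Total.leftHom 𝔤 R (Weil.contr (ξ a)) = totalLie ξ V a := by
  have h : psi ξ V * (Total.leftHom 𝔤 R (Weil.contr (ξ a)) * brstD ξ V +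
      brstD ξ V * Total.leftHom 𝔤 R (Weil.contr (ξ a))) = psi ξ V * totalLie ξ V a := by
    rw [← totalLie_mul_psi, ← totalContr_mul_d V ξ a, mul_add, ← mul_assoc, ← mul_assoc,
      ← totalContr_mul_psi, ← d_mul_psi, mul_assoc, ← d_mul_psi, mul_assoc _ (psi ξ V),
      ← totalContr_mul_psi, add_mul, mul_assoc, mul_assoc]
  have := congrArg (psiInv V ξ * ·) h
  simpa only [← mul_assoc, psiInv_mul_psi, one_mul] using this

/-- As `δ` is conjugate to `d`, it is of square zero. -/
theorem brstD_mul_brstD : brstD ξ V * brstD ξ V = 0 := by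
  rw [← psiInv_mul_d_mul_psi, mul_assoc, ← mul_assoc (psi ξ V), ← mul_assoc (psi ξ V),
    psi_mul_psiInv, one_mul, mul_assoc, ← mul_assoc (weilD ξ), Total.d_mul_d, zero_mul, mul_zero]

theorem commute_of_anticommutator {A : Type*} [Ring A] {i d l : A} (h : i * d + d * i = l)
    (hd : d * d = 0) : l * d = d * l := by
  rw [← h, add_mul, mul_add, mul_assoc i, hd, ← mul_assoc d d, hd, mul_zero, zero_mul, mul_assoc]
  abel

theorem totalLie_mul_d (a : ι) : totalLie ξ V a * weilD ξ = weilD ξ * totalLie ξ V a :=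
  commute_of_anticommutator (totalContr_mul_d V ξ a) (Total.d_mul_d ξ)

theorem totalLie_mul_brstD (a : ι) : totalLie ξ V a * brstD ξ V = brstD ξ V * totalLie ξ V a :=
  commute_of_anticommutator (leftContr_mul_brstD V ξ a) (brstD_mul_brstD V ξ)

end Conjugation

/-! ### The automorphism `ψ` and the Leibniz rules -/

section Automorphism

variable {𝔤 : Type*} [LieRing 𝔤] [LieAlgebra ℝ 𝔤] {R : Type*} [CommRing R] [Algebra ℝ R]

theorem weilD_mul {ι : Type*} [Fintype ι] (ξ : Module.Basis ι ℝ 𝔤) (x y : Total 𝔤 R) :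
    weilD ξ (x * y) = weilD ξ x * y + Total.sgn x * weilD ξ y := by
  simp only [weilD, LinearMap.add_apply]
  rw [Total.left_odd_mul (Weil.parity_d ξ) (Weil.d_mul ξ),
    Total.rightOdd_mul Forms.parity_extD Forms.extD_mul, add_mul, mul_add]
  abel

variable (V : 𝔤 →ₗ⁅ℝ⁆ VField R)

theorem Total.sgn_mul_omega (l : Module.Dual ℝ 𝔤) :
    (Total.sgn : Module.End ℝ (Total 𝔤 R)) * Total.mulW 𝔤 R (Weil.omega l) =
      -(Total.mulW 𝔤 R (Weil.omega l) * Total.sgn) := by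
  refine Total.hom_ext fun w η => ?_
  change ((Weil.parity 𝔤).inv (Weil.omega l * w) ᵍ⊗ₜ[ℝ] (Forms.parity R).inv η : Total 𝔤 R) =
    -((Weil.omega l * (Weil.parity 𝔤).inv w) ᵍ⊗ₜ[ℝ] (Forms.parity R).inv η)
  rw [map_mul, Weil.parity_omega, neg_mul, Total.neg_tmul]

theorem Total.sgn_mul_io (x : 𝔤) :
    Total.sgn * Total.io V x = -(Total.io V x * Total.sgn) := by
  refine Total.hom_ext fun w η => ?_
  change ((Weil.parity 𝔤).inv ((Weil.parity 𝔤).inv w) ᵍ⊗ₜ[ℝ]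
      (Forms.parity R).inv (Forms.contr (V x) η) : Total 𝔤 R) =
    -((Weil.parity 𝔤).inv ((Weil.parity 𝔤).inv w) ᵍ⊗ₜ[ℝ]
      Forms.contr (V x) ((Forms.parity R).inv η))
  rw [Forms.parity_contr, Total.tmul_neg]

variable {ι : Type*} [Fintype ι] (ξ : Module.Basis ι ℝ 𝔤)

theorem sgn_mul_omegaContr : Total.sgn * omegaContr ξ V = omegaContr ξ V * Total.sgn := by
  rw [omegaContr_eq, Finset.mul_sum, Finset.sum_mul]
  refine Finset.sum_congr rfl fun a _ => ?_
  rw [← mul_assoc, Total.sgn_mul_omega, neg_mul, mul_assoc, Total.sgn_mul_io, mul_neg, neg_neg,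
    mul_assoc]

/-- `ψ` is even. -/
theorem sgn_mul_psi : Total.sgn * psi ξ V = psi ξ V * Total.sgn := by
  have h : Commute (Total.sgn : Module.End ℝ (Total 𝔤 R)) (omegaContr ξ V) :=
    sgn_mul_omegaContr V ξ
  exact Commute.sum_right _ _ _ fun k _ => (h.neg_right.pow_right k).smul_right _

/-- The product of the odd element `ω^a` and the odd derivation `ι_a` is an even derivation. -/
theorem omegaContr_mul_eq (x y : Total 𝔤 R) :
    omegaContr ξ V (x * y) = x * omegaContr ξ V y + omegaContr ξ V x * y := by
  rw [omegaContr, LinearMap.sum_apply, LinearMap.sum_apply, LinearMap.sum_apply, Finset.mul_sum,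
    Finset.sum_mul, ← Finset.sum_add_distrib]
  refine Finset.sum_congr rfl fun a _ => ?_
  simp only [LinearMap.comp_apply, LinearMap.mulLeft_apply]
  rw [Total.rightOdd_mul (Forms.parity_contr _) (Forms.contr_mul _), mul_add, ← mul_assoc,
    ← mul_assoc _ (Total.sgn x), Total.mul_tmul_one (Weil.parity_omega _) (Weil.omega_mul _),
    mul_assoc x, add_comm]

/-- As the exponential of a nilpotent derivation, `ψ` is multiplicative. -/
theorem psi_mul (x y : Total 𝔤 R) : psi ξ V (x * y) = psi ξ V x * psi ξ V y := by
  refine expSum_derivation (by rw [neg_pow, omegaContr_pow, mul_zero]) (fun x y => ?_) x y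
  simp only [LinearMap.neg_apply, omegaContr_mul_eq, mul_neg, neg_mul, neg_add]

theorem psi_psiInv (x : Total 𝔤 R) : psi ξ V (psiInv V ξ x) = x :=
  congrArg (fun T => T x) (psi_mul_psiInv V ξ)

theorem psiInv_psi (x : Total 𝔤 R) : psiInv V ξ (psi ξ V x) = x :=
  congrArg (fun T => T x) (psiInv_mul_psi V ξ)

/-- `ψ` as an automorphism of the algebra `W(𝔤) ⊗ Ω`. -/
def psiEquiv : Total 𝔤 R ≃ₐ[ℝ] Total 𝔤 R :=
  AlgEquiv.ofLinearEquiv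
    (LinearEquiv.ofLinearMap (psi ξ V) (psiInv V ξ) (psi_mul_psiInv V ξ) (psiInv_mul_psi V ξ))
    (by
      -- a surjective multiplicative map is unital
      change psi ξ V 1 = 1
      have h := psi_mul V ξ 1 (psiInv V ξ 1)
      rwa [one_mul, psi_psiInv, mul_one, eq_comm] at h)
    (psi_mul V ξ)

theorem psi_brstD (x : Total 𝔤 R) : psi ξ V (brstD ξ V x) = weilD ξ (psi ξ V x) :=
  congrArg (fun T => T x) (d_mul_psi V ξ).symm

theorem psi_injective : Function.Injective (psi ξ V : Total 𝔤 R → Total 𝔤 R) :=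
  (psiEquiv V ξ).injective

/-- The Leibniz rule for `δ` is transported from the one for `d` by the automorphism `ψ`. -/
theorem brstD_mul (x y : Total 𝔤 R) :
    brstD ξ V (x * y) = brstD ξ V x * y + Total.sgn x * brstD ξ V y := by
  have hs : Total.sgn (psi ξ V x) = psi ξ V (Total.sgn x) := congrArg (fun T => T x) (sgn_mul_psi V ξ)
  refine psi_injective V ξ ?_
  rw [psi_brstD, psi_mul, weilD_mul, map_add, psi_mul, psi_mul, psi_brstD, psi_brstD, hs]

end Automorphism

/-! ### Horizontal elements and the Cartan model -/

section Horizontal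

variable {𝔤 : Type*} [LieRing 𝔤] [LieAlgebra ℝ 𝔤] {R : Type*} [CommRing R] [Algebra ℝ R]

theorem omegaZero_cartanIncl (y : CartanTotal 𝔤 R) : omegaZero 𝔤 R (cartanIncl 𝔤 R y) = y := by
  induction y using CartanTotal.induction with
  | zero => rw [map_zero, map_zero]
  | add x y hx hy => rw [map_add, map_add, hx, hy]
  | tmul s η =>
    rw [cartanIncl_tmul, omegaZero_tmul, Weil.omegaZero_tmul, map_one, map_one, mul_one]

theorem cartanIncl_injective : Function.Injective (cartanIncl 𝔤 R) :=
  Function.LeftInverse.injective omegaZero_cartanIncl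

theorem left_contr_cartanIncl (z : 𝔤) (y : CartanTotal 𝔤 R) :
    Total.left (Weil.contr z) (cartanIncl 𝔤 R y) = 0 := by
  induction y using CartanTotal.induction with
  | zero => rw [map_zero, map_zero]
  | add x y hx hy => rw [map_add, map_add, hx, hy, add_zero]
  | tmul s η =>
    rw [cartanIncl_tmul, Total.left, Total.map_tmul, Weil.contr_tmul_one, ← zero_smul ℝ (0 : Weil 𝔤),
      Total.smul_tmul, zero_smul]

variable {ι : Type*} [Fintype ι] (ξ : Module.Basis ι ℝ 𝔤)

/-- The projections setting a single `ω^a` to zero fix horizontal elements. -/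
theorem leftHom_killList (L : List ι) {x : Total 𝔤 R}
    (h : ∀ a, Total.left (Weil.contr (ξ a)) x = 0) :
    Total.leftHom 𝔤 R (Weil.killList ξ L) x = x := by
  induction L with
  | nil => exact congrArg (fun T => T x) (map_one (Total.leftHom 𝔤 R))
  | cons a L ih =>
    have h1 : Weil.killList ξ (a :: L) = (1 - LinearMap.mulLeft ℝ (Weil.omega (ξ.coord a)) *
        Weil.contr (ξ a) : Module.End ℝ (Weil 𝔤)) * Weil.killList ξ L :=
      LinearMap.ext fun x => Weil.killList_cons ξ a L x
    have h2 : Total.leftHom 𝔤 R (Weil.contr (ξ a)) x = 0 := h a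
    rw [h1, map_mul, Module.End.mul_apply, ih, map_sub, map_one, map_mul, LinearMap.sub_apply,
      Module.End.mul_apply, h2, map_zero, sub_zero]
    rfl

/-- The horizontal elements are those independent of the `ω^a`. -/
theorem eq_cartanIncl_of_contr {x : Total 𝔤 R} (h : ∀ a, Total.left (Weil.contr (ξ a)) x = 0) :
    cartanIncl 𝔤 R (omegaZero 𝔤 R x) = x := by
  have h1 : Total.leftHom 𝔤 R (Weil.killList ξ Finset.univ.toList) =
      (cartanIncl 𝔤 R).toLinearMap ∘ₗ (omegaZero 𝔤 R).toLinearMap :=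
    Total.hom_ext fun w η => by
      change (Weil.killList ξ Finset.univ.toList w ᵍ⊗ₜ[ℝ] η : Total 𝔤 R) = _
      rw [Weil.killList_univ]
      rfl
  rw [← leftHom_killList ξ Finset.univ.toList h, h1]
  simp only [LinearMap.comp_apply, AlgHom.toLinearMap_apply, omegaZero_cartanIncl]

theorem range_cartanIncl : Set.range (cartanIncl 𝔤 R) =
    { b | ∀ a, Total.left (Weil.contr (ξ a)) b = 0 } := by
  ext b
  refine ⟨?_, fun h => ⟨_, eq_cartanIncl_of_contr ξ h⟩⟩
  rintro ⟨y, rfl⟩ a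
  exact left_contr_cartanIncl _ _

theorem omegaZero_omega_mul (l : Module.Dual ℝ 𝔤) (x : Total 𝔤 R) :
    omegaZero 𝔤 R (Weil.omega l ᵍ⊗ₜ[ℝ] 1 * x) = 0 := by
  have h : CartanTotal.tmul (0 : Sym 𝔤) (1 : Forms R) = 0 := TensorProduct.zero_tmul _ _
  rw [map_mul, omegaZero_tmul, Weil.omegaZero_omega, h, zero_mul]

variable (V : 𝔤 →ₗ⁅ℝ⁆ VField R)

theorem omegaZero_omegaContr (x : Total 𝔤 R) : omegaZero 𝔤 R (omegaContr ξ V x) = 0 := by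
  rw [omegaContr, LinearMap.sum_apply, map_sum]
  exact Finset.sum_eq_zero fun a _ => omegaZero_omega_mul _ _

/-- `ψ - 1` takes values in the ideal of the `ω^a`. -/
theorem omegaZero_psi (x : Total 𝔤 R) : omegaZero 𝔤 R (psi ξ V x) = omegaZero 𝔤 R x := by
  rw [psi, Finset.sum_range_succ', LinearMap.add_apply, map_add, LinearMap.sum_apply, map_sum,
    Finset.sum_eq_zero, zero_add]
  · simp
  · intro k _
    rw [pow_succ', LinearMap.smul_apply, map_smul, Module.End.mul_apply, LinearMap.neg_apply, map_neg,
      omegaZero_omegaContr, neg_zero, smul_zero]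

theorem symDerivation_sum {E : Type*} [AddCommGroup E] [Module ℝ E] {κ : Type*} (t : Finset κ)
    (c : κ → ℝ) (f : κ → E →ₗ[ℝ] E) (s : SymmetricAlgebra ℝ E) :
    symDerivation (∑ i ∈ t, c i • f i) s = ∑ i ∈ t, c i • symDerivation (f i) s := by
  induction s using SymmetricAlgebra.induction with
  | algebraMap r => simp
  | ι v => simp only [symDerivation_ι, LinearMap.sum_apply, map_sum, LinearMap.smul_apply, map_smul]
  | mul a b ha hb =>
    simp only [Derivation.leibniz, ha, hb, Finset.smul_sum, smul_add, Finset.sum_add_distrib,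
      smul_comm (_ : ℝ)]
  | add a b ha hb => simp only [map_add, ha, hb, smul_add, Finset.sum_add_distrib]

theorem Forms.lieDer_eq (X : VField R) (η : Forms R) :
    Forms.lieDer X η = Forms.contr X (Forms.extD η) + Forms.extD (Forms.contr X η) := by
  rw [Forms.contr_extD, sub_add_cancel]

theorem Forms.lieDer_sum {κ : Type*} (t : Finset κ) (c : κ → ℝ) (X : κ → VField R) (η : Forms R) :
    Forms.lieDer (∑ i ∈ t, c i • X i) η = ∑ i ∈ t, c i • Forms.lieDer (X i) η := by
  have h : ∀ η, Forms.contr (∑ i ∈ t, c i • X i) η = ∑ i ∈ t, c i • Forms.contr (X i) η :=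
    fun η => by
      have h0 : Forms.contr (0 : VField R) η = 0 := by
        rw [← zero_smul ℝ (0 : VField R), Forms.contr_smul_left, zero_smul]
      let T : VField R →+ Forms R := ⟨⟨fun X => Forms.contr X η, h0⟩, fun X Y =>
        Forms.contr_add_left X Y η⟩
      exact (map_sum T _ _).trans (Finset.sum_congr rfl fun i _ => Forms.contr_smul_left _ _ _)
  simp only [Forms.lieDer_eq, h, map_sum, map_smul, smul_add, Finset.sum_add_distrib]

/-- The action of `𝔤` on `S(𝔤*) ⊗ Ω` is linear in the element of `𝔤`. -/
theorem cartanLie_eq_sum (x : 𝔤) (y : CartanTotal 𝔤 R) :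
    cartanLie V x y = ∑ b, ξ.repr x b • cartanLie V (ξ b) y := by
  induction y using CartanTotal.induction with
  | zero => simp
  | add y z hy hz => simp only [map_add, hy, hz, smul_add, Finset.sum_add_distrib]
  | tmul s η =>
    have h1 : coadjoint x = ∑ b, ξ.repr x b • coadjoint (ξ b) := by
      ext l z
      conv_lhs => rw [coadjoint_apply, ← ξ.sum_repr x, sum_lie]
      simp [coadjoint_apply]
    have h2 : V x = ∑ b, ξ.repr x b • V (ξ b) := by
      conv_lhs => rw [← ξ.sum_repr x]
      exact (map_sum (V : 𝔤 →ₗ[ℝ] VField R) _ _).trans (Finset.sum_congr rfl fun b _ => map_smul V _ _)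
    have h3 : ∀ (c : ℝ) (s : Sym 𝔤), CartanTotal.tmul (c • s) η = c • CartanTotal.tmul s η :=
      fun c s => (TensorProduct.smul_tmul' c s η).symm
    have h4 : ∀ (c : ℝ) (η : Forms R), CartanTotal.tmul s (c • η) = c • CartanTotal.tmul s η :=
      fun c η => TensorProduct.tmul_smul c s η
    have h5 : ∀ f : ι → Sym 𝔤, CartanTotal.tmul (∑ b, f b) η = ∑ b, CartanTotal.tmul (f b) η :=
      fun f => TensorProduct.sum_tmul _ _ _
    have h6 : ∀ f : ι → Forms R, CartanTotal.tmul s (∑ b, f b) = ∑ b, CartanTotal.tmul s (f b) :=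
      fun f => TensorProduct.tmul_sum _ _ _
    simp only [cartanLie_tmul, Sym.lie, smul_add, Finset.sum_add_distrib]
    rw [h1, h2, symDerivation_sum, Forms.lieDer_sum, h5, h6]
    simp only [h3, h4]

theorem mem_cartanAlgebra_iff (y : CartanTotal 𝔤 R) :
    y ∈ cartanAlgebra V ↔ ∀ a, cartanLie V (ξ a) y = 0 :=
  ⟨fun h a => h (ξ a), fun h x => by
    rw [cartanLie_eq_sum ξ]
    exact Finset.sum_eq_zero fun b _ => by rw [h b, smul_zero]⟩

theorem totalLie_cartanIncl (a : ι) (y : CartanTotal 𝔤 R) :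
    totalLie ξ V a (cartanIncl 𝔤 R y) = cartanIncl 𝔤 R (cartanLie V (ξ a) y) := by
  induction y using CartanTotal.induction with
  | zero => simp only [map_zero]
  | add x y hx hy => simp only [map_add, hx, hy]
  | tmul s η =>
    rw [cartanLie_tmul, map_add, cartanIncl_tmul, cartanIncl_tmul, cartanIncl_tmul,
      ← Weil.lie_tmul_one]
    rfl

theorem image_cartanAlgebra : cartanIncl 𝔤 R '' cartanAlgebra V =
    { b | (∀ a, Total.left (Weil.contr (ξ a)) b = 0) ∧ ∀ a, totalLie ξ V a b = 0 } := by
  ext b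
  constructor
  · rintro ⟨y, hy, rfl⟩
    exact ⟨fun a => left_contr_cartanIncl _ _, fun a => by
      rw [totalLie_cartanIncl, (mem_cartanAlgebra_iff ξ V y).mp hy, map_zero]⟩
  · rintro ⟨h1, h2⟩
    have hb := eq_cartanIncl_of_contr ξ h1
    refine ⟨omegaZero 𝔤 R b, (mem_cartanAlgebra_iff ξ V _).mpr fun a => ?_, hb⟩
    refine cartanIncl_injective ?_
    rw [← totalLie_cartanIncl, hb, h2, map_zero]

/-- Setting `ω^a` to zero in the BRST differential leaves the Cartan differential. -/
theorem omegaZero_brstD_cartanIncl (y : CartanTotal 𝔤 R) :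
    omegaZero 𝔤 R (brstD ξ V (cartanIncl 𝔤 R y)) = cartanD ξ V y := by
  induction y using CartanTotal.induction with
  | zero => simp only [map_zero]
  | add x y hx hy => simp only [map_add, hx, hy]
  | tmul s η =>
    have h0 : ∀ η : Forms R, CartanTotal.tmul (0 : Sym 𝔤) η = 0 := fun η =>
      TensorProduct.zero_tmul _ η
    have h1 : Weil.omegaZero 𝔤 (Weil.d ξ (Weil.tmul s 1)) = 0 := by
      rw [Weil.d_apply]
      simp [Weil.contr_tmul_one, Weil.omegaZero_omega]
    have h2 : ∀ (s : Sym 𝔤) (η : Forms R), omegaZero 𝔤 R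
        ((Weil.parity 𝔤).inv (Weil.tmul s 1) ᵍ⊗ₜ[ℝ] η : Total 𝔤 R) = CartanTotal.tmul s η :=
      fun s η => by
        rw [omegaZero_tmul, Weil.omegaZero_parity, Weil.omegaZero_tmul, map_one, map_one, mul_one]
    simp only [brstD, weilD, cartanD, LinearMap.sub_apply, LinearMap.add_apply, LinearMap.sum_apply,
      LinearMap.comp_apply, LinearMap.mulLeft_apply, map_sub, map_add, map_sum, omegaZero_omega_mul,
      Finset.sum_const_zero, add_zero, cartanIncl_tmul, Total.left, Total.rightOdd, Total.map_tmul,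
      AlgHom.toLinearMap_apply, CartanTotal.map_tmul, LinearMap.id_apply, h2]
    simp only [map_mul, h2, omegaZero_tmul, h1, h0, zero_add, Weil.omegaZero_phi, CartanTotal.tmul_mul_tmul,
      one_mul]

/-- The BRST differential restricts to the Cartan differential: for invariant `y`, both
`ι_a δ y = 𝓛_a y - δ ι_a y` and `𝓛_a δ y` vanish, so that `δ y` is determined by its image under
`ω^a ↦ 0`. -/
theorem brstD_cartanIncl {y : CartanTotal 𝔤 R} (hy : y ∈ cartanAlgebra V) :
    brstD ξ V (cartanIncl 𝔤 R y) = cartanIncl 𝔤 R (cartanD ξ V y) := by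
  rw [← omegaZero_brstD_cartanIncl, eq_cartanIncl_of_contr ξ fun a => ?_]
  have h := congrArg (fun T => T (cartanIncl 𝔤 R y)) (leftContr_mul_brstD V ξ a)
  simp only [LinearMap.add_apply, Module.End.mul_apply] at h
  change Total.left (Weil.contr (ξ a)) _ + brstD ξ V (Total.left (Weil.contr (ξ a)) _) = _ at h
  rwa [left_contr_cartanIncl, map_zero, add_zero, totalLie_cartanIncl,
    (mem_cartanAlgebra_iff ξ V y).mp hy, map_zero] at h

theorem cartanD_mem {y : CartanTotal 𝔤 R} (hy : y ∈ cartanAlgebra V) :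
    cartanD ξ V y ∈ cartanAlgebra V := by
  refine (mem_cartanAlgebra_iff ξ V _).mpr fun a => cartanIncl_injective ?_
  have h := congrArg (fun T => T (cartanIncl 𝔤 R y)) (totalLie_mul_brstD V ξ a)
  simp only [Module.End.mul_apply] at h
  rw [← totalLie_cartanIncl, ← brstD_cartanIncl ξ V hy, h, totalLie_cartanIncl,
    (mem_cartanAlgebra_iff ξ V y).mp hy, map_zero, map_zero]

theorem cartanD_cartanD {y : CartanTotal 𝔤 R} (hy : y ∈ cartanAlgebra V) :
    cartanD ξ V (cartanD ξ V y) = 0 := by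
  refine cartanIncl_injective ?_
  rw [← brstD_cartanIncl ξ V (cartanD_mem ξ V hy), ← brstD_cartanIncl ξ V hy, map_zero]
  exact congrArg (fun T => T (cartanIncl 𝔤 R y)) (brstD_mul_brstD V ξ)

theorem sgn_cartanIncl (y : CartanTotal 𝔤 R) :
    Total.sgn (cartanIncl 𝔤 R y) = cartanIncl 𝔤 R (CartanTotal.sgn y) := by
  induction y using CartanTotal.induction with
  | zero => simp only [map_zero]
  | add x y hx hy => simp only [map_add, hx, hy]
  | tmul s η =>
    have h : (Weil.parity 𝔤).inv (Weil.tmul s 1) = Weil.tmul s 1 := by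
      rw [Weil.parity_tmul, map_one]
    rw [CartanTotal.sgn, CartanTotal.map_tmul, cartanIncl_tmul, cartanIncl_tmul, Total.sgn,
      Total.map_tmul, AlgHom.toLinearMap_apply, h]
    rfl

/-- On invariant elements `j` identifies `D` with the restriction of `δ`, which yields the Leibniz
rule. -/
theorem cartanD_mul {x y : CartanTotal 𝔤 R} (hx : x ∈ cartanAlgebra V)
    (hy : y ∈ cartanAlgebra V) :
    cartanD ξ V (x * y) = cartanD ξ V x * y + CartanTotal.sgn x * cartanD ξ V y := by
  refine cartanIncl_injective ?_
  rw [← brstD_cartanIncl ξ V ((cartanAlgebra V).mul_mem hx hy), map_mul, brstD_mul,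
    brstD_cartanIncl ξ V hx, brstD_cartanIncl ξ V hy, map_add, map_mul, map_mul, sgn_cartanIncl]

theorem weilD_mem {x : Total 𝔤 R} (hx : x ∈ weilBasic ξ V) : weilD ξ x ∈ weilBasic ξ V := by
  refine ⟨fun a => ?_, fun a => ?_⟩
  · have h := congrArg (fun T => T x) (totalContr_mul_d V ξ a)
    simp only [LinearMap.add_apply, Module.End.mul_apply] at h
    rwa [hx.1 a, hx.2 a, map_zero, add_zero] at h
  · have h := congrArg (fun T => T x) (totalLie_mul_d V ξ a)
    simp only [Module.End.mul_apply] at h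
    rw [h, hx.2 a, map_zero]

/-- `ψ` intertwines the conditions defining the two models. -/
theorem psi_mem_weilBasic_iff (x : Total 𝔤 R) :
    psi ξ V x ∈ weilBasic ξ V ↔ x ∈ cartanIncl 𝔤 R '' cartanAlgebra V := by
  have h1 : ∀ a, totalContr ξ V a (psi ξ V x) = psi ξ V (Total.left (Weil.contr (ξ a)) x) :=
    fun a => congrArg (fun T => T x) (totalContr_mul_psi V ξ a)
  have h2 : ∀ a, totalLie ξ V a (psi ξ V x) = psi ξ V (totalLie ξ V a x) :=
    fun a => congrArg (fun T => T x) (totalLie_mul_psi V ξ a)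
  have h3 : ∀ z, psi ξ V z = 0 ↔ z = 0 := fun z => map_eq_zero_iff _ (psi_injective V ξ)
  rw [image_cartanAlgebra ξ V]
  change ((∀ a, totalContr ξ V a _ = 0) ∧ ∀ a, totalLie ξ V a _ = 0) ↔ _
  simp only [h1, h2, h3]
  rfl

theorem psi_image : psi ξ V '' (cartanIncl 𝔤 R '' cartanAlgebra V) = weilBasic ξ V := by
  ext x
  constructor
  · rintro ⟨z, hz, rfl⟩
    exact (psi_mem_weilBasic_iff ξ V z).mpr hz
  · intro hx
    refine ⟨psiInv V ξ x, (psi_mem_weilBasic_iff ξ V _).mp ?_, psi_psiInv V ξ x⟩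
    rwa [psi_psiInv]

/-- On basic elements, the inverse of `ψ` is given by `ω^a ↦ 0`. -/
theorem psiInv_eq {x : Total 𝔤 R} (hx : x ∈ weilBasic ξ V) :
    psiInv V ξ x = cartanIncl 𝔤 R (omegaZero 𝔤 R x) := by
  rw [← SetLike.mem_coe, ← psi_image] at hx
  obtain ⟨_, ⟨y, -, rfl⟩, rfl⟩ := hx
  rw [psiInv_psi, omegaZero_psi, omegaZero_cartanIncl]

theorem psi_cartanIncl_mem {y : CartanTotal 𝔤 R} (hy : y ∈ cartanAlgebra V) :
    psi ξ V (cartanIncl 𝔤 R y) ∈ weilBasic ξ V :=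
  (psi_mem_weilBasic_iff ξ V _).mpr ⟨y, hy, rfl⟩

theorem psi_cartanIncl_omegaZero {x : Total 𝔤 R} (hx : x ∈ weilBasic ξ V) :
    psi ξ V (cartanIncl 𝔤 R (omegaZero 𝔤 R x)) = x := by
  rw [← psiInv_eq ξ V hx, psi_psiInv]

theorem omegaZero_mem {x : Total 𝔤 R} (hx : x ∈ weilBasic ξ V) :
    omegaZero 𝔤 R x ∈ cartanAlgebra V := by
  rw [← psi_cartanIncl_omegaZero ξ V hx, psi_mem_weilBasic_iff] at hx
  obtain ⟨y, hy, h⟩ := hx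
  rwa [← cartanIncl_injective h]

/-- On the basic subalgebra `p` intertwines `d` with `D`. -/
theorem cartanD_omegaZero {x : Total 𝔤 R} (hx : x ∈ weilBasic ξ V) :
    cartanD ξ V (omegaZero 𝔤 R x) = omegaZero 𝔤 R (weilD ξ x) := by
  nth_rewrite 2 [← psi_cartanIncl_omegaZero ξ V hx]
  rw [← psi_brstD, omegaZero_psi, omegaZero_brstD_cartanIncl]

/-- The isomorphism `ω^a ↦ 0` from the Weil model to the Cartan model. -/
def basicEquiv : weilBasic ξ V ≃ₐ[ℝ] cartanAlgebra V where
  toFun x := ⟨omegaZero 𝔤 R x, omegaZero_mem ξ V x.2⟩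
  invFun y := ⟨psi ξ V (cartanIncl 𝔤 R y), psi_cartanIncl_mem ξ V y.2⟩
  left_inv x := Subtype.ext (psi_cartanIncl_omegaZero ξ V x.2)
  right_inv y := Subtype.ext (by
    change omegaZero 𝔤 R (psi ξ V (cartanIncl 𝔤 R y)) = y
    rw [omegaZero_psi, omegaZero_cartanIncl])
  map_mul' x y := Subtype.ext (map_mul (omegaZero 𝔤 R) (x : Total 𝔤 R) y)
  map_add' x y := Subtype.ext (map_add (omegaZero 𝔤 R) (x : Total 𝔤 R) y)
  commutes' c := Subtype.ext ((omegaZero 𝔤 R).commutes c)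

end Horizontal

/-! ### Degrees -/

section DegreeCalculus

variable {𝔤 : Type*} [LieRing 𝔤] [LieAlgebra ℝ 𝔤] {R : Type*} [CommRing R] [Algebra ℝ R]

/-- A property of the elements of `Λ^{q+1}` may be checked on products `l ∧ a` with `a ∈ Λ^q`. -/
theorem Ext.succ_induction {q : ℕ} {P : Ext 𝔤 → Prop}
    (mul : ∀ l, ∀ a ∈ (⋀[ℝ]^q (Module.Dual ℝ 𝔤) : Submodule ℝ (Ext 𝔤)),
      P (ExteriorAlgebra.ι ℝ l * a))
    (add : ∀ a b, P a → P b → P (a + b)) {a : Ext 𝔤}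
    (ha : a ∈ (⋀[ℝ]^(q + 1) (Module.Dual ℝ 𝔤) : Submodule ℝ (Ext 𝔤))) : P a := by
  rw [ExteriorAlgebra.exteriorPower, pow_succ'] at ha
  refine Submodule.mul_induction_on ha ?_ add
  rintro _ ⟨l, rfl⟩ a ha
  exact mul l a ha

theorem Ext.eq_algebraMap {a : Ext 𝔤}
    (ha : a ∈ (⋀[ℝ]^0 (Module.Dual ℝ 𝔤) : Submodule ℝ (Ext 𝔤))) :
    ∃ c : ℝ, algebraMap ℝ (Ext 𝔤) c = a := by
  rwa [ExteriorAlgebra.exteriorPower, pow_zero, Submodule.mem_one] at ha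

theorem Ext.one_mem : (1 : Ext 𝔤) ∈ (⋀[ℝ]^0 (Module.Dual ℝ 𝔤) : Submodule ℝ (Ext 𝔤)) := by
  rw [ExteriorAlgebra.exteriorPower, pow_zero]
  exact Submodule.one_le.mp le_rfl

theorem Ext.ι_mul_mem (l : Module.Dual ℝ 𝔤) {q : ℕ} {a : Ext 𝔤}
    (ha : a ∈ (⋀[ℝ]^q (Module.Dual ℝ 𝔤) : Submodule ℝ (Ext 𝔤))) :
    ExteriorAlgebra.ι ℝ l * a ∈ (⋀[ℝ]^(q + 1) (Module.Dual ℝ 𝔤) : Submodule ℝ (Ext 𝔤)) := by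
  rw [ExteriorAlgebra.exteriorPower, pow_succ']
  exact Submodule.mul_mem_mul ⟨l, rfl⟩ ha

theorem Ext.contr_of_mem_zero (z : 𝔤) {a : Ext 𝔤}
    (ha : a ∈ (⋀[ℝ]^0 (Module.Dual ℝ 𝔤) : Submodule ℝ (Ext 𝔤))) : Ext.contr z a = 0 := by
  obtain ⟨c, rfl⟩ := Ext.eq_algebraMap ha
  exact CliffordAlgebra.contractLeft_algebraMap (Q := (0 : QuadraticForm ℝ (Module.Dual ℝ 𝔤))) _ c

theorem Ext.contr_mem (z : 𝔤) {q : ℕ} {a : Ext 𝔤}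
    (ha : a ∈ (⋀[ℝ]^(q + 1) (Module.Dual ℝ 𝔤) : Submodule ℝ (Ext 𝔤))) :
    Ext.contr z a ∈ (⋀[ℝ]^q (Module.Dual ℝ 𝔤) : Submodule ℝ (Ext 𝔤)) := by
  have hι : ∀ l (a : Ext 𝔤), Ext.contr z (ExteriorAlgebra.ι ℝ l * a) =
      l z • a - ExteriorAlgebra.ι ℝ l * Ext.contr z a := fun l a =>
    CliffordAlgebra.contractLeft_ι_mul (Q := (0 : QuadraticForm ℝ (Module.Dual ℝ 𝔤))) _ _ _
  induction q generalizing a with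
  | zero =>
    refine Ext.succ_induction (P := fun a => Ext.contr z a ∈
      (⋀[ℝ]^_ (Module.Dual ℝ 𝔤) : Submodule ℝ (Ext 𝔤))) (fun l b hb => ?_) (fun a b h h' => ?_) ha
    · rw [hι, Ext.contr_of_mem_zero z hb, mul_zero, sub_zero]
      exact Submodule.smul_mem _ _ hb
    · rw [map_add]; exact Submodule.add_mem _ h h'
  | succ q ih =>
    refine Ext.succ_induction (P := fun a => Ext.contr z a ∈
      (⋀[ℝ]^_ (Module.Dual ℝ 𝔤) : Submodule ℝ (Ext 𝔤))) (fun l b hb => ?_) (fun a b h h' => ?_) ha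
    · rw [hι]
      exact Submodule.sub_mem _ (Submodule.smul_mem _ _ hb) (Ext.ι_mul_mem l (ih hb))
    · rw [map_add]; exact Submodule.add_mem _ h h'

theorem Ext.involute_mem {q : ℕ} {a : Ext 𝔤}
    (ha : a ∈ (⋀[ℝ]^q (Module.Dual ℝ 𝔤) : Submodule ℝ (Ext 𝔤))) :
    (CliffordAlgebra.involute a : Ext 𝔤) ∈
      (⋀[ℝ]^q (Module.Dual ℝ 𝔤) : Submodule ℝ (Ext 𝔤)) := by
  induction q generalizing a with
  | zero =>
    obtain ⟨c, rfl⟩ := Ext.eq_algebraMap ha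
    rwa [AlgHom.commutes]
  | succ q ih =>
    refine Ext.succ_induction (P := fun a => (CliffordAlgebra.involute a : Ext 𝔤) ∈
      (⋀[ℝ]^(q + 1) (Module.Dual ℝ 𝔤) : Submodule ℝ (Ext 𝔤))) (fun l b hb => ?_) (fun a b h h' => ?_) ha
    · rw [map_mul]
      have h : (CliffordAlgebra.involute (ExteriorAlgebra.ι ℝ l) : Ext 𝔤) =
        -ExteriorAlgebra.ι ℝ l := CliffordAlgebra.involute_ι l
      rw [h, neg_mul]
      exact Submodule.neg_mem _ (Ext.ι_mul_mem l (ih hb))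
    · rw [map_add]; exact Submodule.add_mem _ h h'

theorem Ext.algebraMapInv_of_mem_succ {q : ℕ} {a : Ext 𝔤}
    (ha : a ∈ (⋀[ℝ]^(q + 1) (Module.Dual ℝ 𝔤) : Submodule ℝ (Ext 𝔤))) :
    ExteriorAlgebra.algebraMapInv a = 0 := by
  refine Ext.succ_induction (P := fun a => ExteriorAlgebra.algebraMapInv a = 0)
    (fun l b hb => ?_) (fun a b h h' => ?_) ha
  · have h : ExteriorAlgebra.algebraMapInv (R := ℝ) (ExteriorAlgebra.ι ℝ l) = 0 :=
      ExteriorAlgebra.lift_ι_apply _ _ _ _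
    rw [map_mul, h, zero_mul]
  · rw [map_add, h, h', add_zero]

theorem Sym.ι_mul_mem (l : Module.Dual ℝ 𝔤) {p : ℕ} {s : Sym 𝔤} (hs : s ∈ Sym.polyDeg 𝔤 p) :
    SymmetricAlgebra.ι ℝ _ l * s ∈ Sym.polyDeg 𝔤 (p + 1) := by
  rw [Sym.polyDeg, pow_succ']
  exact Submodule.mul_mem_mul ⟨l, rfl⟩ hs

theorem Sym.lie_mem (x : 𝔤) {p : ℕ} {s : Sym 𝔤} (hs : s ∈ Sym.polyDeg 𝔤 p) :
    Sym.lie x s ∈ Sym.polyDeg 𝔤 p := by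
  induction p generalizing s with
  | zero =>
    rw [Sym.polyDeg, pow_zero, Submodule.mem_one] at hs
    obtain ⟨c, rfl⟩ := hs
    rw [Derivation.map_algebraMap]
    exact Submodule.zero_mem _
  | succ p ih =>
    have hs' := hs
    rw [Sym.polyDeg, pow_succ'] at hs'
    refine Submodule.mul_induction_on hs' ?_ fun a b h h' => ?_
    · rintro _ ⟨l, rfl⟩ t ht
      rw [Derivation.leibniz, Sym.lie, symDerivation_ι, smul_eq_mul, smul_eq_mul, mul_comm t]
      exact Submodule.add_mem _ (Sym.ι_mul_mem l (ih ht)) (Sym.ι_mul_mem _ ht)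
    · rw [map_add]; exact Submodule.add_mem _ h h'

theorem Weil.tmul_mem {p q : ℕ} {s : Sym 𝔤} {a : Ext 𝔤} (hs : s ∈ Sym.polyDeg 𝔤 p)
    (ha : a ∈ (⋀[ℝ]^q (Module.Dual ℝ 𝔤) : Submodule ℝ (Ext 𝔤))) {n : ℕ} (h : 2 * p + q = n) :
    Weil.tmul s a ∈ Weil.deg 𝔤 n :=
  Submodule.subset_span ⟨p, q, h, s, hs, a, ha, rfl⟩

/-- A linear map on `W(𝔤)` may be controlled in degree `n` by its values on products. -/
theorem Weil.map_mem_of_tmul {N : Type*} [AddCommGroup N] [Module ℝ N] (T : Weil 𝔤 →ₗ[ℝ] N) {n : ℕ}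
    {F : Submodule ℝ N}
    (h : ∀ p q, 2 * p + q = n → ∀ s ∈ Sym.polyDeg 𝔤 p,
      ∀ a ∈ (⋀[ℝ]^q (Module.Dual ℝ 𝔤) : Submodule ℝ (Ext 𝔤)), T (Weil.tmul s a) ∈ F)
    {w : Weil 𝔤} (hw : w ∈ Weil.deg 𝔤 n) : T w ∈ F := by
  have h' : Weil.deg 𝔤 n ≤ F.comap T := Submodule.span_le.mpr (by
    rintro _ ⟨p, q, hpq, s, hs, a, ha, rfl⟩
    exact h p q hpq s hs a ha)
  exact h' hw

theorem Weil.omega_mul_mem (l : Module.Dual ℝ 𝔤) {n : ℕ} {w : Weil 𝔤} (hw : w ∈ Weil.deg 𝔤 n) :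
    Weil.omega l * w ∈ Weil.deg 𝔤 (n + 1) :=
  Weil.map_mem_of_tmul (LinearMap.mulLeft ℝ (Weil.omega l)) (fun p q h s hs a ha => by
    rw [LinearMap.mulLeft_apply, Weil.omega, Weil.tmul_mul_tmul, one_mul]
    exact Weil.tmul_mem hs (Ext.ι_mul_mem l ha) (by omega)) hw

theorem Weil.phi_mul_mem (l : Module.Dual ℝ 𝔤) {n : ℕ} {w : Weil 𝔤} (hw : w ∈ Weil.deg 𝔤 n) :
    Weil.phi l * w ∈ Weil.deg 𝔤 (n + 2) :=
  Weil.map_mem_of_tmul (LinearMap.mulLeft ℝ (Weil.phi l)) (fun p q h s hs a ha => by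
    rw [LinearMap.mulLeft_apply, Weil.phi, Weil.tmul_mul_tmul, one_mul]
    exact Weil.tmul_mem (Sym.ι_mul_mem l hs) ha (by omega)) hw

theorem Weil.symLie_mem (x : 𝔤) {n : ℕ} {w : Weil 𝔤} (hw : w ∈ Weil.deg 𝔤 n) :
    Weil.symLie x w ∈ Weil.deg 𝔤 n :=
  Weil.map_mem_of_tmul (Weil.symLie x) (fun _ _ h _ hs _ ha =>
    Weil.tmul_mem (Sym.lie_mem x hs) ha h) hw

theorem Weil.parity_mem {n : ℕ} {w : Weil 𝔤} (hw : w ∈ Weil.deg 𝔤 n) :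
    (Weil.parity 𝔤).inv w ∈ Weil.deg 𝔤 n :=
  Weil.map_mem_of_tmul (Weil.parity 𝔤).inv.toLinearMap (fun _ _ h _ hs _ ha =>
    Weil.tmul_mem hs (Ext.involute_mem ha) h) hw

theorem Weil.contr_mem (z : 𝔤) {n : ℕ} {w : Weil 𝔤} (hw : w ∈ Weil.deg 𝔤 (n + 1)) :
    Weil.contr z w ∈ Weil.deg 𝔤 n :=
  Weil.map_mem_of_tmul (Weil.contr z) (fun p q h s hs a ha => by
    rw [Weil.contr, Weil.map_tmul]
    cases q with
    | zero => rw [Ext.contr_of_mem_zero z ha, Weil.tmul_zero]; exact Submodule.zero_mem _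
    | succ q => exact Weil.tmul_mem hs (Ext.contr_mem z ha) (by omega)) hw

theorem Weil.contr_of_mem_zero (z : 𝔤) {w : Weil 𝔤} (hw : w ∈ Weil.deg 𝔤 0) :
    Weil.contr z w = 0 := by
  refine (Submodule.mem_bot ℝ).mp (Weil.map_mem_of_tmul (Weil.contr z) (fun p q h s hs a ha => ?_) hw)
  obtain rfl : q = 0 := by omega
  rw [Weil.contr, Weil.map_tmul, Ext.contr_of_mem_zero z ha, Weil.tmul_zero]
  exact Submodule.zero_mem _

section WeilDifferential

variable {ι : Type*} [Fintype ι] (ξ : Module.Basis ι ℝ 𝔤)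

theorem Weil.dOmega_mul_mem (a : ι) {n : ℕ} {w : Weil 𝔤} (hw : w ∈ Weil.deg 𝔤 n) :
    Weil.dOmega ξ a * w ∈ Weil.deg 𝔤 (n + 2) := by
  rw [Weil.dOmega, sub_mul, smul_mul_assoc, Finset.sum_mul]
  refine Submodule.sub_mem _ (Weil.phi_mul_mem _ hw) (Submodule.smul_mem _ _
    (Submodule.sum_mem _ fun b _ => ?_))
  rw [Finset.sum_mul]
  refine Submodule.sum_mem _ fun c _ => ?_
  rw [smul_mul_assoc, mul_assoc]
  exact Submodule.smul_mem _ _ (Weil.omega_mul_mem _ (Weil.omega_mul_mem _ hw))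

theorem Weil.d_mem {n : ℕ} {w : Weil 𝔤} (hw : w ∈ Weil.deg 𝔤 n) :
    Weil.d ξ w ∈ Weil.deg 𝔤 (n + 1) := by
  rw [Weil.d_apply]
  refine Submodule.add_mem _
    (Submodule.sum_mem _ fun b _ => Weil.omega_mul_mem _ (Weil.symLie_mem _ hw))
    (Submodule.sum_mem _ fun a _ => ?_)
  cases n with
  | zero => rw [Weil.contr_of_mem_zero _ hw, mul_zero]; exact Submodule.zero_mem _
  | succ n => exact Weil.dOmega_mul_mem ξ a (Weil.contr_mem _ hw)

end WeilDifferential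

theorem Total.tmul_mem {m k n : ℕ} {w : Weil 𝔤} {η : Forms R} (hw : w ∈ Weil.deg 𝔤 m)
    (hη : η ∈ Forms.deg R k) (h : m + k = n) : (w ᵍ⊗ₜ[ℝ] η : Total 𝔤 R) ∈ Total.deg 𝔤 R n :=
  Submodule.subset_span ⟨m, k, h, w, hw, η, hη, rfl⟩

theorem Total.map_mem_of_tmul {N : Type*} [AddCommGroup N] [Module ℝ N] (T : Total 𝔤 R →ₗ[ℝ] N)
    {n : ℕ} {F : Submodule ℝ N}
    (h : ∀ m k, m + k = n → ∀ w ∈ Weil.deg 𝔤 m, ∀ η ∈ Forms.deg R k, T (w ᵍ⊗ₜ[ℝ] η) ∈ F)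
    {x : Total 𝔤 R} (hx : x ∈ Total.deg 𝔤 R n) : T x ∈ F := by
  have h' : Total.deg 𝔤 R n ≤ F.comap T := Submodule.span_le.mpr (by
    rintro _ ⟨m, k, hmk, w, hw, η, hη, rfl⟩
    exact h m k hmk w hw η hη)
  exact h' hx

theorem cartanIncl_mem_deg {n : ℕ} {y : CartanTotal 𝔤 R} (hy : y ∈ CartanTotal.deg 𝔤 R n) :
    cartanIncl 𝔤 R y ∈ Total.deg 𝔤 R n := by
  have h : CartanTotal.deg 𝔤 R n ≤ (Total.deg 𝔤 R n).comap (cartanIncl 𝔤 R).toLinearMap :=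
    Submodule.span_le.mpr (by
      rintro _ ⟨p, k, hpk, s, hs, η, hη, rfl⟩
      exact Total.tmul_mem (Weil.tmul_mem hs Ext.one_mem (add_zero _)) hη hpk)
  exact h hy

theorem omegaZero_mem_deg {n : ℕ} {x : Total 𝔤 R} (hx : x ∈ Total.deg 𝔤 R n) :
    omegaZero 𝔤 R x ∈ CartanTotal.deg 𝔤 R n := by
  refine Total.map_mem_of_tmul (omegaZero 𝔤 R).toLinearMap (fun m k hmk w hw η hη => ?_) hx
  let T : Weil 𝔤 →ₗ[ℝ] CartanTotal 𝔤 R :=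
    { toFun := fun w => CartanTotal.tmul (Weil.omegaZero 𝔤 w) η
      map_add' := fun w w' => by rw [map_add, CartanTotal.add_tmul]
      map_smul' := fun c w => by
        rw [map_smul]
        exact (TensorProduct.smul_tmul' c (Weil.omegaZero 𝔤 w) η).symm }
  refine Weil.map_mem_of_tmul T (fun p q hpq s hs a ha => ?_) hw
  change CartanTotal.tmul (Weil.omegaZero 𝔤 (Weil.tmul s a)) η ∈ _
  rw [Weil.omegaZero_tmul]
  cases q with
  | zero =>
    obtain ⟨c, rfl⟩ := Ext.eq_algebraMap ha
    refine Submodule.subset_span ⟨p, k, by omega, _, ?_, η, hη, rfl⟩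
    rw [mul_comm, ← Algebra.smul_def]
    exact Submodule.smul_mem _ _ hs
  | succ q =>
    have h0 : CartanTotal.tmul (0 : Sym 𝔤) η = 0 := TensorProduct.zero_tmul _ η
    rw [Ext.algebraMapInv_of_mem_succ ha, map_zero, mul_zero, h0]
    exact Submodule.zero_mem _

variable {ι : Type*} [Fintype ι] (ξ : Module.Basis ι ℝ 𝔤)

theorem weilD_mem_deg {n : ℕ} {x : Total 𝔤 R} (hx : x ∈ Total.deg 𝔤 R n) :
    weilD ξ x ∈ Total.deg 𝔤 R (n + 1) :=
  Total.map_mem_of_tmul (weilD ξ) (fun m k h w hw η hη => by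
    rw [weilD, LinearMap.add_apply, Total.left, Total.rightOdd, Total.map_tmul, Total.map_tmul]
    exact Submodule.add_mem _ (Total.tmul_mem (Weil.d_mem ξ hw) hη (by omega))
      (Total.tmul_mem (Weil.parity_mem hw) (Forms.extD_mem_deg hη) (by omega))) hx

variable (V : 𝔤 →ₗ⁅ℝ⁆ VField R)

/-- `ω^a` raises the degree by one, and `ι_a` lowers it by one (it vanishes on functions). -/
theorem omegaContr_mem_deg {n : ℕ} {x : Total 𝔤 R} (hx : x ∈ Total.deg 𝔤 R n) :
    omegaContr ξ V x ∈ Total.deg 𝔤 R n := by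
  refine Total.map_mem_of_tmul (omegaContr ξ V) (fun m k h w hw η hη => ?_) hx
  rw [omegaContr_eq, LinearMap.sum_apply]
  refine Submodule.sum_mem _ fun a _ => ?_
  change ((Weil.omega (ξ.coord a) * (Weil.parity 𝔤).inv w) ᵍ⊗ₜ[ℝ]
    Forms.contr (V (ξ a)) η : Total 𝔤 R) ∈ _
  cases k with
  | zero =>
    rw [Forms.contr_deg_zero _ hη, ← zero_smul ℝ (0 : Forms R), Total.tmul_smul, zero_smul]
    exact Submodule.zero_mem _
  | succ k =>
    exact Total.tmul_mem (Weil.omega_mul_mem _ (Weil.parity_mem hw)) (Forms.contr_mem_deg _ hη)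
      (by omega)

theorem expSum_mem {B : Type*} [AddCommGroup B] [Module ℝ B] {F : Submodule ℝ B}
    {T : Module.End ℝ B} (hT : ∀ x ∈ F, T x ∈ F) (n : ℕ) {x : B} (hx : x ∈ F) :
    expSum n T x ∈ F := by
  rw [expSum, LinearMap.sum_apply]
  refine Submodule.sum_mem _ fun k hk => Submodule.smul_mem _ _ ?_
  clear hk
  induction k with
  | zero => exact hx
  | succ k ih => rw [pow_succ']; exact hT _ ih

/-- As `ω^a ι_a` has degree `0`, so has its exponential. -/
theorem psi_mem_deg {n : ℕ} {x : Total 𝔤 R} (hx : x ∈ Total.deg 𝔤 R n) :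
    psi ξ V x ∈ Total.deg 𝔤 R n :=
  expSum_mem (fun _ h => Submodule.neg_mem _ (omegaContr_mem_deg ξ V h)) _ hx

theorem psiInv_mem_deg {n : ℕ} {x : Total 𝔤 R} (hx : x ∈ Total.deg 𝔤 R n) :
    psiInv V ξ x ∈ Total.deg 𝔤 R n :=
  expSum_mem (fun _ h => omegaContr_mem_deg ξ V h) _ hx

/-- The degree of `δ` is that of its conjugate `d`. -/
theorem brstD_mem_deg {n : ℕ} {x : Total 𝔤 R} (hx : x ∈ Total.deg 𝔤 R n) :
    brstD ξ V x ∈ Total.deg 𝔤 R (n + 1) := by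
  rw [← psiInv_mul_d_mul_psi]
  exact psiInv_mem_deg ξ V (weilD_mem_deg ξ (psi_mem_deg ξ V hx))

/-- `D = p δ j`, where `p` and `j` preserve degrees. -/
theorem cartanD_mem_deg {n : ℕ} {y : CartanTotal 𝔤 R} (hy : y ∈ CartanTotal.deg 𝔤 R n) :
    cartanD ξ V y ∈ CartanTotal.deg 𝔤 R (n + 1) := by
  rw [← omegaZero_brstD_cartanIncl]
  exact omegaZero_mem_deg (brstD_mem_deg ξ V (cartanIncl_mem_deg hy))

end DegreeCalculus

/-! ### The four differential algebras -/

section Summary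

variable {𝔤 : Type*} [LieRing 𝔤] [LieAlgebra ℝ 𝔤] {R : Type*} [CommRing R] [Algebra ℝ R]
  {ι : Type*} [Fintype ι] (ξ : Module.Basis ι ℝ 𝔤) (V : 𝔤 →ₗ⁅ℝ⁆ VField R)

theorem isDifferential_weilD (C : Subalgebra ℝ (Total 𝔤 R)) (hC : ∀ x ∈ C, weilD ξ x ∈ C) :
    IsDifferential Total.sgn (Total.deg 𝔤 R) (weilD ξ) C where
  mem := hC
  degree _ _ _ := weilD_mem_deg ξ
  leibniz x _ y _ := weilD_mul ξ x y
  sq_zero x _ := congrArg (fun T => T x) (Total.d_mul_d ξ)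

theorem isDifferential_brstD :
    IsDifferential Total.sgn (Total.deg 𝔤 R) (brstD ξ V) ⊤ where
  mem _ _ := Algebra.mem_top
  degree _ _ _ := brstD_mem_deg ξ V
  leibniz x _ y _ := brstD_mul V ξ x y
  sq_zero x _ := congrArg (fun T => T x) (brstD_mul_brstD V ξ)

theorem isDifferential_cartanD :
    IsDifferential CartanTotal.sgn (CartanTotal.deg 𝔤 R) (cartanD ξ V) (cartanAlgebra V) where
  mem _ := cartanD_mem ξ V
  degree _ _ _ := cartanD_mem_deg ξ V
  leibniz _ hx _ hy := cartanD_mul ξ V hx hy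
  sq_zero _ := cartanD_cartanD ξ V

end Summary

/-! ### The isomorphism of the two models -/

section FundamentalFields

variable {k m : ℕ} {G : Type*} [TopologicalSpace G] [ChartedSpace (EuclideanSpace ℝ (Fin k)) G]
  [Group G] [LieGroup (𝓡 k) ∞ G]

/-- The fundamental vector fields, as a homomorphism of Lie algebras. -/
def fundHom (M : Type*) [TopologicalSpace M] [ChartedSpace (EuclideanSpace ℝ (Fin m)) M]
    [IsManifold (𝓡 m) ∞ M] [MulAction G M] [ContMDiffSMul (𝓡 k) (𝓡 m) ∞ G M] :
    GroupLieAlgebra (𝓡 k) G →ₗ⁅ℝ⁆ VField C^∞⟮𝓡 m, M; ℝ⟯ where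
  toFun := fundField M
  map_add' := fundField_add
  map_smul' := fundField_smul
  map_lie' {ξ η} := fundField_lie ξ η

end FundamentalFields
end EquivariantForms

end

theorem theorem1p2p2 {k m : ℕ}
    {G : Type*} [TopologicalSpace G] [ChartedSpace (EuclideanSpace ℝ (Fin k)) G] [Group G]
    [LieGroup (𝓡 k) ∞ G]
    {M : Type*} [TopologicalSpace M] [T2Space M] [ChartedSpace (EuclideanSpace ℝ (Fin m)) M]
    [IsManifold (𝓡 m) ∞ M] [MulAction G M] [ContMDiffSMul (𝓡 k) (𝓡 m) ∞ G M]
    {ι : Type*} [Fintype ι] (ξ : Module.Basis ι ℝ (GroupLieAlgebra (𝓡 k) G)) :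
    let V : GroupLieAlgebra (𝓡 k) G → VField C^∞⟮𝓡 m, M; ℝ⟯ := fundField M
    let d : Total (GroupLieAlgebra (𝓡 k) G) C^∞⟮𝓡 m, M; ℝ⟯ →ₗ[ℝ]
        Total (GroupLieAlgebra (𝓡 k) G) C^∞⟮𝓡 m, M; ℝ⟯ := weilD ξ
    let δ : Total (GroupLieAlgebra (𝓡 k) G) C^∞⟮𝓡 m, M; ℝ⟯ →ₗ[ℝ]
        Total (GroupLieAlgebra (𝓡 k) G) C^∞⟮𝓡 m, M; ℝ⟯ := brstD ξ V
    let D : CartanTotal (GroupLieAlgebra (𝓡 k) G) C^∞⟮𝓡 m, M; ℝ⟯ →ₗ[ℝ]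
        CartanTotal (GroupLieAlgebra (𝓡 k) G) C^∞⟮𝓡 m, M; ℝ⟯ := cartanD ξ V
    let j := cartanIncl (GroupLieAlgebra (𝓡 k) G) C^∞⟮𝓡 m, M; ℝ⟯
    let p := omegaZero (GroupLieAlgebra (𝓡 k) G) C^∞⟮𝓡 m, M; ℝ⟯
    let deg := Total.deg (GroupLieAlgebra (𝓡 k) G) C^∞⟮𝓡 m, M; ℝ⟯
    let cartanDeg := CartanTotal.deg (GroupLieAlgebra (𝓡 k) G) C^∞⟮𝓡 m, M; ℝ⟯
    -- the algebras `(A, d)` and `(B, δ)`, the basic subalgebra, and the Cartan model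
    IsDifferential Total.sgn deg d ⊤ ∧
    IsDifferential Total.sgn deg δ ⊤ ∧
    IsDifferential Total.sgn deg d (weilBasic ξ V) ∧
    IsDifferential CartanTotal.sgn cartanDeg D (cartanAlgebra V) ∧
    -- `S(𝔤*) ⊗ Ω(M)` is the algebra of the `ω`-independent elements of `B`, and
    -- `(S(𝔤*) ⊗ Ω(M))^G` that of the invariant ones; `δ` restricts to the Cartan differential
    Function.Injective j ∧
    Set.range j = { b | ∀ a, Total.left (Weil.contr (ξ a)) b = 0 } ∧
    j '' cartanAlgebra V =
      { b | (∀ a, Total.left (Weil.contr (ξ a)) b = 0) ∧ ∀ a, totalLie ξ V a b = 0 } ∧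
    (∀ y ∈ cartanAlgebra V, δ (j y) = j (D y)) ∧
    -- the exponential series defining `ψ` terminates
    omegaContr ξ V ^ (Fintype.card ι + 1) = 0 ∧
    -- `ψ` is an isomorphism `(B, δ) → (A, d)`
    ∃ Ψ : Total (GroupLieAlgebra (𝓡 k) G) C^∞⟮𝓡 m, M; ℝ⟯ ≃ₐ[ℝ]
        Total (GroupLieAlgebra (𝓡 k) G) C^∞⟮𝓡 m, M; ℝ⟯,
      (∀ x, Ψ x = psi ξ V x) ∧
      (∀ x, Ψ (δ x) = d (Ψ x)) ∧
      (∀ n x, Ψ x ∈ deg n ↔ x ∈ deg n) ∧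
      -- it maps the Cartan model onto the basic subalgebra, on which its inverse is `ω^a ↦ 0`
      Ψ '' (j '' cartanAlgebra V) = weilBasic ξ V ∧
      (∀ x ∈ weilBasic ξ V, Ψ.symm x = j (p x)) ∧
      -- the resulting isomorphism from the Weil model to the Cartan model
      ∃ e : weilBasic ξ V ≃ₐ[ℝ] cartanAlgebra V,
        (∀ x, (e x : CartanTotal _ _) = p x) ∧
        (∀ y, (e.symm y : Total _ _) = Ψ (j y)) ∧
        (∀ x, D (e x) = p (d x)) ∧
        (∀ n x, (e x : CartanTotal _ _) ∈ cartanDeg n ↔ (x : Total _ _) ∈ deg n) := by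
  intro V d δ D j p deg cartanDeg
  refine ⟨isDifferential_weilD ξ ⊤ fun _ _ => Algebra.mem_top, isDifferential_brstD ξ (fundHom M),
    isDifferential_weilD ξ _ fun _ => weilD_mem ξ (fundHom M),
    isDifferential_cartanD ξ (fundHom M), cartanIncl_injective, range_cartanIncl ξ,
    image_cartanAlgebra ξ (fundHom M), fun _ => brstD_cartanIncl ξ (fundHom M),
    omegaContr_pow (fundHom M) ξ, psiEquiv (fundHom M) ξ, fun _ => rfl,
    psi_brstD (fundHom M) ξ, fun n x => ⟨fun h => ?_, psi_mem_deg ξ (fundHom M)⟩,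
    psi_image ξ (fundHom M), fun _ => psiInv_eq ξ (fundHom M), basicEquiv ξ (fundHom M),
    fun _ => rfl, fun _ => rfl, fun x => cartanD_omegaZero ξ (fundHom M) x.2,
    fun n x => ⟨fun h => ?_, omegaZero_mem_deg⟩⟩
  · rw [← psiInv_psi (fundHom M) ξ x]
    exact psiInv_mem_deg ξ (fundHom M) h
  · rw [← psi_cartanIncl_omegaZero ξ (fundHom M) x.2]
    exact psi_mem_deg ξ (fundHom M) (cartanIncl_mem_deg h)
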